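/- **Setting.** Let $X$ be a proper geodesic metric space with base point $\mathfrak o$, write $\|x\|=d(x,\mathfrak o)$, and let $\kappa:[0,\infty)\to[1,\infty)$ be monotone increasing, concave and sublinear ($\kappa(t)/t\to 0$); $\kappa(x)$ means $\kappa(\|x\|)$. CAT(0) cube complexes $Q$ are considered through their vertices, with the combinatorial metric and the median $m_Q$ of their $1$-skeleton (a median graph). *Coarse medians.* $X$ is a coarse median space of rank at most $r$: there are $m:X^3\to X$ and $h:\mathbb N\to\mathbb R$ such that $d(m(x,y,z),m(x',y',z'))\le h(1)\,(d(x,x')+d(y,y')+d(z,z'))+h(1)$, and for every nonempty $A\subseteq X$ with $|A|\le n$ there are a finite CAT(0) cube complex $Q$ of dimension at most $r$ and maps $f:Q\to X$, $g:A\to Q$ with $d(f(m_Q(a,b,c)),m(f(a),f(b),f(c)))\le h(n)$ for $a,b,c\in Q$ and $d(a,f(g(a)))\le h(n)$ for $a\in A$. For $A\subseteq X$ put $[x,y]=\{m(x,y,z):z\in X\}$, $J(A)=\bigcup_{x,y\in A}[x,y]$ and $\mathrm{hull}(A)=J^r(A)$. In a CAT(0) cube complex of dimension at most $v$, hulls are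 formed as $J^v$, with respect to $m_Q$. *LQC.* A $K$-cubical model ($K\ge1$) of $H\subseteq X$ is a CAT(0) cube complex $Q$ of dimension at most $v$ with a $(K,K)$-quasi-isometry $f:Q\to H$ that preserves medians up to an error of at most $K$. $X$ is locally quasi-cubical of dimension $v\geq 1$: for every nonempty finite $F\subseteq X$, $\mathrm{hull}(F)$ has a $K$-cubical model with $K$ depending only on $|F|$. *Rays.* An $(a,b)$-quasi-geodesic ($a\ge1$, $b\ge0$) is a continuous $(a,b)$-quasi-isometric embedding of an interval; it is a quasi-geodesic ray if the interval is $[0,\infty)$. A $\lambda$-median ray is a $(\lambda,\lambda)$-quasi-isometric embedding $h:[0,\infty)\to X$, $\lambda\ge1$, that preserves medians up to an error of at most $\lambda$. Rays are identified with their images. Put $\mathcal N_\kappa(Z,n)=\{x: d(x,Z)\le n\,\kappa(x)\}$. The ray $h$ represents $q$ if each of them lies in some $\kappa$-neighbourhood $\mathcal N_\kappa(\cdot,n)$ of the other. *Morseness.* Let $Z\subseteq X$ be closed. - $Z$ is *weakly $\kappa$-Morse* if there is a function $\mathtt m_Z(a,b)$ such that every $(a,b)$-quasi-geodesic segment with endpoints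 on $Z$ lies in $\mathcal N_\kappa(Z,\mathtt m_Z(a,b))$. - $Z$ is *$\kappa$-Morse* if there is a positive function $\mathtt m_Z(a,b)$, proper (preimages of bounded sets are bounded), such that for every sublinear $\kappa':[0,\infty)\to[1,\infty)$ and every $r>0$ there is $R\ge r$ such that for every $(a,b)$-quasi-geodesic ray $\beta$ from $\mathfrak o$ with $\mathtt m_Z(a,b)\le r/(2\kappa(r))$: if $d(\beta_R,Z)\le\kappa'(R)$, then $\beta|_r\subseteq\mathcal N_\kappa(Z,\mathtt m_Z(a,b))$. Here $\beta_R$ is the first point of $\beta$ at distance $R$ from $\mathfrak o$, and $\beta|_r$ is the part of $\beta$ up to $\beta_r$. - A *$\kappa$-projection* to $Z$ (not necessarily closed) is a map $\pi$ from $X$ to the nonempty subsets of $Z$ with $\mathrm{diam}(\{x\}\cup\pi(x))\le(D_1+1)\,d(x,Z)+D_2\,\kappa(x)$ for all $x$ and some constants $D_1,D_2\ge0$. $Z$ is *$\kappa$-contracting with respect to $\pi$* if moreover there are $C_1>0$ and $C_2$ such that $d(x,y)<C_1\,d(x,Z)$ implies $\mathrm{diam}(\pi(x)\cup\pi(y))\le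 C_2\,\kappa(x)$. A closed $Z$ is *$\kappa$-contracting* if this holds for some $\kappa$-projection. *Cubical gates.* Let $H=\mathrm{hull}(h)$ for a median ray $h$. A map $G:X\to H$ is a *cubical gate map* if there is a constant $C$ such that for each $x\in X$ there are a point $y\in X$, a $C$-cubical model $f:Q\to\mathrm{hull}(h\cup\{x,y\})$ and a coarse inverse $g$ of $f$, defined also on $h\cup\{x,y\}$, with $d(z,f(g(z)))\le C$, such that the hull $A$ of $g(h)$ in $Q$ satisfies $f(A)\subseteq H$, and $G(x)=f(P_A(g(x)))$, where $P_A$ is the combinatorial nearest point projection to $A$. **Theorem.** Let $q$ be a quasi-geodesic ray in $X$ with $q(0)=\mathfrak o$. The following are equivalent, with the same $\kappa$: 1. $q$ is $\kappa$-Morse; 2. $q$ is $\kappa$-contracting; 3. $q$ is weakly $\kappa$-Morse. Moreover, if one of these holds and $h$ is any $\lambda$-median ray (for any $\lambda\ge1$) representing $q$, then there is a coarsely Lipschitz cubical gate map $G_H:X\to H=\mathrm{hull}(h)$ with respect to which $H$ is $\kappa$-contracting (via $x\mapsto\{G_H(x)\}$), and there are constants $C_2>0$ and $C_3$ such that for all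 $x,y\in X$, $$d(x,y)\le C_2\,d(x,H)\ \Longrightarrow\ d(G_H(x),G_H(y))\le C_3\,\kappa(x).$$ -/

import Mathlib

open Set Filter Topology

/-! ### CAT(0) cube complexes -/

/-- The 1-skeleton of the `n`-cube `[0,1]^n`. -/
def hypercubeGraph (n : ℕ) : SimpleGraph (Fin n → Bool) where
  Adj a b := hammingDist a b = 1
  symm := ⟨fun a b h => by rw [hammingDist_comm]; exact h⟩
  loopless := ⟨fun a h => by simp at h⟩

/-- `p` lies on combinatorial geodesics between each two of `x`, `y`, `z`. -/
def IsGraphMedian {V : Type*} (G : SimpleGraph V) (x y z p : V) : Prop :=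
  G.dist x p + G.dist p y = G.dist x y ∧
  G.dist y p + G.dist p z = G.dist y z ∧
  G.dist x p + G.dist p z = G.dist x z

universe u w

/-- A CAT(0) cube complex, given by its 1-skeleton with the combinatorial metric.  The 1-skeleta of
CAT(0) cube complexes are exactly the median graphs (connected graphs in which any three vertices
have a unique median), and the complex is recovered by filling every `n`-cube subgraph with
an `n`-cube.  The metric of the complex is the combinatorial one, `oneSkeleton.dist`. -/
structure CATZeroCubeComplex where
  Vertex : Type w
  oneSkeleton : SimpleGraph Vertex
  connected : oneSkeleton.Connected
  existsUnique_median : ∀ x y z : Vertex, ∃! p, IsGraphMedian oneSkeleton x y z p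

namespace CATZeroCubeComplex

/-- The median of three vertices. -/
noncomputable def median (Q : CATZeroCubeComplex.{w}) (x y z : Q.Vertex) : Q.Vertex :=
  (Q.existsUnique_median x y z).choose

theorem isGraphMedian_median (Q : CATZeroCubeComplex.{w}) (x y z : Q.Vertex) :
    IsGraphMedian Q.oneSkeleton x y z (Q.median x y z) :=
  (Q.existsUnique_median x y z).choose_spec.1

/-- All cubes of `Q` have dimension at most `v`. -/
def DimLE (Q : CATZeroCubeComplex.{w}) (v : ℕ) : Prop :=
  ∀ n : ℕ, Nonempty (hypercubeGraph n ↪g Q.oneSkeleton) → n ≤ v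

/-- `p` is a combinatorial nearest point projection (gate) of the vertex `x` to `A`. -/
def IsGate (Q : CATZeroCubeComplex.{w}) (A : Set Q.Vertex) (x p : Q.Vertex) : Prop :=
  p ∈ A ∧ ∀ a ∈ A, Q.oneSkeleton.dist x p ≤ Q.oneSkeleton.dist x a

end CATZeroCubeComplex

/-! ### Intervals, joins and hulls of a ternary operation -/

/-- The median interval `[x,y] = {m(x,y,z) | z}`. -/
def medianInterval {α : Type*} (m : α → α → α → α) (x y : α) : Set α :=
  {p | ∃ z, p = m x y z}

/-- The median join `J(A)`, the union of all `[x,y]` with `x, y ∈ A`. -/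
def medianJoin {α : Type*} (m : α → α → α → α) (A : Set α) : Set α :=
  ⋃ x ∈ A, ⋃ y ∈ A, medianInterval m x y

/-- The median hull `J^r(A)` in a (coarse) median space of rank (at most) `r`. -/
def medianHull {α : Type*} (m : α → α → α → α) (r : ℕ) (A : Set α) : Set α :=
  (medianJoin m)^[r] A

/-! ### Coarse median spaces and local quasi-cubicality -/

/-- `m` is a coarse median on the metric space `X`, of rank at most `r`: it is coarsely
Lipschitz, and on finite sets it is approximated by medians of finite CAT(0) cube complexes
of dimension at most `r`. -/
def IsCoarseMedian {X : Type u} [MetricSpace X] (m : X → X → X → X) (r : ℕ) : Prop :=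
  ∃ h : ℕ → ℝ,
    (∀ x y z x' y' z' : X,
      dist (m x y z) (m x' y' z') ≤ h 1 * (dist x x' + dist y y' + dist z z') + h 1) ∧
    ∀ (n : ℕ) (A : Finset X), A.Nonempty → A.card ≤ n →
      ∃ Q : CATZeroCubeComplex.{0}, Finite Q.Vertex ∧ Q.DimLE r ∧
        ∃ (f : Q.Vertex → X) (g : X → Q.Vertex),
          (∀ a b c, dist (f (Q.median a b c)) (m (f a) (f b) (f c)) ≤ h n) ∧
          ∀ a ∈ A, dist a (f (g a)) ≤ h n

/-- `f : Q → H` is a `K`-median `(K,K)`-quasi-isometry from the CAT(0) cube complex `Q`, of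
dimension at most `v`, to the subset `H` of the coarse median space `(X, m)`. -/
structure IsCubicalModel {X : Type u} [MetricSpace X] (m : X → X → X → X) (v : ℕ) (K : ℝ)
    (H : Set X) (Q : CATZeroCubeComplex.{w}) (f : Q.Vertex → X) : Prop where
  dimLE : Q.DimLE v
  one_le : 1 ≤ K
  mapsTo : ∀ a, f a ∈ H
  lower : ∀ a b, (Q.oneSkeleton.dist a b : ℝ) / K - K ≤ dist (f a) (f b)
  upper : ∀ a b, dist (f a) (f b) ≤ K * (Q.oneSkeleton.dist a b : ℝ) + K
  coarselyOnto : ∀ p ∈ H, ∃ a, dist p (f a) ≤ K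
  median : ∀ a b c, dist (f (Q.median a b c)) (m (f a) (f b) (f c)) ≤ K

/-- The coarse median space `(X, m)` of rank at most `r` is locally quasi-cubical of
dimension `v`. -/
def IsLocallyQuasiCubical {X : Type u} [MetricSpace X] (m : X → X → X → X) (r v : ℕ) : Prop :=
  0 < v ∧ ∃ K : ℕ → ℝ, ∀ F : Finset X, F.Nonempty →
    ∃ (Q : CATZeroCubeComplex.{w}) (f : Q.Vertex → X),
      IsCubicalModel m v (K F.card) (medianHull m r (F : Set X)) Q f

/-! ### Geodesics, quasi-geodesics, median rays -/

/-- Any two points are joined by a geodesic segment. -/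
def IsGeodesicMetric (X : Type u) [MetricSpace X] : Prop :=
  ∀ x y : X, ∃ γ : ℝ → X, γ 0 = x ∧ γ (dist x y) = y ∧
    ∀ s ∈ Icc 0 (dist x y), ∀ t ∈ Icc 0 (dist x y), dist (γ s) (γ t) = |s - t|

/-- `β` restricted to `I ⊆ ℝ` is an `(a,b)`-quasi-isometric embedding. -/
def IsQIEmbeddingOn {X : Type u} [MetricSpace X] (a b : ℝ) (β : ℝ → X) (I : Set ℝ) : Prop :=
  1 ≤ a ∧ 0 ≤ b ∧ ∀ s ∈ I, ∀ t ∈ I,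
    |s - t| / a - b ≤ dist (β s) (β t) ∧ dist (β s) (β t) ≤ a * |s - t| + b

/-- `β` restricted to `I` is a (continuous) `(a,b)`-quasi-geodesic; it is a quasi-geodesic ray
when `I = [0,∞)`. -/
def IsQuasiGeodesicOn {X : Type u} [MetricSpace X] (a b : ℝ) (β : ℝ → X) (I : Set ℝ) : Prop :=
  ContinuousOn β I ∧ IsQIEmbeddingOn a b β I

/-- The point set of a ray. -/
def rayImage {X : Type u} (β : ℝ → X) : Set X := β '' Ici 0

/-- The median of three real numbers. -/
noncomputable def realMedian (s t u : ℝ) : ℝ := max (min s t) (min (max s t) u)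

/-- `h` (restricted to `[0,∞)`) is an `l`-median ray. -/
def IsMedianRay {X : Type u} [MetricSpace X] (m : X → X → X → X) (l : ℝ) (h : ℝ → X) : Prop :=
  IsQIEmbeddingOn l l h (Ici 0) ∧
  ∀ s ∈ Ici (0 : ℝ), ∀ t ∈ Ici (0 : ℝ), ∀ u ∈ Ici (0 : ℝ),
    dist (h (realMedian s t u)) (m (h s) (h t) (h u)) ≤ l

/-! ### Sublinear Morseness -/

/-- `κ : [0,∞) → [1,∞)` with `κ(t)/t → 0`. -/
def IsSublinear (κ : ℝ → ℝ) : Prop :=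
  (∀ t, 0 ≤ t → 1 ≤ κ t) ∧ Tendsto (fun t => κ t / t) atTop (𝓝 0)

/-- The `(κ,n)`-neighbourhood of `Z` with respect to the base point `o`. -/
def kappaNhd {X : Type u} [MetricSpace X] (o : X) (κ : ℝ → ℝ) (Z : Set X) (n : ℝ) : Set X :=
  {x | Metric.infDist x Z ≤ n * κ (dist x o)}

/-- `Z` and `Z'` are each contained in some `κ`-neighbourhood of the other. -/
def KappaFellowTravel {X : Type u} [MetricSpace X] (o : X) (κ : ℝ → ℝ) (Z Z' : Set X) : Prop :=
  (∃ n, Z ⊆ kappaNhd o κ Z' n) ∧ ∃ n, Z' ⊆ kappaNhd o κ Z n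

/-- `Z` is weakly `κ`-Morse. -/
def IsWeaklyKappaMorse {X : Type u} [MetricSpace X] (o : X) (κ : ℝ → ℝ) (Z : Set X) : Prop :=
  IsClosed Z ∧ ∃ M : ℝ → ℝ → ℝ, ∀ (a b : ℝ) (β : ℝ → X) (s t : ℝ), s ≤ t →
    IsQuasiGeodesicOn a b β (Icc s t) → β s ∈ Z → β t ∈ Z →
      β '' Icc s t ⊆ kappaNhd o κ Z (M a b)

/-- The first time at which `β` is at distance `R` from `o`. -/
noncomputable def firstTime {X : Type u} [MetricSpace X] (o : X) (β : ℝ → X) (R : ℝ) : ℝ :=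
  sInf {t | 0 ≤ t ∧ dist (β t) o = R}

/-- `D` is small compared to `r`: `D ≤ r / (2 κ(r))`. -/
def SmallComparedTo (κ : ℝ → ℝ) (D r : ℝ) : Prop := D ≤ r / (2 * κ r)

/-- The function `M` of the quasi-geodesic constants `a ≥ 1`, `b ≥ 0` is positive, and it is
proper: preimages of bounded sets are bounded. -/
def IsProperGauge (M : ℝ → ℝ → ℝ) : Prop :=
  (∀ a b, 1 ≤ a → 0 ≤ b → 0 < M a b) ∧
  ∀ B, ∃ N, ∀ a b, 1 ≤ a → 0 ≤ b → M a b ≤ B → a ≤ N ∧ b ≤ N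

/-- `Z` is `κ`-Morse.  For a ray `β` from `o`, `β_R = β (firstTime o β R)` and `β|_r` is the part
of `β` up to the time `firstTime o β r`. -/
def IsKappaMorse {X : Type u} [MetricSpace X] (o : X) (κ : ℝ → ℝ) (Z : Set X) : Prop :=
  IsClosed Z ∧ ∃ M : ℝ → ℝ → ℝ, IsProperGauge M ∧
    ∀ κ' : ℝ → ℝ, IsSublinear κ' → ∀ r : ℝ, 0 < r → ∃ R, r ≤ R ∧
      ∀ (a b : ℝ) (β : ℝ → X), IsQuasiGeodesicOn a b β (Ici 0) → β 0 = o →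
        SmallComparedTo κ (M a b) r →
        Metric.infDist (β (firstTime o β R)) Z ≤ κ' R →
        β '' Icc 0 (firstTime o β r) ⊆ kappaNhd o κ Z (M a b)

/-- `diam S ≤ c`. -/
def DiamLE {X : Type u} [MetricSpace X] (S : Set X) (c : ℝ) : Prop :=
  ∀ p ∈ S, ∀ p' ∈ S, dist p p' ≤ c

/-- `π` is a `κ`-projection to `Z`. Its values are nonempty subsets of `Z`. -/
def IsKappaProjection {X : Type u} [MetricSpace X] (o : X) (κ : ℝ → ℝ) (Z : Set X)
    (π : X → Set X) : Prop :=
  (∀ x, (π x).Nonempty ∧ π x ⊆ Z) ∧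
  ∃ D₁ D₂ : ℝ, 0 ≤ D₁ ∧ 0 ≤ D₂ ∧ ∀ x,
    DiamLE ({x} ∪ π x) ((D₁ + 1) * Metric.infDist x Z + D₂ * κ (dist x o))

/-- `Z` is `κ`-contracting with respect to the `κ`-projection `π`. -/
def IsKappaContractingWith {X : Type u} [MetricSpace X] (o : X) (κ : ℝ → ℝ) (Z : Set X)
    (π : X → Set X) : Prop :=
  IsKappaProjection o κ Z π ∧
  ∃ C₁ C₂ : ℝ, 0 < C₁ ∧ ∀ x y, dist x y < C₁ * Metric.infDist x Z →
    DiamLE (π x ∪ π y) (C₂ * κ (dist x o))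

/-- The closed set `Z` is `κ`-contracting. -/
def IsKappaContracting {X : Type u} [MetricSpace X] (o : X) (κ : ℝ → ℝ) (Z : Set X) : Prop :=
  IsClosed Z ∧ ∃ π : X → Set X, IsKappaContractingWith o κ Z π

/-! ### Cubical gate maps -/

/-- `G : X → hull(Y)` is a cubical gate map: with a constant `C` that serves all points, for each
`x` there are an auxiliary point `y` and a cubical model `f : Q → hull(Y ∪ {x,y})` with
coarse inverse `g`, such that `f` maps the hull `A` of `g(Y)` in `Q` into `hull(Y)`, and `G x` is
the image under `f` of the combinatorial nearest point projection of `g x` to `A`. -/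
def IsCubicalGateMap {X : Type u} [MetricSpace X] (m : X → X → X → X) (r v : ℕ)
    (Y : Set X) (G : X → X) : Prop :=
  ∃ C : ℝ, ∀ x : X, ∃ (y : X) (Q : CATZeroCubeComplex.{w}) (f : Q.Vertex → X)
      (g : X → Q.Vertex) (p : Q.Vertex),
    IsCubicalModel m v C (medianHull m r (Y ∪ {x, y})) Q f ∧
    (∀ z ∈ medianHull m r (Y ∪ {x, y}) ∪ (Y ∪ {x, y}), dist z (f (g z)) ≤ C) ∧
    (∀ a ∈ medianHull Q.median v (g '' Y), f a ∈ medianHull m r Y) ∧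
    Q.IsGate (medianHull Q.median v (g '' Y)) (g x) p ∧
    G x = f p

/-- `G` is coarsely Lipschitz. -/
def IsCoarselyLipschitz {X : Type u} [MetricSpace X] (G : X → X) : Prop :=
  ∃ L : ℝ, ∀ x y, dist (G x) (G y) ≤ L * dist x y + L

/-! Both Morse properties enter only through `HasMorseRays`: a discrete quasi-geodesic ray that
starts near `o` and ends inside `Z` stays `κ`-close to `Z`. Surgery with an optimal shortcut
(`exists_shortcut`, `IsGeodesicMetric.exists_shortcut_ray`) strengthens this to
`HasMorseRays.exists_bound`: a finite coarse geodesic whose far end is within a small proportion of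
its length from the ray `q` still follows `q` on an initial part of definite proportion.

To get contraction, project `x` by the medians `m (u 0) (u n) x` for large `n`, where `u` runs to
infinity along `q`. In a cubical model of the hull of `u 0`, `u n`, `x`, `y`, median identities
produce a rectangle standing on the interval from `u 0` to `u n`. Its width is the distance of the
two projections, and its height can be anything up to a number that is at least the distance of `x`
from its projection minus the distance of `x` and `y` (`exists_isRectangleOver`). When the height
does not exceed the width, the path that climbs the rectangle, crosses its top and descends is a
quasi-geodesic with uniform constants, and its corner is as far from the interval as the rectangle
is high. The Morse property puts the corner `κ`-close to `q`, and `q` is `κ`-close to the interval,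
so the height is `O(κ)`. Hence either the projections of `x` and `y` are `κ`-close, or `x` is near
the interval compared to its distance from `y`. In the second case, if `y` is relatively close to
`x`, all distances involved are `O(κ)` and coarse Lipschitz continuity of `m` suffices. This is
`IsGuide.exists_dist_median_le`. It is used with `u = q` to make `q` contracting, and with `u = h`
for the hull of a median ray `h`.

Conversely, while a path stays far from a contracting set its projections drift more slowly than the
path advances, so its excursions are short (`IsKappaContractingWith.exists_excursion`). Between
endpoints in `Z` this is the weak Morse property. For rays whose point at radius `R` is only
sublinearly close to `Z`, an excursion that begins before radius `r` cannot last until radius `R`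
once `R` is large, which is the Morse property.

For the gate map, models of the hulls of `h 0`, `h n`, `x` have an ultraproduct that models the hull
of `h` and `x` (`IsMedianRay.exists_model`). The nearest point projection in it agrees up to bounded
error with `m (h 0) (h n) x`, so the same estimate applies. All median identities needed on the way
are truth-table checks: half-spaces embed a median graph in a power of the two-element median
algebra (`eval_eq`), and finite approximation carries the identities over to coarse medians
(`IsCoarseMedian.exists_dist_eval_le`). -/

/-! ### Half-spaces of median graphs -/

namespace CATZeroCubeComplex

variable {Q : CATZeroCubeComplex.{w}}

/-- The combinatorial distance. -/
noncomputable abbrev d (Q : CATZeroCubeComplex.{w}) (x y : Q.Vertex) : ℕ := Q.oneSkeleton.dist x y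

theorem d_comm (x y : Q.Vertex) : Q.d x y = Q.d y x := SimpleGraph.dist_comm

theorem d_self (x : Q.Vertex) : Q.d x x = 0 := SimpleGraph.dist_self

theorem d_triangle (x y z : Q.Vertex) : Q.d x z ≤ Q.d x y + Q.d y z := Q.connected.dist_triangle

theorem eq_of_d_eq_zero {x y : Q.Vertex} (h : Q.d x y = 0) : x = y :=
  Q.connected.dist_eq_zero_iff.1 h

theorem exists_step {x y : Q.Vertex} (h : x ≠ y) : ∃ z, Q.d x z = 1 ∧ Q.d z y + 1 = Q.d x y := by
  obtain ⟨p, hp⟩ := Q.connected.exists_walk_length_eq_dist x y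
  cases p with
  | nil => exact absurd rfl h
  | @cons _ z _ hadj p =>
    refine ⟨z, SimpleGraph.dist_eq_one_iff_adj.2 hadj, ?_⟩
    have h1 : Q.d z y ≤ p.length := SimpleGraph.dist_le p
    have h2 := Q.d_triangle x z y
    have h3 : Q.d x z = 1 := SimpleGraph.dist_eq_one_iff_adj.2 hadj
    have h4 : p.length + 1 = Q.d x y := hp
    omega

theorem median_spec (x y z : Q.Vertex) :
    Q.d x (Q.median x y z) + Q.d (Q.median x y z) y = Q.d x y ∧
    Q.d y (Q.median x y z) + Q.d (Q.median x y z) z = Q.d y z ∧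
    Q.d x (Q.median x y z) + Q.d (Q.median x y z) z = Q.d x z := Q.isGraphMedian_median x y z

theorem median_unique {x y z p : Q.Vertex} (h1 : Q.d x p + Q.d p y = Q.d x y)
    (h2 : Q.d y p + Q.d p z = Q.d y z) (h3 : Q.d x p + Q.d p z = Q.d x z) :
    Q.median x y z = p :=
  (Q.existsUnique_median x y z).unique (Q.isGraphMedian_median x y z) ⟨h1, h2, h3⟩

/-- The median of `a`, `b`, `x` lies on the edge, so it is `a` or `b`. Thus no vertex is equidistant
from the two ends, and every edge splits the vertices into two sides. -/
theorem d_edge {a b : Q.Vertex} (h : Q.d a b = 1) (x : Q.Vertex) :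
    Q.d x a + 1 = Q.d x b ∨ Q.d x b + 1 = Q.d x a := by
  obtain ⟨h1, h2, h3⟩ := Q.median_spec a b x
  generalize Q.median a b x = p at *
  have := Q.d_comm a b
  have := Q.d_comm x a
  have := Q.d_comm x b
  rcases Nat.eq_zero_or_pos (Q.d a p) with h0 | h0
  · obtain rfl := eq_of_d_eq_zero h0
    omega
  · have h0' : Q.d p b = 0 := by omega
    obtain h0' := eq_of_d_eq_zero h0'
    rw [h0'] at h1 h2 h3
    omega

/-- Opposite edges of a square have the same sides. Otherwise `u` and `v'` are equally far from `z`,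
and the median `y` of `z`, `u`, `v'` is adjacent to both. Then `u'`, `v`, `y` have the two medians
`u` and `v'`. -/
theorem d_lt_of_square {u u' v v' z : Q.Vertex} (h1 : Q.d u u' = 1) (h2 : Q.d u v = 1)
    (h3 : Q.d u' v' = 1) (h4 : Q.d v v' = 1) (h5 : Q.d u v' = 2) (h6 : Q.d u' v = 2)
    (hz : Q.d z u < Q.d z u') : Q.d z v < Q.d z v' := by
  by_contra hcon
  have e1 := d_edge h1 z
  have e2 := d_edge h2 z
  have e3 := d_edge h3 z
  have e4 := d_edge h4 z
  obtain ⟨m1, m2, m3⟩ := Q.median_spec z u v'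
  set y := Q.median z u v'
  have c1 := Q.d_comm u y
  have c2 := Q.d_comm y v'
  have c3 := Q.d_comm u u'
  have c4 := Q.d_comm u v
  have t1 := Q.d_triangle u' u y
  have t2 := Q.d_triangle v u y
  have t3 := Q.d_triangle z y u'
  have t4 := Q.d_triangle z y v
  have c5 := Q.d_comm u' y
  have c6 := Q.d_comm v y
  have : Q.median u' v y = u := median_unique (by omega) (by omega) (by omega)
  have h' : Q.median u' v y = v' := median_unique (by rw [d_comm v' v]; omega)
    (by rw [d_comm v' y]; omega) (by rw [d_comm v' y]; omega)
  rw [this] at h'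
  rw [h', d_self] at h5
  omega

/-- Induction on the distance from `u` to `a`: a step `v` from `u` towards `a` and the median `v'`
of `u'`, `v`, `b` complete `u u'` to a square. Its opposite edge `v v'` crosses the same hyperplane
one step closer to `a`. -/
theorem side_of_cross_aux (k : ℕ) : ∀ {a b u u' : Q.Vertex}, Q.d a b = 1 → Q.d u u' = 1 →
    Q.d u a = k → Q.d u a < Q.d u b → Q.d u' b < Q.d u' a →
    ∀ z, Q.d z a < Q.d z b → Q.d z u < Q.d z u' := by
  induction k with
  | zero =>
    intro a b u u' hab huu hk hu hu' z hz
    obtain rfl := eq_of_d_eq_zero hk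
    rw [d_comm u' u, huu] at hu'
    obtain rfl := eq_of_d_eq_zero (show Q.d u' b = 0 by omega)
    exact hz
  | succ k ih =>
    intro a b u u' hab huu hk hu hu' z hz
    have hne : u ≠ a := by
      rintro rfl
      rw [d_self] at hk
      omega
    obtain ⟨v, hv1, hv2⟩ := exists_step hne
    have e1 := d_edge hab u
    have e2 := d_edge hab u'
    have t1 := Q.d_triangle u u' b
    have t2 := Q.d_triangle u' u a
    have t3 := Q.d_triangle u v b
    have t4 := Q.d_triangle v a b
    have t5 := Q.d_triangle u' u v
    have t6 := Q.d_triangle u' v a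
    have c1 := Q.d_comm u u'
    obtain ⟨m1, m2, m3⟩ := Q.median_spec u' v b
    set v' := Q.median u' v b
    have c2 := Q.d_comm v' v
    have t7 := Q.d_triangle u' v' a
    have t8 := Q.d_triangle u v' b
    have t9 := Q.d_triangle u v v'
    refine d_lt_of_square (u := v) (u' := v') ?_ ?_ ?_ ?_ ?_ ?_
      (ih (u := v) (u' := v') hab ?_ ?_ ?_ ?_ z hz)
    · omega
    · rw [d_comm]; omega
    · rw [d_comm]; omega
    · omega
    · rw [d_comm]; omega
    · rw [d_comm]; omega
    · omega
    · omega
    · omega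
    · omega

/-- The side of the hyperplane dual to the edge `ab` on which `x` lies. -/
noncomputable def side (a b x : Q.Vertex) : Bool := decide (Q.d x a < Q.d x b)

theorem side_iff {a b x : Q.Vertex} : side a b x = true ↔ Q.d x a < Q.d x b := by simp [side]

theorem side_self {a b : Q.Vertex} (h : Q.d a b = 1) : side a b a = true := by
  rw [side_iff, d_self]; omega

theorem side_swap {a b : Q.Vertex} (h : Q.d a b = 1) (x : Q.Vertex) :
    side b a x = !side a b x := by
  have := d_edge h x
  unfold side
  rcases this with h | h
  · simp [show Q.d x a < Q.d x b by omega, show Q.d x a ≤ Q.d x b by omega]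
  · simp [show Q.d x b < Q.d x a by omega, show Q.d x b ≤ Q.d x a by omega]

theorem side_eq_of_cross {a b u u' : Q.Vertex} (hab : Q.d a b = 1) (huu : Q.d u u' = 1)
    (hu : side a b u = true) (hu' : side a b u' = false) (z : Q.Vertex) :
    side u u' z = side a b z := by
  have hu2 : side b a u' = true := by rw [side_swap hab, hu']; rfl
  rw [side_iff] at hu hu2
  cases h : side a b z with
  | true =>
    rw [side_iff] at h ⊢
    exact side_of_cross_aux _ hab huu rfl hu hu2 z h
  | false =>
    have h' : side b a z = true := by rw [side_swap hab, h]; rfl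
    rw [side_iff] at h'
    have := side_of_cross_aux _ ((d_comm b a).trans hab) ((d_comm u' u).trans huu) rfl hu2 hu z h'
    rw [← side_iff, side_swap huu] at this
    simpa using this

/-- A geodesic that leaves the half-space does so across an edge with the same sides as `ab`. The
end `y` is on the near side of that edge, hence closer to its first vertex, so the path was not a
geodesic. -/
theorem side_convex {a b : Q.Vertex} (hab : Q.d a b = 1) {x y z : Q.Vertex}
    (hx : side a b x = true) (hy : side a b y = true) (hz : Q.d x z + Q.d z y = Q.d x y) :
    side a b z = true := by
  induction hk : Q.d x z generalizing x with
  | zero => rwa [← eq_of_d_eq_zero hk]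
  | succ k ih =>
    have hne : x ≠ z := by
      rintro rfl
      rw [d_self] at hk
      omega
    obtain ⟨v, hv1, hv2⟩ := exists_step hne
    have t1 := Q.d_triangle x v y
    have t2 := Q.d_triangle v z y
    by_cases hv : side a b v = true
    · exact ih hv (by omega) (by omega)
    · have := side_eq_of_cross hab hv1 hx (by simpa using hv) y
      rw [hy, side_iff, d_comm y x, d_comm y v] at this
      omega

end CATZeroCubeComplex

/-! ### Median expressions and their identities -/

/-- The majority of three truth values. -/
def boolMaj (p q r : Bool) : Bool := (p && q) || (q && r) || (p && r)

/-- Formal median expressions in `n` variables. -/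
inductive MedianTerm (n : ℕ) where
  | var : Fin n → MedianTerm n
  | med : MedianTerm n → MedianTerm n → MedianTerm n → MedianTerm n

/-- The value of a median expression for a ternary operation. -/
def MedianTerm.eval {n : ℕ} {α : Type*} (m : α → α → α → α) (p : Fin n → α) : MedianTerm n → α
  | .var i => p i
  | .med a b c => m (a.eval m p) (b.eval m p) (c.eval m p)

/-- Two median expressions agree in the two-element median algebra. -/
def MedianTerm.Equiv {n : ℕ} (s t : MedianTerm n) : Prop :=
  ∀ σ : Fin n → Bool, s.eval boolMaj σ = t.eval boolMaj σ

instance {n : ℕ} (s t : MedianTerm n) : Decidable (s.Equiv t) :=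
  inferInstanceAs (Decidable (∀ σ : Fin n → Bool, s.eval boolMaj σ = t.eval boolMaj σ))

namespace CATZeroCubeComplex

variable {Q : CATZeroCubeComplex.{w}}

/-- The median is between each two of its arguments, and both sides of an edge are convex. So two
arguments on one side pull the median to that side. -/
theorem side_median {a b : Q.Vertex} (hab : Q.d a b = 1) (x y z : Q.Vertex) :
    side a b (Q.median x y z) = boolMaj (side a b x) (side a b y) (side a b z) := by
  obtain ⟨h1, h2, h3⟩ := Q.median_spec x y z
  have hba : Q.d b a = 1 := (d_comm b a).trans hab
  have g1 := fun h h' => side_convex hab (x := x) (y := y) h h' h1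
  have g2 := fun h h' => side_convex hab (x := y) (y := z) h h' h2
  have g3 := fun h h' => side_convex hab (x := x) (y := z) h h' h3
  have k1 := fun h h' => side_convex hba (x := x) (y := y) h h' h1
  have k2 := fun h h' => side_convex hba (x := y) (y := z) h h' h2
  have k3 := fun h h' => side_convex hba (x := x) (y := z) h h' h3
  simp only [side_swap hab] at k1 k2 k3
  generalize side a b (Q.median x y z) = s at *
  generalize side a b x = s1 at *
  generalize side a b y = s2 at *
  generalize side a b z = s3 at *
  revert s s1 s2 s3
  decide

theorem eq_of_side {x y : Q.Vertex} (h : ∀ a b, Q.d a b = 1 → side a b x = side a b y) :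
    x = y := by
  by_contra hne
  obtain ⟨v, hv1, hv2⟩ := exists_step hne
  have := h x v hv1
  rw [side_self hv1, eq_comm, side_iff, d_comm y x, d_comm y v] at this
  omega

theorem side_eval {a b : Q.Vertex} (hab : Q.d a b = 1) {n : ℕ} (p : Fin n → Q.Vertex)
    (t : MedianTerm n) :
    side a b (t.eval Q.median p) = t.eval boolMaj (fun i => side a b (p i)) := by
  induction t with
  | var i => rfl
  | med s t u hs ht hu => simp only [MedianTerm.eval, side_median hab, hs, ht, hu]

/-- Sides are median homomorphisms to the two-element algebra and they separate vertices. Identities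
in median graphs thereby become finite checks, discharged by `decide` wherever this is applied. -/
theorem eval_eq {n : ℕ} {s t : MedianTerm n} (h : s.Equiv t) (p : Fin n → Q.Vertex) :
    s.eval Q.median p = t.eval Q.median p :=
  eq_of_side fun a b hab => by rw [side_eval hab, side_eval hab, h]

open MedianTerm in
theorem median_perm (x y z : Q.Vertex) :
    Q.median x y z = Q.median y x z ∧ Q.median x y z = Q.median x z y :=
  ⟨eval_eq (s := med (var 0) (var 1) (var 2)) (t := med (var 1) (var 0) (var 2))
    (by decide) ![x, y, z],
  eval_eq (s := med (var 0) (var 1) (var 2)) (t := med (var 0) (var 2) (var 1))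
    (by decide) ![x, y, z]⟩

theorem median_swap_left (x y z : Q.Vertex) : Q.median x y z = Q.median y x z :=
  (median_perm x y z).1

theorem median_swap_right (x y z : Q.Vertex) : Q.median x y z = Q.median x z y :=
  (median_perm x y z).2

theorem median_eq_iff {x y p : Q.Vertex} :
    Q.median x y p = p ↔ Q.d x p + Q.d p y = Q.d x y := by
  constructor
  · intro h
    have := (Q.median_spec x y p).1
    rwa [h] at this
  · intro h
    refine median_unique h ?_ ?_ <;> simp

theorem median_self (x y : Q.Vertex) : Q.median x x y = x :=
  median_unique (by simp) (by simp) (by simp)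

/-- A median expression identity that places `p` between `x` and `y`. -/
theorem between_of_equiv {n : ℕ} {x p y : MedianTerm n}
    (h : (MedianTerm.med x y p).Equiv p) (v : Fin n → Q.Vertex) :
    Q.d (x.eval Q.median v) (p.eval Q.median v) + Q.d (p.eval Q.median v) (y.eval Q.median v) =
      Q.d (x.eval Q.median v) (y.eval Q.median v) :=
  median_eq_iff.1 (eval_eq h v)

open MedianTerm in
-- The first median is between `x` and the second, and the second is between `x'` and the first.
-- Adding the two length equations and comparing `x` with `x'` bounds twice the distance of the
-- medians by twice that of `x` and `x'`.
theorem d_median_le (x y z x' : Q.Vertex) :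
    Q.d (Q.median x y z) (Q.median x' y z) ≤ Q.d x x' := by
  have h1 := between_of_equiv (x := var 0) (p := med (var 0) (var 1) (var 2))
    (y := med (var 3) (var 1) (var 2)) (by decide) ![x, y, z, x']
  have h2 := between_of_equiv (x := var 3) (p := med (var 3) (var 1) (var 2))
    (y := med (var 0) (var 1) (var 2)) (by decide) ![x, y, z, x']
  simp only [MedianTerm.eval] at h1 h2
  change Q.d x (Q.median x y z) + Q.d (Q.median x y z) (Q.median x' y z) =
    Q.d x (Q.median x' y z) at h1
  change Q.d x' (Q.median x' y z) + Q.d (Q.median x' y z) (Q.median x y z) =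
    Q.d x' (Q.median x y z) at h2
  have t1 := Q.d_triangle x x' (Q.median x' y z)
  have t2 := Q.d_triangle x' x (Q.median x y z)
  have := Q.d_comm x x'
  have := Q.d_comm (Q.median x y z) (Q.median x' y z)
  omega

theorem d_median_le₃ (x y z z' : Q.Vertex) :
    Q.d (Q.median x y z) (Q.median x y z') ≤ Q.d z z' := by
  rw [median_swap_right x y z, median_swap_left x z y, median_swap_right x y z',
    median_swap_left x z' y]
  exact d_median_le _ _ _ _

end CATZeroCubeComplex

/-! ### Iterated joins and dimension -/

section Joins

variable {α : Type*} {m : α → α → α → α}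

theorem mem_medianJoin {A : Set α} {p : α} :
    p ∈ medianJoin m A ↔ ∃ x ∈ A, ∃ y ∈ A, ∃ z, p = m x y z := by
  simp [medianJoin, medianInterval]

theorem medianHull_zero (A : Set α) : medianHull m 0 A = A := rfl

theorem medianHull_succ (n : ℕ) (A : Set α) :
    medianHull m (n + 1) A = medianJoin m (medianHull m n A) :=
  Function.iterate_succ_apply' _ _ _

theorem mem_medianHull_succ {n : ℕ} {A : Set α} {p : α} :
    p ∈ medianHull m (n + 1) A ↔
      ∃ x ∈ medianHull m n A, ∃ y ∈ medianHull m n A, ∃ z, p = m x y z := by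
  rw [medianHull_succ, mem_medianJoin]

theorem medianHull_mono (n : ℕ) {A B : Set α} (h : A ⊆ B) :
    medianHull m n A ⊆ medianHull m n B := by
  induction n with
  | zero => exact h
  | succ n ih =>
    intro p hp
    obtain ⟨x, hx, y, hy, z, rfl⟩ := mem_medianHull_succ.1 hp
    exact mem_medianHull_succ.2 ⟨x, ih hx, y, ih hy, z, rfl⟩

theorem medianHull_nonempty (n : ℕ) {A : Set α} (h : A.Nonempty) :
    (medianHull m n A).Nonempty := by
  induction n with
  | zero => exact h
  | succ n ih =>
    obtain ⟨x, hx⟩ := ih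
    exact ⟨m x x x, mem_medianHull_succ.2 ⟨x, hx, x, hx, x, rfl⟩⟩

end Joins

namespace CATZeroCubeComplex

variable {Q : CATZeroCubeComplex.{w}}

theorem medianHull_subset_succ (n : ℕ) (A : Set Q.Vertex) :
    medianHull Q.median n A ⊆ medianHull Q.median (n + 1) A := fun p hp =>
  mem_medianHull_succ.2 ⟨p, hp, p, hp, p, (median_self p p).symm⟩

theorem subset_medianHull (n : ℕ) (A : Set Q.Vertex) : A ⊆ medianHull Q.median n A := by
  induction n with
  | zero => exact subset_rfl
  | succ n ih => exact ih.trans (medianHull_subset_succ n A)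

/-- The neighbours of `p` on geodesics from `p` to `c`. -/
def steps (p c : Q.Vertex) : Set Q.Vertex := {u | Q.d u p = 1 ∧ side u p c = true}

/-- For an edge from `p` to a neighbour, `p` casts one of the three votes, so the median lies beyond
the edge only if both `c` and `a` do. Each join towards `p` thus removes the directions that are not
shared with `a`. -/
theorem steps_median (p c a : Q.Vertex) :
    steps p (Q.median c a p) = steps p c ∩ steps p a := by
  ext u
  simp only [steps, mem_ofPred_eq, mem_inter_iff]
  by_cases hu : Q.d u p = 1
  · have : side u p p = false := by
      rw [← Bool.not_eq_true, side_iff, d_self]; omega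
    rw [side_median hu, this]
    simp [hu, boolMaj]
  · simp [hu]

theorem eq_of_steps_eq_empty {p c : Q.Vertex} (h : steps p c = ∅) : c = p := by
  by_contra hne
  obtain ⟨z, hz1, hz2⟩ := exists_step (Ne.symm hne)
  have : z ∈ steps p c := by
    refine ⟨(d_comm z p).trans hz1, ?_⟩
    rw [side_iff, d_comm c z, d_comm c p]
    omega
  rw [h] at this
  exact this

/-- The join of the vertices `u i` with `i ∈ l`, `S i = true`, in the interval from `p` to `c`. -/
noncomputable def cubeVertex {k : ℕ} (p c : Q.Vertex) (u : Fin k → Q.Vertex) (S : Fin k → Bool) :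
    List (Fin k) → Q.Vertex
  | [] => p
  | i :: l => if S i then Q.median (cubeVertex p c u S l) (u i) c else cubeVertex p c u S l

theorem median_cubeVertex {k : ℕ} {p c : Q.Vertex} (u : Fin k → Q.Vertex) (S : Fin k → Bool)
    (hu : ∀ i, Q.median p c (u i) = u i) (l : List (Fin k)) :
    Q.median p c (cubeVertex p c u S l) = cubeVertex p c u S l := by
  induction l with
  | nil => rw [cubeVertex, median_swap_right, median_self]
  | cons i l ih =>
    rw [cubeVertex]
    split_ifs with h
    · have := eval_eq (s := .med (.var 0) (.var 1) (.med (.med (.var 0) (.var 1) (.var 2))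
        (.med (.var 0) (.var 1) (.var 3)) (.var 1))) (t := .med (.med (.var 0) (.var 1) (.var 2))
        (.med (.var 0) (.var 1) (.var 3)) (.var 1)) (by decide)
        ![p, c, cubeVertex p c u S l, u i]
      change Q.median p c (Q.median (Q.median p c (cubeVertex p c u S l)) (Q.median p c (u i)) c) =
        Q.median (Q.median p c (cubeVertex p c u S l)) (Q.median p c (u i)) c at this
      rwa [ih, hu] at this
    · exact ih

/-- Joining one more `u i` moves a vertex by at most one: the same median with `p` in place of `u i`
returns the vertex, and `u i` is adjacent to `p`. -/
theorem d_cubeVertex_le {k : ℕ} {p c : Q.Vertex} (u : Fin k → Q.Vertex) (S S' : Fin k → Bool)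
    (hu : ∀ i, Q.median p c (u i) = u i) (hu1 : ∀ i, Q.d (u i) p = 1) (l : List (Fin k)) :
    Q.d (cubeVertex p c u S l) (cubeVertex p c u S' l) ≤
      (l.map fun i => if S i ≠ S' i then 1 else 0).sum := by
  induction l with
  | nil => simp [cubeVertex]
  | cons i l ih =>
    have key : ∀ T, Q.d (Q.median (cubeVertex p c u T l) (u i) c) (cubeVertex p c u T l) ≤ 1 := by
      intro T
      have h1 : Q.median (cubeVertex p c u T l) p c = cubeVertex p c u T l := by
        rw [median_swap_left, median_swap_right]
        exact median_cubeVertex u T hu l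
      have h2 := d_median_le (u i) (cubeVertex p c u T l) c p
      rw [median_swap_left p, median_swap_left (u i), h1, hu1] at h2
      exact h2
    have k1 := key S
    have k2 := key S'
    have t1 := Q.d_triangle (Q.median (cubeVertex p c u S l) (u i) c) (cubeVertex p c u S l)
      (cubeVertex p c u S' l)
    have t2 := Q.d_triangle (cubeVertex p c u S l) (cubeVertex p c u S' l)
      (Q.median (cubeVertex p c u S' l) (u i) c)
    have c1 := Q.d_comm (Q.median (cubeVertex p c u S' l) (u i) c) (cubeVertex p c u S' l)
    have k3 := d_median_le (cubeVertex p c u S l) (u i) c (cubeVertex p c u S' l)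
    simp only [List.map_cons, List.sum_cons, cubeVertex]
    generalize (l.map fun i => if S i ≠ S' i then 1 else 0).sum = N at *
    cases hS : S i <;> cases hS' : S' i <;> simp <;> omega

/-- The edge from `u i` to `p` reads off coordinate `i`: `c` is on the side of `u i`, while the
other `u j`, being neighbours of `p`, are on the side of `p`. -/
theorem side_cubeVertex {k : ℕ} {p c : Q.Vertex} (u : Fin k → Q.Vertex) (S : Fin k → Bool)
    (hinj : Function.Injective u) (hu : ∀ i, u i ∈ steps p c) (i : Fin k) (l : List (Fin k)) :
    side (u i) p (cubeVertex p c u S l) = decide (i ∈ l ∧ S i = true) := by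
  induction l with
  | nil =>
    simp only [cubeVertex, List.not_mem_nil, false_and, decide_false]
    rw [← Bool.not_eq_true, side_iff, d_self]
    omega
  | cons j l ih =>
    have hij : side (u i) p (u j) = decide (i = j) := by
      by_cases h : i = j
      · subst h
        simp [side_self (hu i).1]
      · have h0 : Q.d (u j) (u i) ≠ 0 := fun h' => h (hinj (eq_of_d_eq_zero h')).symm
        simp only [h, decide_false]
        rw [← Bool.not_eq_true, side_iff, (hu j).1]
        omega
    rw [cubeVertex]
    by_cases hS : S j = true
    · rw [if_pos hS, side_median (hu i).1, ih, hij, (hu i).2]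
      by_cases h : i = j
      · subst h
        simp [boolMaj, hS]
      · simp [boolMaj, h]
    · rw [if_neg hS, ih]
      by_cases h : i = j
      · subst h
        simp [hS]
      · simp [h]

/-- Neighbours of `p` that lead towards a common vertex `c` span a cube at `p`, so their number is
bounded by the dimension. -/
theorem card_le_of_steps {v : ℕ} (hQ : Q.DimLE v) {p c : Q.Vertex} {k : ℕ}
    (u : Fin k → Q.Vertex) (hinj : Function.Injective u) (hu : ∀ i, u i ∈ steps p c) :
    k ≤ v := by
  refine hQ k ⟨?_⟩
  have hmed : ∀ i, Q.median p c (u i) = u i := fun i => by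
    rw [median_eq_iff]
    have h1 := (hu i).1
    have h2 := side_iff.1 (hu i).2
    have h3 := d_edge h1 c
    rw [d_comm p (u i), d_comm (u i) c, d_comm p c]
    omega
  have hside := fun S i => side_cubeVertex u S hinj hu i (List.finRange k)
  simp only [List.mem_finRange, true_and, Bool.decide_eq_true] at hside
  have hd := fun S S' => d_cubeVertex_le u S S' hmed (fun i => (hu i).1) (List.finRange k)
  have hsum : ∀ S S' : Fin k → Bool, ((List.finRange k).map
      fun i => if S i ≠ S' i then 1 else 0).sum = hammingDist S S' := by
    intro S S'
    rw [← Fin.sum_univ_def, hammingDist, Finset.card_filter]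
  simp only [hsum] at hd
  set φ : (Fin k → Bool) → Q.Vertex := fun S => cubeVertex p c u S (List.finRange k) with hφ
  have hφinj : Function.Injective φ := by
    intro S S' h
    funext i
    rw [← hside S i, ← hside S' i]
    exact congrArg _ h
  refine ⟨⟨φ, hφinj⟩, ?_⟩
  intro S S'
  change Q.oneSkeleton.Adj (φ S) (φ S') ↔ hammingDist S S' = 1
  rw [← SimpleGraph.dist_eq_one_iff_adj]
  change Q.d (φ S) (φ S') = 1 ↔ _
  constructor
  · intro h
    have hne : S ≠ S' := by
      rintro rfl
      rw [d_self] at h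
      omega
    have hpos := hammingDist_pos.2 hne
    by_contra hcon
    obtain ⟨i, hi, j, hj, hij⟩ := Finset.one_lt_card.1 (show 1 < hammingDist S S' by omega)
    simp only [Finset.mem_filter, Finset.mem_univ, true_and] at hi hj
    -- An edge between cube vertices crosses at most one of the hyperplanes. If it crosses two in
    -- the same direction, they have the same sides and `u i = u j`. In opposite directions their
    -- sides would be complementary, but `p` is on the negative side of both.
    have key : ∀ (S S' : Fin k → Bool) (i j : Fin k), Q.d (φ S) (φ S') = 1 → S i = true →
        S' i = false → S j ≠ S' j → i = j := by
      intro S S' i j h hi hi' hj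
      have e1 := side_eq_of_cross (hu i).1 h ((hside S i).trans hi) ((hside S' i).trans hi')
      have hpj : side (u j) p p = false := by
        rw [← Bool.not_eq_true, side_iff, d_self]; omega
      have hpi : side (u i) p p = false := by
        rw [← Bool.not_eq_true, side_iff, d_self]; omega
      cases hSj : S j with
      | true =>
        have hSj' : S' j = false := by
          rw [hSj] at hj
          cases h : S' j <;> simp_all
        have e2 := side_eq_of_cross (hu j).1 h ((hside S j).trans hSj) ((hside S' j).trans hSj')
        by_contra hne
        have h5 := e1 (u i)
        rw [e2, side_self (hu i).1, side_iff, (hu i).1] at h5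
        have h0 : Q.d (u i) (u j) ≠ 0 := fun h' => hne (hinj (eq_of_d_eq_zero h'))
        omega
      | false =>
        have hSj' : S' j = true := by
          rw [hSj] at hj
          cases h : S' j <;> simp_all
        have h' : Q.d (φ S') (φ S) = 1 := (d_comm _ _).trans h
        have e2 := side_eq_of_cross (hu j).1 h' ((hside S' j).trans hSj') ((hside S j).trans hSj) p
        rw [side_swap h, e1 p, hpi, hpj] at e2
        simp at e2
    cases hSi : S i with
    | true =>
      refine hij (key S S' i j h hSi ?_ hj)
      rw [hSi] at hi
      cases h : S' i <;> simp_all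
    | false =>
      refine hij (key S' S i j ((d_comm _ _).trans h) ?_ hSi (Ne.symm hj))
      rw [hSi] at hi
      cases h : S' i <;> simp_all
  · intro h
    have h1 := hd S S'
    have h2 : Q.d (φ S) (φ S') ≠ 0 := by
      intro h0
      rw [hφinj (eq_of_d_eq_zero h0), hammingDist_self] at h
      omega
    change Q.d (φ S) (φ S') ≤ _ at h1
    omega

theorem finite_steps {v : ℕ} (hQ : Q.DimLE v) (p c : Q.Vertex) :
    (steps p c).Finite ∧ (steps p c).ncard ≤ v := by
  have key : ∀ s : Finset Q.Vertex, (s : Set Q.Vertex) ⊆ steps p c → s.card ≤ v := by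
    intro s hs
    exact card_le_of_steps hQ (fun i => (s.equivFin.symm i : Q.Vertex))
      (Subtype.val_injective.comp s.equivFin.symm.injective)
      (fun i => hs (s.equivFin.symm i).2)
  have hfin : (steps p c).Finite := by
    by_contra hinf
    obtain ⟨s, hs, hcard⟩ := Set.Infinite.exists_subset_card_eq hinf (v + 1)
    have := key s hs
    omega
  refine ⟨hfin, ?_⟩
  have := key hfin.toFinset (by simp)
  rwa [← Set.ncard_eq_toFinset_card _ hfin] at this

theorem side_eq_of_mem_medianHull {a b : Q.Vertex} (hab : Q.d a b = 1) {A : Set Q.Vertex}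
    (hA : ∀ x ∈ A, side a b x = true) (n : ℕ) :
    ∀ x ∈ medianHull Q.median n A, side a b x = true := by
  induction n with
  | zero => exact hA
  | succ n ih =>
    intro p hp
    obtain ⟨x, hx, y, hy, z, rfl⟩ := mem_medianHull_succ.1 hp
    rw [side_median hab, ih x hx, ih y hy]
    simp [boolMaj]

/-- In a CAT(0) cube complex of dimension at most `v`, iterated joins stabilise after `v` steps. -/
theorem medianHull_subset_of_dimLE {v : ℕ} (hQ : Q.DimLE v) (A : Set Q.Vertex) (n : ℕ) :
    medianHull Q.median n A ⊆ medianHull Q.median v A := by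
  intro p hp
  have hAne : A.Nonempty := by
    by_contra hA
    rw [not_nonempty_iff_eq_empty] at hA
    subst hA
    have : ∀ n, medianHull Q.median n (∅ : Set Q.Vertex) = ∅ := by
      intro n
      induction n with
      | zero => rfl
      | succ n ih => rw [medianHull_succ, ih]; simp [medianJoin]
    rw [this] at hp
    exact hp
  -- Approach `p` by joins. While a direction `u` remains, some `a ∈ A` is not beyond it, since
  -- otherwise the whole hull, including `p`, would be. Joining with `a` removes at least one of the
  -- at most `v` directions.
  have key : ∀ j ≤ v, ∃ c ∈ medianHull Q.median j A, (steps p c).ncard ≤ v - j := by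
    intro j
    induction j with
    | zero =>
      intro _
      obtain ⟨a, ha⟩ := hAne
      exact ⟨a, ha, (finite_steps hQ p a).2⟩
    | succ j ih =>
      intro hj
      obtain ⟨c, hc, hcard⟩ := ih (by omega)
      by_cases hemp : steps p c = ∅
      · exact ⟨c, medianHull_subset_succ j A hc, by rw [hemp]; simp⟩
      · obtain ⟨u, hu⟩ := nonempty_iff_ne_empty.2 hemp
        have : ∃ a ∈ A, side u p a ≠ true := by
          by_contra hcon
          push Not at hcon
          have h1 := side_eq_of_mem_medianHull hu.1 hcon n p hp
          rw [side_iff, d_self] at h1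
          omega
        obtain ⟨a, ha, hua⟩ := this
        refine ⟨Q.median c a p, mem_medianHull_succ.2
          ⟨c, hc, a, subset_medianHull j A ha, p, rfl⟩, ?_⟩
        rw [steps_median]
        have hlt : (steps p c ∩ steps p a).ncard < (steps p c).ncard := by
          refine Set.ncard_lt_ncard ⟨inter_subset_left, fun h => ?_⟩ (finite_steps hQ p c).1
          exact hua (h hu).2.2
        omega
  obtain ⟨c, hc, hcard⟩ := key v le_rfl
  rw [Nat.sub_self, Nat.le_zero, Set.ncard_eq_zero (finite_steps hQ p c).1] at hcard
  rwa [← eq_of_steps_eq_empty hcard]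

end CATZeroCubeComplex

/-! ### Identities and hulls in coarse median spaces -/

section CoarseIdentities

variable {X : Type u} [MetricSpace X] {m : X → X → X → X}

/-- `m` is coarsely Lipschitz with constant `L`. -/
def IsCoarselyLipschitzMedian (m : X → X → X → X) (L : ℝ) : Prop :=
  0 ≤ L ∧ ∀ x y z x' y' z' : X,
    dist (m x y z) (m x' y' z') ≤ L * (dist x x' + dist y y' + dist z z') + L

theorem IsCoarseMedian.exists_lipschitz [Nonempty X] {r : ℕ} (hm : IsCoarseMedian m r) :
    ∃ L, IsCoarselyLipschitzMedian m L := by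
  obtain ⟨h, hL, -⟩ := hm
  refine ⟨h 1, ?_, hL⟩
  obtain ⟨x⟩ := ‹Nonempty X›
  simpa using hL x x x x x x

theorem IsCoarselyLipschitzMedian.dist_le {L : ℝ} (hL : IsCoarselyLipschitzMedian m L)
    {x y z x' y' z' : X} {a b c : ℝ} (hx : dist x x' ≤ a) (hy : dist y y' ≤ b)
    (hz : dist z z' ≤ c) : dist (m x y z) (m x' y' z') ≤ L * (a + b + c) + L :=
  (hL.2 x y z x' y' z').trans
    (add_le_add_left (mul_le_mul_of_nonneg_left (by linarith) hL.1) _)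

theorem MedianTerm.dist_eval_le {n : ℕ} (t : MedianTerm n) (L E : ℝ) :
    ∃ C, ∀ {X : Type u} [MetricSpace X] {m : X → X → X → X}, IsCoarselyLipschitzMedian m L →
      ∀ (Q : CATZeroCubeComplex.{w}) (f : Q.Vertex → X) (p : Fin n → X) (p' : Fin n → Q.Vertex),
        (∀ a b c, dist (f (Q.median a b c)) (m (f a) (f b) (f c)) ≤ E) →
        (∀ i, dist (p i) (f (p' i)) ≤ E) →
        dist (t.eval m p) (f (t.eval Q.median p')) ≤ C := by
  induction t with
  | var i => exact ⟨E, fun _ _ _ _ _ _ h => h i⟩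
  | med s t u hs ht hu =>
    obtain ⟨C₁, h₁⟩ := hs
    obtain ⟨C₂, h₂⟩ := ht
    obtain ⟨C₃, h₃⟩ := hu
    refine ⟨L * (C₁ + C₂ + C₃) + L + E, fun hL Q f p p' hf hp => ?_⟩
    refine (dist_triangle_right _ _ _).trans (add_le_add ?_ (hf _ _ _))
    exact hL.dist_le (h₁ hL Q f p p' hf hp) (h₂ hL Q f p p' hf hp) (h₃ hL Q f p p' hf hp)

/-- Identities of median algebras hold up to bounded error in coarse median spaces. -/
theorem IsCoarseMedian.exists_dist_eval_le {r : ℕ} (hm : IsCoarseMedian m r) {n : ℕ} [NeZero n]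
    {s t : MedianTerm n} (hst : s.Equiv t) :
    ∃ C, ∀ p : Fin n → X, dist (s.eval m p) (t.eval m p) ≤ C := by
  classical
  rcases isEmpty_or_nonempty X with hX | hX
  · exact ⟨0, fun p => (hX.false (p 0)).elim⟩
  obtain ⟨L, hL⟩ := hm.exists_lipschitz
  obtain ⟨h, -, hh⟩ := hm
  obtain ⟨C₁, h₁⟩ := s.dist_eval_le L (h n)
  obtain ⟨C₂, h₂⟩ := t.dist_eval_le L (h n)
  refine ⟨C₁ + C₂, fun p => ?_⟩
  obtain ⟨Q, -, -, f, g, hf, hg⟩ := hh n (Finset.univ.image p)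
    (Finset.univ_nonempty.image p) (Finset.card_image_le.trans (by simp))
  have k1 := h₁ hL Q f p (fun i => g (p i)) hf (fun i => hg _ (by simp))
  have k2 := h₂ hL Q f p (fun i => g (p i)) hf (fun i => hg _ (by simp))
  rw [CATZeroCubeComplex.eval_eq hst] at k1
  exact (dist_triangle_right _ _ _).trans (add_le_add k1 k2)

/-- A coarse median map sends iterated joins close to iterated joins. -/
theorem exists_near_medianHull (L E : ℝ) (n : ℕ) :
    ∃ C, ∀ {X : Type u} [MetricSpace X] {m : X → X → X → X}, IsCoarselyLipschitzMedian m L →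
      ∀ (Q : CATZeroCubeComplex.{w}) (f : Q.Vertex → X) (A : Set X) (B : Set Q.Vertex),
        (∀ a b c, dist (f (Q.median a b c)) (m (f a) (f b) (f c)) ≤ E) →
        (∀ b ∈ B, ∃ a ∈ A, dist (f b) a ≤ E) →
        ∀ z ∈ medianHull Q.median n B, ∃ z' ∈ medianHull m n A, dist (f z) z' ≤ C := by
  induction n with
  | zero => exact ⟨E, fun _ _ _ _ _ _ h => h⟩
  | succ n ih =>
    obtain ⟨C, hC⟩ := ih
    refine ⟨E + (L * (C + C + 0) + L), fun hL Q f A B hf hB z hz => ?_⟩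
    obtain ⟨x, hx, y, hy, w, rfl⟩ := mem_medianHull_succ.1 hz
    obtain ⟨x', hx', hxx⟩ := hC hL Q f A B hf hB x hx
    obtain ⟨y', hy', hyy⟩ := hC hL Q f A B hf hB y hy
    refine ⟨_, mem_medianHull_succ.2 ⟨x', hx', y', hy', f w, rfl⟩, ?_⟩
    exact (dist_triangle _ _ _).trans (add_le_add (hf _ _ _) (hL.dist_le hxx hyy (by simp)))

/-- A point of an iterated join is detected by a finite set of bounded size. -/
theorem exists_finset_of_mem_medianHull (n : ℕ) :
    ∃ N : ℕ, ∀ L E : ℝ, ∃ C, ∀ {X : Type u} [MetricSpace X] {m : X → X → X → X},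
      IsCoarselyLipschitzMedian m L → ∀ (A : Set X), ∀ z ∈ medianHull m n A,
      ∃ B : Finset X, B.Nonempty ∧ B.card ≤ N ∧
        ∀ (Q : CATZeroCubeComplex.{w}) (f : Q.Vertex → X) (g : X → Q.Vertex),
          (∀ a b c, dist (f (Q.median a b c)) (m (f a) (f b) (f c)) ≤ E) →
          (∀ b ∈ B, dist b (f (g b)) ≤ E) →
          ∃ z' ∈ medianHull Q.median n (g '' (A ∩ B)), dist z (f z') ≤ C := by
  classical
  induction n with
  | zero =>
    refine ⟨1, fun L E => ⟨E, fun _ A z hz => ⟨{z}, by simp, by simp, fun Q f g hf hg => ?_⟩⟩⟩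
    refine ⟨g z, ⟨z, ⟨hz, by simp⟩, rfl⟩, hg z (by simp)⟩
  | succ n ih =>
    obtain ⟨N, hN⟩ := ih
    refine ⟨N + N + 1, fun L E => ?_⟩
    obtain ⟨C, hC⟩ := hN L E
    refine ⟨L * (C + C + E) + L + E, fun hL A z hz => ?_⟩
    obtain ⟨x, hx, y, hy, w, rfl⟩ := mem_medianHull_succ.1 hz
    obtain ⟨B₁, hB₁, hc₁, h₁⟩ := hC hL A x hx
    obtain ⟨B₂, hB₂, hc₂, h₂⟩ := hC hL A y hy
    refine ⟨B₁ ∪ B₂ ∪ {w}, by simp, ?_, fun Q f g hf hg => ?_⟩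
    · have i1 := Finset.card_union_le (B₁ ∪ B₂) {w}
      have i2 := Finset.card_union_le B₁ B₂
      simp only [Finset.card_singleton] at i1
      omega
    · obtain ⟨x', hx', hxx⟩ := h₁ Q f g hf (fun b hb => hg b (by simp [hb]))
      obtain ⟨y', hy', hyy⟩ := h₂ Q f g hf (fun b hb => hg b (by simp [hb]))
      have hw := hg w (by simp)
      have s1 : g '' (A ∩ B₁) ⊆ g '' (A ∩ ↑(B₁ ∪ B₂ ∪ {w})) :=
        image_mono (inter_subset_inter_right _ (by intro b hb; simp_all))
      have s2 : g '' (A ∩ B₂) ⊆ g '' (A ∩ ↑(B₁ ∪ B₂ ∪ {w})) :=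
        image_mono (inter_subset_inter_right _ (by intro b hb; simp_all))
      refine ⟨_, mem_medianHull_succ.2 ⟨x', medianHull_mono n s1 hx', y',
        medianHull_mono n s2 hy', g w, rfl⟩, ?_⟩
      exact (dist_triangle_right _ _ _).trans (add_le_add (hL.dist_le hxx hyy hw) (hf _ _ _))

/-- In a coarse median space of rank at most `r`, iterated joins stabilise coarsely after `r`
steps. -/
theorem IsCoarseMedian.exists_near_medianHull {r : ℕ} (hm : IsCoarseMedian m r) (n : ℕ) :
    ∃ C, ∀ A : Set X, ∀ z ∈ medianHull m n A, ∃ z' ∈ medianHull m r A, dist z z' ≤ C := by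
  rcases isEmpty_or_nonempty X with hX | hX
  · exact ⟨0, fun _ z => (hX.false z).elim⟩
  obtain ⟨L, hL⟩ := hm.exists_lipschitz
  obtain ⟨h, -, hh⟩ := hm
  obtain ⟨N, hN⟩ := exists_finset_of_mem_medianHull.{u, 0} n
  -- The size `N` of the detecting set had to be fixed before the error, because the error `h N` of
  -- the approximation depends on it.
  obtain ⟨C₁, h₁⟩ := hN L (h N)
  obtain ⟨C₂, h₂⟩ := _root_.exists_near_medianHull.{u, 0} L (h N) r
  refine ⟨C₁ + C₂, fun A z hz => ?_⟩
  obtain ⟨B, hBne, hB, hz⟩ := h₁ hL A z hz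
  obtain ⟨Q, -, hQ, f, g, hf, hg⟩ := hh N B hBne hB
  obtain ⟨z', hz', hzz⟩ := hz Q f g hf hg
  obtain ⟨z'', hz'', hzz'⟩ := h₂ hL Q f A (g '' (A ∩ B)) hf (by
    rintro _ ⟨a, ha, rfl⟩
    exact ⟨a, ha.1, by rw [dist_comm]; exact hg a ha.2⟩) z'
    -- The reduction from `n` joins to `r` joins is exact in the approximating complex. Errors arise
    -- only in passing to it and back.
    (CATZeroCubeComplex.medianHull_subset_of_dimLE hQ _ n hz')
  exact ⟨z'', hz'', (dist_triangle _ _ _).trans (add_le_add hzz hzz')⟩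

end CoarseIdentities

/-! ### Ultraproducts of cube complexes -/

/-- A graph whose distance function is prescribed. -/
def graphOfDist {V : Type*} (D : V → V → ℕ) (hself : ∀ x, D x x = 0)
    (hsymm : ∀ x y, D x y = D y x) : SimpleGraph V where
  Adj x y := D x y = 1
  symm := ⟨fun x y h => (hsymm y x).trans h⟩
  loopless := ⟨fun x h => by
    change D x x = 1 at h
    rw [hself] at h
    omega⟩

theorem graphOfDist_dist {V : Type*} [Nonempty V] {D : V → V → ℕ} (hself : ∀ x, D x x = 0)
    (hsymm : ∀ x y, D x y = D y x) (heq : ∀ x y, D x y = 0 → x = y)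
    (htri : ∀ x y z, D x z ≤ D x y + D y z)
    (hstep : ∀ x y, x ≠ y → ∃ z, D x z = 1 ∧ D z y + 1 = D x y) :
    (graphOfDist D hself hsymm).Connected ∧
      ∀ x y, (graphOfDist D hself hsymm).dist x y = D x y := by
  set G := graphOfDist D hself hsymm
  have hwalk : ∀ k x y, D x y = k → ∃ p : G.Walk x y, p.length = k := by
    intro k
    induction k with
    | zero =>
      intro x y h
      obtain rfl := heq x y h
      exact ⟨.nil, rfl⟩
    | succ k ih =>
      intro x y h
      have hne : x ≠ y := by
        rintro rfl
        rw [hself] at h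
        omega
      obtain ⟨z, hz1, hz2⟩ := hstep x y hne
      obtain ⟨p, hp⟩ := ih z y (by omega)
      have hadj : G.Adj x z := hz1
      exact ⟨.cons hadj p, by rw [SimpleGraph.Walk.length_cons, hp]⟩
  have hle : ∀ x y (p : G.Walk x y), D x y ≤ p.length := by
    intro x y p
    induction p with
    | nil => rw [hself]; exact Nat.zero_le _
    | @cons x z y hadj p ih =>
      have h1 : D x z = 1 := hadj
      have := htri x z y
      rw [SimpleGraph.Walk.length_cons]
      omega
  have hconn : G.Connected :=
    ⟨fun x y => ⟨(hwalk _ x y rfl).choose⟩⟩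
  refine ⟨hconn, fun x y => le_antisymm ?_ ?_⟩
  · obtain ⟨p, hp⟩ := hwalk _ x y rfl
    rw [← hp]
    exact SimpleGraph.dist_le p
  · obtain ⟨p, hp⟩ := hconn.exists_walk_length_eq_dist x y
    rw [← hp]
    exact hle x y p

theorem Ultrafilter.exists_eventually_eq_of_le (U : Ultrafilter ℕ) {k : ℕ → ℕ} {R : ℕ}
    (h : ∀ᶠ n in U, k n ≤ R) : ∃ k₀, ∀ᶠ n in U, k n = k₀ := by
  have h' : ∀ᶠ n in U, ∃ i ∈ Iic R, k n = i := h.mono fun n hn => ⟨k n, hn, rfl⟩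
  obtain ⟨i, -, hi⟩ := (Ultrafilter.eventually_exists_mem_iff (finite_Iic R)).1 h'
  exact ⟨i, hi⟩

namespace CATZeroCubeComplex

/-- The vertices of the ultraproduct of based cube complexes: sequences at bounded distance from
the base points. -/
def BoundedSeq (Q : ℕ → CATZeroCubeComplex.{w}) (b : ∀ n, (Q n).Vertex) : Type w :=
  {a : ∀ n, (Q n).Vertex // ∃ R, ∀ n, (Q n).d (a n) (b n) ≤ R}

/-- Equality of sequences along an ultrafilter. -/
def boundedSeqSetoid (U : Ultrafilter ℕ) (Q : ℕ → CATZeroCubeComplex.{w})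
    (b : ∀ n, (Q n).Vertex) : Setoid (BoundedSeq Q b) where
  r a a' := ∀ᶠ n in U, a.1 n = a'.1 n
  iseqv := ⟨fun _ => Eventually.of_forall fun _ => rfl,
    fun h => h.mono fun _ hn => hn.symm,
    fun h h' => (h.and h').mono fun _ hn => hn.1.trans hn.2⟩

/-- Distances of bounded sequences are bounded integers, hence constant along `U`. Medians are taken
termwise, and uniqueness of medians and the dimension bound pass to the limit because each concerns
finitely many distances at a time. The function `rep` picks representing sequences. -/
theorem exists_ultraproduct (U : Ultrafilter ℕ) (Q : ℕ → CATZeroCubeComplex.{w})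
    (b : ∀ n, (Q n).Vertex) {v : ℕ} (hv : ∀ n, (Q n).DimLE v) :
    ∃ (P : CATZeroCubeComplex.{w}) (rep : P.Vertex → ∀ n, (Q n).Vertex), P.DimLE v ∧
      (∀ x y, ∀ᶠ n in U, (Q n).d (rep x n) (rep y n) = P.d x y) ∧
      (∀ x y z, ∀ᶠ n in U,
        rep (P.median x y z) n = (Q n).median (rep x n) (rep y n) (rep z n)) ∧
      (∀ x, ∃ R, ∀ n, (Q n).d (rep x n) (b n) ≤ R) ∧
      ∀ (a : ∀ n, (Q n).Vertex) (R : ℕ), (∀ᶠ n in U, (Q n).d (a n) (b n) ≤ R) →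
        ∃ x, ∀ᶠ n in U, rep x n = a n := by
  classical
  let s := boundedSeqSetoid U Q b
  let V := Quotient s
  let rep : V → ∀ n, (Q n).Vertex := fun x => x.out.1
  have hrep : ∀ x, ∃ R, ∀ n, (Q n).d (rep x n) (b n) ≤ R := fun x => x.out.2
  have hsurj : ∀ (a : ∀ n, (Q n).Vertex) (R : ℕ), (∀ᶠ n in U, (Q n).d (a n) (b n) ≤ R) →
      ∃ x, ∀ᶠ n in U, rep x n = a n := by
    intro a R ha
    -- Resetting the sequence to the base point where the bound fails makes it bounded at every
    -- index and does not change its class.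
    let a' : BoundedSeq Q b := ⟨fun n => if (Q n).d (a n) (b n) ≤ R then a n else b n, R, by
      intro n
      by_cases h : (Q n).d (a n) (b n) ≤ R
      · simp only [if_pos h]; exact h
      · simp only [if_neg h, d_self]; exact Nat.zero_le _⟩
    refine ⟨⟦a'⟧, ?_⟩
    have h1 : ∀ᶠ n in U, (⟦a'⟧ : V).out.1 n = a'.1 n :=
      @Quotient.exact _ s (⟦a'⟧ : V).out a' (Quotient.out_eq _)
    filter_upwards [h1, ha] with n h1 h2
    exact h1.trans (if_pos h2)
  have hinj : ∀ x y : V, (∀ᶠ n in U, rep x n = rep y n) → x = y := by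
    intro x y h
    rw [← Quotient.out_eq x, ← Quotient.out_eq y]
    exact Quotient.sound h
  have hD : ∀ x y : V, ∃ k, ∀ᶠ n in U, (Q n).d (rep x n) (rep y n) = k := by
    intro x y
    obtain ⟨R₁, h₁⟩ := hrep x
    obtain ⟨R₂, h₂⟩ := hrep y
    refine U.exists_eventually_eq_of_le (R := R₁ + R₂) (Eventually.of_forall fun n => ?_)
    have := (Q n).d_triangle (rep x n) (b n) (rep y n)
    have := h₁ n
    have := h₂ n
    have := d_comm (b n) (rep y n)
    omega
  choose D hD using hD
  have hself : ∀ x, D x x = 0 := fun x => by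
    obtain ⟨n, hn⟩ := (hD x x).exists
    rw [← hn, d_self]
  have hsymm : ∀ x y, D x y = D y x := fun x y => by
    obtain ⟨n, hn, hn'⟩ := ((hD x y).and (hD y x)).exists
    rw [← hn, ← hn', d_comm]
  have htri : ∀ x y z, D x z ≤ D x y + D y z := fun x y z => by
    obtain ⟨n, hn, hn', hn''⟩ := ((hD x y).and ((hD y z).and (hD x z))).exists
    rw [← hn, ← hn', ← hn'']
    exact d_triangle _ _ _
  have heq : ∀ x y, D x y = 0 → x = y := fun x y h => by
    refine hinj x y ((hD x y).mono fun n hn => eq_of_d_eq_zero (hn.trans h))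
  have hstep : ∀ x y, x ≠ y → ∃ z, D x z = 1 ∧ D z y + 1 = D x y := by
    intro x y hne
    have hpos : D x y ≠ 0 := fun h => hne (heq x y h)
    have : ∀ n, ∃ z, rep x n ≠ rep y n →
        (Q n).d (rep x n) z = 1 ∧ (Q n).d z (rep y n) + 1 = (Q n).d (rep x n) (rep y n) := by
      intro n
      by_cases h : rep x n = rep y n
      · exact ⟨rep x n, fun h' => absurd h h'⟩
      · obtain ⟨z, hz⟩ := exists_step h
        exact ⟨z, fun _ => hz⟩
    choose z hz using this
    have hne' : ∀ᶠ n in U, rep x n ≠ rep y n := (hD x y).mono fun n hn h => by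
      rw [h, d_self] at hn
      exact hpos hn.symm
    obtain ⟨R, hR⟩ := hrep x
    obtain ⟨z', hz'⟩ := hsurj z (R + 1) (hne'.mono fun n hn => by
      have := (Q n).d_triangle (z n) (rep x n) (b n)
      have := hR n
      have := (hz n hn).1
      have := d_comm (z n) (rep x n)
      omega)
    obtain ⟨n, h1, h2, h3, h4, h5⟩ :=
      (hne'.and (hz'.and ((hD x y).and ((hD x z').and (hD z' y))))).exists
    refine ⟨z', ?_, ?_⟩
    · rw [← h4, h2]; exact (hz n h1).1
    · rw [← h5, ← h3, h2]; exact (hz n h1).2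
  have : Nonempty V := ⟨(hsurj b 0 (Eventually.of_forall fun n => by rw [d_self])).choose⟩
  obtain ⟨hconn, hdist⟩ := graphOfDist_dist hself hsymm heq htri hstep
  have hmed : ∀ x y z : V, ∃ p : V,
      ∀ᶠ n in U, rep p n = (Q n).median (rep x n) (rep y n) (rep z n) := by
    intro x y z
    obtain ⟨R, hR⟩ := hrep x
    refine hsurj _ (R + D x y) ?_
    filter_upwards [hD x y] with n hn
    have h1 := (Q n).d_triangle ((Q n).median (rep x n) (rep y n) (rep z n)) (rep x n) (b n)
    have h2 := ((Q n).median_spec (rep x n) (rep y n) (rep z n)).1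
    have := hR n
    rw [d_comm _ (rep x n)] at h1
    omega
  have hgm : ∀ x y z p : V, IsGraphMedian (graphOfDist D hself hsymm) x y z p ↔
      ∀ᶠ n in U, rep p n = (Q n).median (rep x n) (rep y n) (rep z n) := by
    intro x y z p
    have hall := (hD x p).and ((hD p y).and ((hD x y).and ((hD y p).and ((hD p z).and
      ((hD y z).and (hD x z))))))
    simp only [IsGraphMedian, hdist]
    constructor
    · rintro ⟨h1, h2, h3⟩
      filter_upwards [hall] with n ⟨e1, e2, e3, e4, e5, e6, e7⟩
      exact (median_unique (by omega) (by omega) (by omega)).symm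
    · intro h
      obtain ⟨n, hn, e1, e2, e3, e4, e5, e6, e7⟩ := (h.and hall).exists
      obtain ⟨m1, m2, m3⟩ := (Q n).median_spec (rep x n) (rep y n) (rep z n)
      rw [← hn] at m1 m2 m3
      omega
  let P : CATZeroCubeComplex.{w} :=
    { Vertex := V
      oneSkeleton := graphOfDist D hself hsymm
      connected := hconn
      existsUnique_median := fun x y z => by
        obtain ⟨p, hp⟩ := hmed x y z
        refine ⟨p, (hgm x y z p).2 hp, fun p' hp' => hinj _ _ ?_⟩
        filter_upwards [hp, (hgm x y z p').1 hp'] with n h1 h2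
        exact h2.trans h1.symm }
  refine ⟨P, rep, ?_, ?_, ?_, hrep, hsurj⟩
  -- A cube has finitely many vertices, so one index realises all its distances at once and carries
  -- an isomorphic cube.
  · rintro k ⟨φ⟩
    have hadj : ∀ᶠ n in U, ∀ S S' : Fin k → Bool,
        (Q n).d (rep (φ S) n) (rep (φ S') n) = D (φ S) (φ S') := by
      rw [eventually_all]
      intro S
      rw [eventually_all]
      exact fun S' => hD _ _
    obtain ⟨n, hn⟩ := hadj.exists
    refine hv n k ⟨⟨⟨fun S => rep (φ S) n, fun S S' h => ?_⟩, ?_⟩⟩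
    · have h1 := hn S S'
      change rep (φ S) n = rep (φ S') n at h
      rw [h, d_self] at h1
      exact φ.injective (heq _ _ h1.symm)
    · intro S S'
      change (Q n).oneSkeleton.Adj (rep (φ S) n) (rep (φ S') n) ↔ _
      rw [← φ.map_adj_iff, ← SimpleGraph.dist_eq_one_iff_adj]
      change (Q n).d (rep (φ S) n) (rep (φ S') n) = 1 ↔ D (φ S) (φ S') = 1
      rw [hn]
  · intro x y
    refine (hD x y).mono fun n hn => hn.trans (hdist x y).symm
  · intro x y z
    exact (hgm x y z _).1 (P.isGraphMedian_median x y z)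

end CATZeroCubeComplex

/-! ### Cubical models -/

section Models

variable {X : Type u} [MetricSpace X] {m : X → X → X → X}

theorem IsCubicalModel.mono {v : ℕ} {K K' : ℝ} {H : Set X} {Q : CATZeroCubeComplex.{w}}
    {f : Q.Vertex → X} (h : IsCubicalModel m v K H Q f) (hK : K ≤ K') :
    IsCubicalModel m v K' H Q f where
  dimLE := h.dimLE
  one_le := h.one_le.trans hK
  mapsTo := h.mapsTo
  lower a b := by
    refine le_trans ?_ (h.lower a b)
    have := h.one_le
    have h1 : (Q.oneSkeleton.dist a b : ℝ) / K' ≤ Q.oneSkeleton.dist a b / K := by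
      gcongr
    linarith
  upper a b := (h.upper a b).trans (by gcongr)
  coarselyOnto p hp := by
    obtain ⟨a, ha⟩ := h.coarselyOnto p hp
    exact ⟨a, ha.trans hK⟩
  median a b c := (h.median a b c).trans hK

theorem IsCubicalModel.d_le {v : ℕ} {K : ℝ} {H : Set X} {Q : CATZeroCubeComplex.{w}}
    {f : Q.Vertex → X} (h : IsCubicalModel m v K H Q f) (a b : Q.Vertex) :
    (Q.d a b : ℝ) ≤ K * (dist (f a) (f b) + K) := by
  have h1 := h.lower a b
  have h2 := h.one_le
  have h3 : (Q.d a b : ℝ) / K ≤ dist (f a) (f b) + K := by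
    change (Q.oneSkeleton.dist a b : ℝ) / K ≤ _
    linarith
  rwa [div_le_iff₀ (by linarith), mul_comm] at h3

/-- A bounded perturbation of a cubical model is a cubical model. -/
theorem IsCubicalModel.perturb {v : ℕ} {K L E : ℝ} {H : Set X} {Q : CATZeroCubeComplex.{w}}
    {f f' : Q.Vertex → X} (hL : IsCoarselyLipschitzMedian m L) (h : IsCubicalModel m v K H Q f)
    (hE : 0 ≤ E) (hf : ∀ a, dist (f a) (f' a) ≤ E) (hmaps : ∀ a, f' a ∈ H) :
    IsCubicalModel m v (K + 2 * E + (L * (E + E + E) + L)) H Q f' := by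
  have hL0 := hL.1
  have h0 : 0 ≤ L * (E + E + E) := by positivity
  have hK := h.one_le
  have hf' : ∀ a, dist (f' a) (f a) ≤ E := fun a => by rw [dist_comm]; exact hf a
  have e1 : ∀ a b, dist (f a) (f b) ≤ dist (f' a) (f' b) + 2 * E := fun a b => by
    have := dist_triangle4 (f a) (f' a) (f' b) (f b)
    have := hf a
    have := hf' b
    linarith
  have e2 : ∀ a b, dist (f' a) (f' b) ≤ dist (f a) (f b) + 2 * E := fun a b => by
    have := dist_triangle4 (f' a) (f a) (f b) (f' b)
    have := hf' a
    have := hf b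
    linarith
  refine ⟨h.dimLE, by linarith, hmaps, fun a b => ?_, fun a b => ?_, fun p hp => ?_,
    fun a b c => ?_⟩
  · have := h.lower a b
    have := e1 a b
    have h1 : (Q.oneSkeleton.dist a b : ℝ) / (K + 2 * E + (L * (E + E + E) + L)) ≤
        Q.oneSkeleton.dist a b / K := by
      gcongr
      linarith
    linarith
  · have := h.upper a b
    have := e2 a b
    have h1 : K * (Q.oneSkeleton.dist a b : ℝ) ≤
        (K + 2 * E + (L * (E + E + E) + L)) * Q.oneSkeleton.dist a b := by
      gcongr
      linarith
    linarith
  · obtain ⟨a, ha⟩ := h.coarselyOnto p hp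
    refine ⟨a, (dist_triangle _ _ _).trans ((add_le_add ha (hf a)).trans (by linarith))⟩
  · have h1 := h.median a b c
    have h2 := hL.dist_le (hf a) (hf b) (hf c)
    have h3 := dist_triangle4 (f' (Q.median a b c)) (f (Q.median a b c)) (m (f a) (f b) (f c))
      (m (f' a) (f' b) (f' c))
    have h4 := hf' (Q.median a b c)
    linarith

theorem IsLocallyQuasiCubical.exists_model {r v : ℕ} (h : IsLocallyQuasiCubical.{u, w} m r v)
    (k : ℕ) : ∃ K, 1 ≤ K ∧ ∀ F : Finset X, F.Nonempty → F.card ≤ k →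
      ∃ (Q : CATZeroCubeComplex.{w}) (f : Q.Vertex → X),
        IsCubicalModel m v K (medianHull m r (F : Set X)) Q f := by
  obtain ⟨-, K, hK⟩ := h
  refine ⟨1 + ∑ i ∈ Finset.range (k + 1), |K i|, ?_, fun F hF hcard => ?_⟩
  · have : 0 ≤ ∑ i ∈ Finset.range (k + 1), |K i| := Finset.sum_nonneg fun i _ => abs_nonneg _
    linarith
  · obtain ⟨Q, f, hf⟩ := hK F hF
    refine ⟨Q, f, hf.mono ?_⟩
    have h1 := Finset.single_le_sum (f := fun i => |K i|) (fun i _ => abs_nonneg (K i))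
      (show F.card ∈ Finset.range (k + 1) by simpa [Nat.lt_succ_iff] using hcard)
    have h2 := le_abs_self (K F.card)
    linarith

theorem exists_ultralimit [ProperSpace X] (U : Ultrafilter ℕ) {c : ℕ → X} {x : X} {R : ℝ}
    (h : ∀ᶠ n in U, dist (c n) x ≤ R) : ∃ y, Tendsto c U (𝓝 y) := by
  obtain ⟨y, -, hy⟩ := (isCompact_closedBall x R).ultrafilter_le_nhds (U.map c)
    (le_principal_iff.2 h)
  exact ⟨y, hy⟩

end Models

/-! ### Hulls of median rays and their gate maps -/

theorem self_mem_rayImage {X : Type u} {h : ℝ → X} {s : ℝ} (hs : 0 ≤ s) : h s ∈ rayImage h :=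
  ⟨s, hs, rfl⟩

section MedianRays

variable {X : Type u} [MetricSpace X] {m : X → X → X → X}

theorem IsMedianRay.dist_le {l : ℝ} {h : ℝ → X} (hh : IsMedianRay m l h) {s : ℝ} (hs : 0 ≤ s)
    {n : ℕ} (hn : s ≤ n) : dist (h s) (m (h 0) (h n) (h s)) ≤ l := by
  have h1 := hh.2 0 (mem_Ici.2 le_rfl) n (mem_Ici.2 (hs.trans hn)) s (mem_Ici.2 hs)
  have h2 : realMedian 0 n s = s := by
    unfold realMedian
    rw [min_eq_left (hs.trans hn), max_eq_right (hs.trans hn), min_eq_right hn, max_eq_right hs]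
  rwa [h2] at h1

open MedianTerm in
theorem IsCoarseMedian.exists_dist_self_le {r : ℕ} (hm : IsCoarseMedian m r) :
    ∃ C, ∀ x y : X, dist (m x x y) x ≤ C := by
  obtain ⟨C, hC⟩ := hm.exists_dist_eval_le (s := med (var 0) (var 0) (var 1)) (t := var (n := 2) 0)
    (by decide)
  exact ⟨C, fun x y => hC ![x, y]⟩

/-- Points of iterated joins of a median ray and a point lie close to iterated joins of three
points. -/
theorem IsMedianRay.exists_near_medianHull_triple {r : ℕ} (hm : IsCoarseMedian m r) {l : ℝ} {h : ℝ → X}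
    (hh : IsMedianRay m l h) (i : ℕ) :
    ∃ C, ∀ x, ∀ z ∈ medianHull m i (rayImage h ∪ {x}), ∀ᶠ n : ℕ in atTop,
      ∃ z' ∈ medianHull m (i + 1) ({h 0, h n, x} : Set X), dist z z' ≤ C := by
  have : Nonempty X := ⟨h 0⟩
  obtain ⟨L, hL⟩ := hm.exists_lipschitz
  obtain ⟨C₀, hC₀⟩ := hm.exists_dist_self_le
  induction i with
  | zero =>
    -- A point `h s` is close to `m (h 0) (h n) (h s)`, which costs one join. This is the extra join
    -- in the statement.
    refine ⟨max l C₀, fun x z hz => ?_⟩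
    rcases hz with ⟨s, hs, rfl⟩ | rfl
    · filter_upwards [eventually_ge_atTop ⌈s⌉₊] with n hn
      exact ⟨_, mem_medianHull_succ.2 ⟨h 0, by simp [medianHull_zero], h n,
        by simp [medianHull_zero], h s, rfl⟩,
        (hh.dist_le hs (Nat.ceil_le.1 hn)).trans (le_max_left _ _)⟩
    · refine Eventually.of_forall fun n => ⟨_, mem_medianHull_succ.2 ⟨z, by simp [medianHull_zero],
        z, by simp [medianHull_zero], z, rfl⟩, ?_⟩
      rw [dist_comm]
      exact (hC₀ z z).trans (le_max_right _ _)
  | succ i ih =>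
    obtain ⟨C, hC⟩ := ih
    refine ⟨L * (C + C + 0) + L, fun x z hz => ?_⟩
    obtain ⟨a, ha, b, hb, c, rfl⟩ := mem_medianHull_succ.1 hz
    filter_upwards [hC x a ha, hC x b hb] with n ⟨a', ha', haa⟩ ⟨b', hb', hbb⟩
    exact ⟨_, mem_medianHull_succ.2 ⟨a', ha', b', hb', c, rfl⟩, hL.dist_le haa hbb (by simp)⟩

/-- Points of iterated joins of a median ray lie close to the intervals from its origin. -/
theorem IsMedianRay.exists_dist_median_le {r : ℕ} (hm : IsCoarseMedian m r) {l : ℝ} {h : ℝ → X}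
    (hh : IsMedianRay m l h) (i : ℕ) :
    ∃ C, ∀ z ∈ medianHull m i (rayImage h), ∀ᶠ n : ℕ in atTop,
      dist z (m (h 0) (h n) z) ≤ C := by
  have : Nonempty X := ⟨h 0⟩
  obtain ⟨L, hL⟩ := hm.exists_lipschitz
  -- The identity says that intervals are convex: a median with two arguments in an interval is
  -- fixed by projection to that interval.
  obtain ⟨C₀, hC₀⟩ := hm.exists_dist_eval_le
    (s := .med (.var 0) (.var 1) (.med (.med (.var 0) (.var 1) (.var 2))
      (.med (.var 0) (.var 1) (.var 3)) (.var 4)))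
    (t := .med (.med (.var 0) (.var 1) (.var 2)) (.med (.var 0) (.var 1) (.var 3))
      (.var (n := 5) 4)) (by decide)
  induction i with
  | zero =>
    refine ⟨l, fun z hz => ?_⟩
    obtain ⟨s, hs, rfl⟩ := hz
    filter_upwards [eventually_ge_atTop ⌈s⌉₊] with n hn
    exact hh.dist_le hs (Nat.ceil_le.1 hn)
  | succ i ih =>
    obtain ⟨C, hC⟩ := ih
    set D := L * (C + C + 0) + L
    refine ⟨D + (L * (0 + 0 + D) + L + C₀), fun z hz => ?_⟩
    obtain ⟨a, ha, b, hb, c, rfl⟩ := mem_medianHull_succ.1 hz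
    filter_upwards [hC a ha, hC b hb] with n haa hbb
    have h1 : dist (m a b c) (m (m (h 0) (h n) a) (m (h 0) (h n) b) c) ≤ D :=
      hL.dist_le haa hbb (by simp)
    have h2 := hL.dist_le (x := h 0) (x' := h 0) (y := h n) (y' := h n) (a := 0) (b := 0)
      (by simp) (by simp) h1
    have h3 := hC₀ ![h 0, h n, a, b, c]
    change dist (m (h 0) (h n) (m (m (h 0) (h n) a) (m (h 0) (h n) b) c))
      (m (m (h 0) (h n) a) (m (h 0) (h n) b) c) ≤ C₀ at h3
    have h4 := dist_triangle4 (m a b c) (m (m (h 0) (h n) a) (m (h 0) (h n) b) c)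
      (m (h 0) (h n) (m (m (h 0) (h n) a) (m (h 0) (h n) b) c)) (m (h 0) (h n) (m a b c))
    rw [dist_comm (m (h 0) (h n) _), dist_comm _ (m (h 0) (h n) (m a b c))] at h4
    rw [dist_comm] at h3
    rw [dist_comm (m (h 0) (h n) (m a b c))] at h4
    linarith

/-- The hull of a median ray and a point has a cubical model. -/
theorem IsMedianRay.exists_model [ProperSpace X] {r v : ℕ} (hm : IsCoarseMedian m r)
    (hLQC : IsLocallyQuasiCubical.{u, w} m r v) {l : ℝ} {h : ℝ → X} (hh : IsMedianRay m l h) :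
    ∃ C, ∀ x, ∃ (Q : CATZeroCubeComplex.{w}) (f : Q.Vertex → X),
      IsCubicalModel m v C (medianHull m r (rayImage h ∪ {x})) Q f := by
  classical
  have : Nonempty X := ⟨h 0⟩
  obtain ⟨L, hL⟩ := hm.exists_lipschitz
  obtain ⟨K, hK1, hK⟩ := hLQC.exists_model 3
  obtain ⟨C₀, hC₀⟩ := hm.exists_near_medianHull 0
  obtain ⟨C₁, hC₁⟩ := hm.exists_near_medianHull (r + 1)
  obtain ⟨C₂, hC₂⟩ := hh.exists_near_medianHull_triple hm r
  have hL0 := hL.1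
  refine ⟨K + 4 + (L * 6 + L) + |C₂| + |C₁|, fun x => ?_⟩
  have hcard : ∀ n : ℕ, ({h 0, h n, x} : Finset X).card ≤ 3 := fun n => Finset.card_le_three
  -- The three points `h 0`, `h n`, `x` have models with constants independent of `n` and `x`.
  -- Vertices `b n` over `x` serve as base points for the ultraproduct.
  choose Q f hf using fun n : ℕ => hK {h 0, h n, x} (by simp) (hcard n)
  have hcoe : ∀ n : ℕ, (({h 0, h n, x} : Finset X) : Set X) = {h 0, h n, x} := by simp
  have hb : ∀ n, ∃ b, dist x (f n b) ≤ C₀ + K := by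
    intro n
    obtain ⟨z, hz, hxz⟩ := hC₀ (({h 0, h n, x} : Finset X) : Set X) x (by simp [medianHull_zero])
    obtain ⟨b, hb⟩ := (hf n).coarselyOnto z hz
    exact ⟨b, (dist_triangle _ _ _).trans (add_le_add hxz hb)⟩
  choose b hb using hb
  set U : Ultrafilter ℕ := hyperfilter ℕ
  have hU : (U : Filter ℕ) ≤ atTop := Nat.hyperfilter_le_atTop
  obtain ⟨P, rep, hPdim, hPd, hPm, hPb, hPs⟩ :=
    CATZeroCubeComplex.exists_ultraproduct U Q b (fun n => (hf n).dimLE)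
  -- Properness gives a limit, but it need not lie in the hull. A term of the sequence within `1` of
  -- the limit does, and it is within `2` of almost all terms.
  have hlim : ∀ a, ∃ p ∈ medianHull m r (rayImage h ∪ {x}),
      ∀ᶠ n in U, dist (f n (rep a n)) p ≤ 2 := by
    intro a
    obtain ⟨R, hR⟩ := hPb a
    obtain ⟨y, hy⟩ := exists_ultralimit U (c := fun n => f n (rep a n)) (x := x)
      (R := K * R + K + (C₀ + K)) (Eventually.of_forall fun n => by
        have h1 := (hf n).upper (rep a n) (b n)
        have h2 : K * ((Q n).oneSkeleton.dist (rep a n) (b n) : ℝ) ≤ K * R := by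
          have : ((Q n).oneSkeleton.dist (rep a n) (b n) : ℝ) ≤ R := by exact_mod_cast hR n
          gcongr
        have h3 := hb n
        have h4 := dist_triangle (f n (rep a n)) (f n (b n)) x
        rw [dist_comm x] at h3
        linarith)
    have hy' : ∀ᶠ n in U, dist (f n (rep a n)) y ≤ 1 := by
      filter_upwards [hy (Metric.closedBall_mem_nhds y one_pos)] with n hn using hn
    obtain ⟨n, hn⟩ := hy'.exists
    refine ⟨f n (rep a n), ?_, hy'.mono fun k hk => ?_⟩
    · refine medianHull_mono r ?_ ((hf n).mapsTo _)
      rw [hcoe]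
      rintro z (rfl | rfl | rfl)
      · exact Or.inl (self_mem_rayImage le_rfl)
      · exact Or.inl (self_mem_rayImage (Nat.cast_nonneg n))
      · exact Or.inr rfl
    · have := dist_triangle_right (f k (rep a k)) (f n (rep a n)) y
      linarith
  choose F hF hFlim using hlim
  refine ⟨P, F, hPdim, ?_, hF, fun a a' => ?_, fun a a' => ?_, fun p hp => ?_, fun a₁ a₂ a₃ => ?_⟩
  · have := abs_nonneg C₁
    have := abs_nonneg C₂
    linarith
  · obtain ⟨n, h1, h2, h3⟩ := ((hFlim a).and ((hFlim a').and (hPd a a'))).exists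
    have h4 := (hf n).lower (rep a n) (rep a' n)
    have h3' : (Q n).oneSkeleton.dist (rep a n) (rep a' n) = P.oneSkeleton.dist a a' := h3
    rw [h3'] at h4
    have h5 := dist_triangle4 (f n (rep a n)) (F a) (F a') (f n (rep a' n))
    rw [dist_comm (F a') ] at h5
    have := abs_nonneg C₁
    have := abs_nonneg C₂
    have h6 : (P.oneSkeleton.dist a a' : ℝ) / (K + 4 + (L * 6 + L) + |C₂| + |C₁|) ≤
        P.oneSkeleton.dist a a' / K := by
      gcongr
      linarith
    linarith
  · obtain ⟨n, h1, h2, h3⟩ := ((hFlim a).and ((hFlim a').and (hPd a a'))).exists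
    have h4 := (hf n).upper (rep a n) (rep a' n)
    have h3' : (Q n).oneSkeleton.dist (rep a n) (rep a' n) = P.oneSkeleton.dist a a' := h3
    rw [h3'] at h4
    have h5 := dist_triangle4 (F a) (f n (rep a n)) (f n (rep a' n)) (F a')
    rw [dist_comm (F a) (f n _)] at h5
    have := abs_nonneg C₁
    have := abs_nonneg C₂
    have h6 : K * (P.oneSkeleton.dist a a' : ℝ) ≤
        (K + 4 + (L * 6 + L) + |C₂| + |C₁|) * P.oneSkeleton.dist a a' := by
      gcongr
      linarith
    linarith
  -- For large `n` the point `p` is near the hull of the three points. Vertices over it stay at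
  -- bounded distance from `b n`, so they define a vertex of the ultraproduct.
  · have h1 : ∀ᶠ n in U, ∃ a : (Q n).Vertex, dist p (f n a) ≤ C₂ + C₁ + K := by
      filter_upwards [hU (hC₂ x p hp)] with n ⟨z, hz, hpz⟩
      obtain ⟨z', hz', hzz⟩ := hC₁ _ z hz
      rw [← hcoe] at hz'
      obtain ⟨a, ha⟩ := (hf n).coarselyOnto z' hz'
      refine ⟨a, (dist_triangle4 _ z z' _).trans (by linarith)⟩
    have h2 : ∀ n, ∃ a : (Q n).Vertex, (∃ a : (Q n).Vertex, dist p (f n a) ≤ C₂ + C₁ + K) →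
        dist p (f n a) ≤ C₂ + C₁ + K := fun n => by
      by_cases hn : ∃ a : (Q n).Vertex, dist p (f n a) ≤ C₂ + C₁ + K
      · exact ⟨hn.choose, fun _ => hn.choose_spec⟩
      · exact ⟨b n, fun h => absurd h hn⟩
    choose a ha using h2
    obtain ⟨x', hx'⟩ := hPs a ⌈K * ((C₂ + C₁ + K) + dist p x + (C₀ + K) + K)⌉₊ (by
      filter_upwards [h1] with n hn
      have h3 := ha n hn
      have h4 := (hf n).d_le (a n) (b n)
      have h5 := hb n
      have h6 := dist_triangle4 (f n (a n)) p x (f n (b n))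
      rw [dist_comm _ p] at h6
      have h7 : K * (dist (f n (a n)) (f n (b n)) + K) ≤
          K * ((C₂ + C₁ + K) + dist p x + (C₀ + K) + K) := by
        gcongr
        linarith
      exact_mod_cast (h4.trans h7).trans (Nat.le_ceil _))
    obtain ⟨n, hn1, hn2, hn3⟩ := (h1.and (hx'.and (hFlim x'))).exists
    refine ⟨x', (dist_triangle _ (f n (a n)) _).trans ?_⟩
    rw [hn2] at hn3
    have := ha n hn1
    have := le_abs_self C₁
    have := le_abs_self C₂
    linarith
  · obtain ⟨n, h1, h2, h3, h4, h5⟩ := ((hFlim a₁).and ((hFlim a₂).and ((hFlim a₃).and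
      ((hFlim (P.median a₁ a₂ a₃)).and (hPm a₁ a₂ a₃))))).exists
    rw [h5] at h4
    have h6 := (hf n).median (rep a₁ n) (rep a₂ n) (rep a₃ n)
    have h7 := hL.dist_le h1 h2 h3
    have h8 := dist_triangle4 (F (P.median a₁ a₂ a₃))
      (f n ((Q n).median (rep a₁ n) (rep a₂ n) (rep a₃ n)))
      (m (f n (rep a₁ n)) (f n (rep a₂ n)) (f n (rep a₃ n))) (m (F a₁) (F a₂) (F a₃))
    rw [dist_comm (F _) (f n _)] at h8
    have := abs_nonneg C₁
    have := abs_nonneg C₂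
    linarith

/-- The hull of a median ray `h` has a cubical gate map, and it is given up to bounded error by
the medians with `h 0` and `h n`, for `n` large. -/
theorem IsMedianRay.exists_cubicalGateMap [ProperSpace X] {r v : ℕ} (hm : IsCoarseMedian m r)
    (hLQC : IsLocallyQuasiCubical.{u, w} m r v) {l : ℝ} {h : ℝ → X} (hh : IsMedianRay m l h) :
    ∃ G : X → X, (∀ x, G x ∈ medianHull m r (rayImage h)) ∧
      IsCubicalGateMap.{u, w} m r v (rayImage h) G ∧
      ∃ C, ∀ x, ∀ᶠ n : ℕ in atTop, dist (G x) (m (h 0) (h n) x) ≤ C := by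
  classical
  have : Nonempty X := ⟨h 0⟩
  obtain ⟨L, hL⟩ := hm.exists_lipschitz
  have hL0 := hL.1
  obtain ⟨C, hC⟩ := hh.exists_model hm hLQC
  obtain ⟨C₀, hC₀⟩ := hm.exists_near_medianHull 0
  set E₀ := |C₀| + |C| with hE₀
  obtain ⟨C₁, hC₁⟩ := exists_near_medianHull.{u, w} L E₀ v
  obtain ⟨C₂, hC₂⟩ := hm.exists_near_medianHull v
  set E := |C₁| + |C₂| with hE
  set K := C + 2 * E + (L * (E + E + E) + L) with hK
  obtain ⟨C₃, hC₃⟩ := hh.exists_dist_median_le hm r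
  obtain ⟨C₄, hC₄⟩ := hm.exists_dist_eval_le
    (s := .med (.var 2) (.med (.var 0) (.var 1) (.var 3)) (.med (.var 0) (.var 1) (.var 2)))
    (t := .med (.var 0) (.var 1) (.var (n := 4) 2)) (by decide)
  have h0E : 0 ≤ E := by positivity
  have hEE : 0 ≤ L * (E + E + E) + L := by positivity
  have key : ∀ x, ∃ G, ∃ (Q : CATZeroCubeComplex.{w}) (f : Q.Vertex → X)
      (g : X → Q.Vertex) (p : Q.Vertex),
      IsCubicalModel m v K (medianHull m r (rayImage h ∪ {x, x})) Q f ∧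
      (∀ z ∈ medianHull m r (rayImage h ∪ {x, x}) ∪ (rayImage h ∪ {x, x}),
        dist z (f (g z)) ≤ E₀ + E) ∧
      (∀ a ∈ medianHull Q.median v (g '' rayImage h), f a ∈ medianHull m r (rayImage h)) ∧
      Q.IsGate (medianHull Q.median v (g '' rayImage h)) (g x) p ∧ G = f p := by
    intro x
    obtain ⟨Q, f, hf⟩ := hC x
    -- The auxiliary point of the gate map is `x` itself.
    rw [← pair_eq_singleton x] at hf
    have hC1 := hf.one_le
    have hg : ∀ z, ∃ a, z ∈ medianHull m r (rayImage h ∪ {x, x}) ∪ (rayImage h ∪ {x, x}) →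
        dist z (f a) ≤ E₀ := by
      intro z
      by_cases hz : z ∈ medianHull m r (rayImage h ∪ {x, x}) ∪ (rayImage h ∪ {x, x})
      · have : ∃ z' ∈ medianHull m r (rayImage h ∪ {x, x}), dist z z' ≤ |C₀| := by
          rcases hz with hz | hz
          · exact ⟨z, hz, by simp⟩
          · obtain ⟨z', hz', h1⟩ := hC₀ _ z hz
            exact ⟨z', hz', h1.trans (le_abs_self _)⟩
        obtain ⟨z', hz', h1⟩ := this
        obtain ⟨a, ha⟩ := hf.coarselyOnto z' hz'
        exact ⟨a, fun _ => (dist_triangle _ _ _).trans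
          (add_le_add h1 (ha.trans (le_abs_self _)))⟩
      · obtain ⟨z', hz'⟩ := medianHull_nonempty (m := m) r
          (show (rayImage h ∪ {x, x}).Nonempty from ⟨x, by simp⟩)
        exact ⟨(hf.coarselyOnto z' hz').choose, fun h => absurd h hz⟩
    choose g hg using hg
    set A := medianHull Q.median v (g '' rayImage h)
    have hA : ∀ a ∈ A, ∃ p ∈ medianHull m r (rayImage h), dist (f a) p ≤ E := by
      intro a ha
      obtain ⟨z, hz, h1⟩ := hC₁ hL Q f (rayImage h) (g '' rayImage h)
        (fun a b c => (hf.median a b c).trans ((le_abs_self C).trans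
          (le_add_of_nonneg_left (abs_nonneg _)))) (by
          rintro _ ⟨z, hz, rfl⟩
          exact ⟨z, hz, by rw [dist_comm]; exact hg z (Or.inr (Or.inl hz))⟩) a ha
      obtain ⟨z', hz', h2⟩ := hC₂ _ z hz
      exact ⟨z', hz', (dist_triangle _ _ _).trans
        (add_le_add (h1.trans (le_abs_self _)) (h2.trans (le_abs_self _)))⟩
    -- The hull `A` is mapped only near the hull of `h`. A bounded perturbation of `f` maps it into
    -- that hull exactly, as a gate map requires.
    have hf' : ∀ a, ∃ p ∈ medianHull m r (rayImage h ∪ {x, x}), dist (f a) p ≤ E ∧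
        (a ∈ A → p ∈ medianHull m r (rayImage h)) := by
      intro a
      by_cases ha : a ∈ A
      · obtain ⟨p, hp, h1⟩ := hA a ha
        exact ⟨p, medianHull_mono r subset_union_left hp, h1, fun _ => hp⟩
      · exact ⟨f a, hf.mapsTo a, by simpa using h0E, fun h => absurd h ha⟩
    choose f' hf'1 hf'2 hf'3 using hf'
    have hAne : A.Nonempty := medianHull_nonempty v ((Set.Nonempty.image g ⟨h 0,
      self_mem_rayImage le_rfl⟩))
    obtain ⟨p, hp, hpmin⟩ : ∃ p ∈ A, ∀ a ∈ A, Q.d (g x) p ≤ Q.d (g x) a :=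
      ⟨Function.argminOn (Q.d (g x)) A hAne, Function.argminOn_mem _ _ _,
        fun a ha => Function.argminOn_le _ _ ha⟩
    refine ⟨f' p, Q, f', g, p, hf.perturb hL h0E hf'2 hf'1, fun z hz => ?_,
      fun a ha => hf'3 a ha, ⟨hp, hpmin⟩, rfl⟩
    exact (dist_triangle _ _ _).trans (add_le_add (hg z hz) (hf'2 _))
  choose G hG using key
  have hGmem : ∀ x, G x ∈ medianHull m r (rayImage h) := by
    intro x
    obtain ⟨Q, f, g, p, h1, h2, h3, h4, h5⟩ := hG x
    rw [h5]
    exact h3 p h4.1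
  set B := E₀ + E
  refine ⟨G, hGmem, ⟨max K B, fun x => ?_⟩, ?_⟩
  · obtain ⟨Q, f, g, p, h1, h2, h3, h4, h5⟩ := hG x
    exact ⟨x, Q, f, g, p, h1.mono (le_max_left _ _),
      fun z hz => (h2 z hz).trans (le_max_right _ _), h3, h4, h5⟩
  · set C₅ := K + (L * (B + B + B) + L)
    set C₆ := K + (L * (B + 0 + C₅) + L)
    refine ⟨C₆ + (L * (0 + C₃ + 0) + L) + C₄, fun x => ?_⟩
    filter_upwards [hC₃ _ (hGmem x)] with n hn
    obtain ⟨Q, f, g, p, h1, h2, h3, h4, h5⟩ := hG x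
    set c := Q.median (g (h 0)) (g (h n)) (g x) with hc
    set A := medianHull Q.median v (g '' rayImage h)
    have hsucc : medianHull Q.median (v + 1) (g '' rayImage h) ⊆ A :=
      CATZeroCubeComplex.medianHull_subset_of_dimLE h1.dimLE _ _
    have hray : ∀ s, 0 ≤ s → g (h s) ∈ A := fun s hs =>
      CATZeroCubeComplex.subset_medianHull v _ ⟨_, self_mem_rayImage hs, rfl⟩
    have hcA : c ∈ A := hsucc (mem_medianHull_succ.2
      ⟨_, hray 0 le_rfl, _, hray n (Nat.cast_nonneg n), g x, rfl⟩)
    have hmA : Q.median p c (g x) ∈ A := hsucc (mem_medianHull_succ.2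
      ⟨_, h4.1, _, hcA, g x, rfl⟩)
    -- The median of `p`, `c`, `g x` lies in `A`, where joins have stabilised, and between `g x` and
    -- `p`. As `p` is nearest, it equals this median. Hence `G x` is close to the median of `x`, `G
    -- x` and `m (h 0) (h n) x`. Since `G x` also projects near itself, the identity of `hC₄` brings
    -- it close to `m (h 0) (h n) x`.
    have hp : Q.median (g x) p c = p := by
      have e1 := (Q.median_spec (g x) p c).1
      rw [CATZeroCubeComplex.median_swap_right p c, CATZeroCubeComplex.median_swap_left p] at hmA
      have e2 : Q.d (g x) p ≤ Q.d (g x) (Q.median (g x) p c) := h4.2 _ hmA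
      exact CATZeroCubeComplex.eq_of_d_eq_zero (by omega)
    have hnear : ∀ s, 0 ≤ s → dist (f (g (h s))) (h s) ≤ B := fun s hs => by
      rw [dist_comm]
      exact h2 _ (Or.inr (Or.inl (self_mem_rayImage hs)))
    have hx : dist (f (g x)) x ≤ B := by
      rw [dist_comm]
      exact h2 _ (Or.inr (Or.inr (by simp)))
    have k1 : dist (f c) (m (h 0) (h n) x) ≤ C₅ :=
      (dist_triangle _ _ _).trans (add_le_add (h1.median _ _ _)
        (hL.dist_le (hnear 0 le_rfl) (hnear n (Nat.cast_nonneg n)) hx))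
    have k2 : dist (G x) (m x (G x) (m (h 0) (h n) x)) ≤ C₆ := by
      have e := h1.median (g x) p c
      rw [hp] at e
      rw [h5]
      exact (dist_triangle _ _ _).trans (add_le_add e (hL.dist_le hx (by simp) k1))
    have k3 : dist (m x (G x) (m (h 0) (h n) x))
        (m x (m (h 0) (h n) (G x)) (m (h 0) (h n) x)) ≤ L * (0 + C₃ + 0) + L :=
      hL.dist_le (by simp) hn (by simp)
    have k4 := hC₄ ![h 0, h n, x, G x]
    change dist (m x (m (h 0) (h n) (G x)) (m (h 0) (h n) x)) (m (h 0) (h n) x) ≤ C₄ at k4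
    exact (dist_triangle4 _ _ _ _).trans (by linarith)

end MedianRays

/-! ### Growth of the gauge -/

/-- The growth properties of a concave sublinear function that are used below. -/
structure IsSublinearGauge (κ : ℝ → ℝ) : Prop where
  one_le : ∀ t, 0 ≤ t → 1 ≤ κ t
  mono : MonotoneOn κ (Ici 0)
  growth : ∀ A B : ℝ, ∃ C, 1 ≤ C ∧ ∀ s t, 0 ≤ s → 0 ≤ t → s ≤ A * t + B → κ s ≤ C * κ t
  small : ∀ ε > 0, ∃ B, 0 ≤ B ∧ ∀ t, 0 ≤ t → κ t ≤ ε * t + B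

theorem IsSublinear.exists_le_of_large {κ : ℝ → ℝ} (hκ : IsSublinear κ) {ε : ℝ} (hε : 0 < ε) :
    ∃ T, 0 < T ∧ ∀ t, T ≤ t → κ t ≤ ε * t := by
  have h1 := hκ.2.eventually (gt_mem_nhds hε)
  obtain ⟨T, hT⟩ := eventually_atTop.1 h1
  refine ⟨max T 1, by positivity, fun t ht => ?_⟩
  have h2 := hT t ((le_max_left _ _).trans ht)
  have h3 : 0 < t := lt_of_lt_of_le one_pos ((le_max_right _ _).trans ht)
  exact ((div_lt_iff₀ h3).1 h2).le

theorem IsSublinear.isSublinearGauge {κ : ℝ → ℝ} (hκ : IsSublinear κ)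
    (hmono : MonotoneOn κ (Ici 0)) (hconc : ConcaveOn ℝ (Ici 0) κ) : IsSublinearGauge κ where
  one_le := hκ.1
  mono := hmono
  growth A B := by
    -- Concavity on the segment from `0` to `c * t`, together with `κ 0 ≥ 0`.
    have hmul : ∀ c t : ℝ, 1 ≤ c → 0 ≤ t → κ (c * t) ≤ c * κ t := by
      intro c t hc ht
      have hc0 : 0 < c := by linarith
      have h1 := hconc.2 (mem_Ici.2 (mul_nonneg hc0.le ht)) (mem_Ici.2 (le_refl (0 : ℝ)))
        (show 0 ≤ 1 / c by positivity) (show 0 ≤ 1 - 1 / c by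
          rw [sub_nonneg, div_le_one hc0]; exact hc) (by ring)
      simp only [smul_eq_mul, mul_zero, add_zero] at h1
      rw [← mul_assoc, one_div_mul_cancel hc0.ne', one_mul] at h1
      have h2 : 0 ≤ (1 - 1 / c) * κ 0 := by
        refine mul_nonneg ?_ (by linarith [hκ.1 0 le_rfl])
        rw [sub_nonneg, div_le_one hc0]; exact hc
      have h3 : 1 / c * κ (c * t) ≤ κ t := by linarith
      rwa [one_div, inv_mul_le_iff₀ hc0] at h3
    set D := |A| + |B| + 1 with hD
    have hD1 : 1 ≤ D := by
      have := abs_nonneg A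
      have := abs_nonneg B
      linarith
    refine ⟨D + κ D, by linarith [hκ.1 D (by linarith)], fun s t hs ht hst => ?_⟩
    have hκD := hκ.1 D (by linarith)
    have hκt := hκ.1 t ht
    have hA : A * t ≤ |A| * t := mul_le_mul_of_nonneg_right (le_abs_self A) ht
    have hB := le_abs_self B
    have hB0 := abs_nonneg B
    have hA0 := abs_nonneg A
    rcases le_total 1 t with h | h
    · have h1 : s ≤ D * t := by
        rw [hD]
        nlinarith
      have h2 := hmono (mem_Ici.2 hs) (mem_Ici.2 (by positivity)) h1
      have h3 := hmul D t hD1 ht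
      nlinarith
    · have h1 : s ≤ D := by
        rw [hD]
        nlinarith
      have h2 := hmono (mem_Ici.2 hs) (mem_Ici.2 (by linarith)) h1
      nlinarith
  small ε hε := by
    obtain ⟨T, hT0, hT⟩ := hκ.exists_le_of_large hε
    refine ⟨κ T, by linarith [hκ.1 T hT0.le], fun t ht => ?_⟩
    rcases le_total T t with h | h
    · have := hT t h
      have := hκ.1 T hT0.le
      linarith
    · have := hmono (mem_Ici.2 ht) (mem_Ici.2 hT0.le) h
      have : 0 ≤ ε * t := by positivity
      linarith

theorem IsSublinearGauge.exists_smallComparedTo {κ : ℝ → ℝ} (hκ : IsSublinearGauge κ) (M : ℝ) :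
    ∃ r₀, 0 < r₀ ∧ ∀ r, r₀ ≤ r → SmallComparedTo κ M r := by
  obtain ⟨B, hB0, hB⟩ := hκ.small (1 / (4 * (|M| + 1))) (by positivity)
  refine ⟨4 * |M| * B + 1, by positivity, fun r hr => ?_⟩
  have hr0 : 0 < r := lt_of_lt_of_le (by positivity) hr
  have h1 := hB r hr0.le
  have h2 := hκ.one_le r hr0.le
  unfold SmallComparedTo
  rw [le_div_iff₀ (by linarith)]
  have h3 : |M| * (1 / (4 * (|M| + 1)) * r) ≤ r / 4 := by
    rw [show |M| * (1 / (4 * (|M| + 1)) * r) = (|M| / (|M| + 1)) * (r / 4) by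
      field_simp]
    have : |M| / (|M| + 1) ≤ 1 := by
      rw [div_le_one (by positivity)]; linarith
    nlinarith
  have h4 : |M| * κ r ≤ |M| * (1 / (4 * (|M| + 1)) * r + B) :=
    mul_le_mul_of_nonneg_left h1 (abs_nonneg M)
  have h5 : M * κ r ≤ |M| * κ r := mul_le_mul_of_nonneg_right (le_abs_self M) (by linarith)
  nlinarith

/-! ### Discrete quasi-geodesics and Morse rays -/

section CoarseGeodesics

variable {X : Type u} [MetricSpace X]

/-- The sequence `c 0, …, c T` is a discrete quasi-geodesic with constant `lam`. -/
def IsCoarseGeodesic (lam : ℝ) (c : ℕ → X) (T : ℕ) : Prop :=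
  (∀ i < T, dist (c i) (c (i + 1)) ≤ lam) ∧
  ∀ i j, i ≤ j → j ≤ T → (j : ℝ) - i ≤ lam * dist (c i) (c j) + lam

theorem IsCoarseGeodesic.dist_le {lam : ℝ} {c : ℕ → X} {T : ℕ} (h : IsCoarseGeodesic lam c T)
    {i j : ℕ} (hij : i ≤ j) (hj : j ≤ T) : dist (c i) (c j) ≤ lam * (j - i) := by
  induction j, hij using Nat.le_induction with
  | base => simp
  | succ j hij ih =>
    have h1 := ih (by omega)
    have h2 := h.1 j (by omega)
    have h3 := dist_triangle (c i) (c j) (c (j + 1))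
    push_cast
    linarith

theorem IsCoarseGeodesic.mono {lam lam' : ℝ} {c : ℕ → X} {T : ℕ} (h : IsCoarseGeodesic lam c T)
    (hl : lam ≤ lam') : IsCoarseGeodesic lam' c T := by
  refine ⟨fun i hi => (h.1 i hi).trans hl, fun i j hij hj => (h.2 i j hij hj).trans ?_⟩
  gcongr

theorem IsCoarseGeodesic.restrict {lam : ℝ} {c : ℕ → X} {T T' : ℕ} (h : IsCoarseGeodesic lam c T)
    (hT : T' ≤ T) : IsCoarseGeodesic lam c T' :=
  ⟨fun i hi => h.1 i (hi.trans_le hT), fun i j hij hj => h.2 i j hij (hj.trans hT)⟩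

theorem continuousOn_Ici_of_Icc {Y : Type*} [TopologicalSpace Y] {β : ℝ → Y}
    (h : ∀ i : ℕ, ContinuousOn β (Icc (i : ℝ) (i + 1))) : ContinuousOn β (Ici 0) := by
  have h1 : ∀ n : ℕ, ContinuousOn β (Icc (0 : ℝ) n) := by
    intro n
    induction n with
    | zero => simp
    | succ n ih =>
      have := ih.union_of_isClosed (h n) isClosed_Icc isClosed_Icc
      rwa [Icc_union_Icc_eq_Icc (Nat.cast_nonneg n) (by linarith), ← Nat.cast_succ] at this
  intro t ht
  obtain ⟨n, hn⟩ := exists_nat_gt t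
  refine (h1 n t ⟨ht, hn.le⟩).mono_of_mem_nhdsWithin ?_
  rw [← Ici_inter_Iic]
  exact inter_mem self_mem_nhdsWithin (mem_nhdsWithin_of_mem_nhds (Iic_mem_nhds hn))

/-- Geodesic interpolation of a sequence. -/
theorem IsGeodesicMetric.exists_interpolation (hgeod : IsGeodesicMetric X) (c : ℕ → X) :
    ∃ β : ℝ → X, ContinuousOn β (Ici 0) ∧ (∀ i : ℕ, β i = c i) ∧
      ∀ t, 0 ≤ t → dist (β t) (c ⌊t⌋₊) ≤ dist (c ⌊t⌋₊) (c (⌊t⌋₊ + 1)) := by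
  choose γ h0 h1 hγ using fun i => hgeod (c i) (c (i + 1))
  set D : ℕ → ℝ := fun i => dist (c i) (c (i + 1)) with hD
  have hmem : ∀ (i : ℕ) (t : ℝ), t ∈ Icc (i : ℝ) (i + 1) → (t - i) * D i ∈ Icc 0 (D i) := by
    intro i t ht
    have : 0 ≤ D i := dist_nonneg
    exact ⟨mul_nonneg (by linarith [ht.1]) this, by nlinarith [ht.2]⟩
  refine ⟨fun t => γ ⌊t⌋₊ ((t - ⌊t⌋₊) * D ⌊t⌋₊), ?_, fun i => by simp [h0], fun t ht => ?_⟩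
  · refine continuousOn_Ici_of_Icc fun i => ?_
    have hc : ContinuousOn (γ i) (Icc 0 (D i)) := by
      have : LipschitzOnWith 1 (γ i) (Icc 0 (D i)) :=
        LipschitzOnWith.of_dist_le_mul fun s hs t ht => by
          rw [hγ i s hs t ht, Real.dist_eq, NNReal.coe_one, one_mul]
      exact this.continuousOn
    have hc' : ContinuousOn (fun t : ℝ => γ i ((t - i) * D i)) (Icc (i : ℝ) (i + 1)) :=
      hc.comp (by fun_prop) (fun t ht => hmem i t ht)
    refine hc'.congr fun t ht => ?_
    rcases ht.2.lt_or_eq with hlt | heq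
    · have : ⌊t⌋₊ = i := (Nat.floor_eq_iff ((Nat.cast_nonneg i).trans ht.1)).2 ⟨ht.1, hlt⟩
      simp only [this]
    · have : ⌊t⌋₊ = i + 1 := by
        rw [heq, ← Nat.cast_succ, Nat.floor_natCast]
      simp only [this]
      rw [heq]
      push_cast
      rw [sub_self, zero_mul, h0, add_sub_cancel_left, one_mul, h1]
  · set i := ⌊t⌋₊
    have ht' : t ∈ Icc (i : ℝ) (i + 1) := ⟨Nat.floor_le ht, (Nat.lt_floor_add_one t).le⟩
    have h2 := hmem i t ht'
    have h3 := hγ i _ h2 0 ⟨le_rfl, dist_nonneg⟩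
    rw [h0, sub_zero, abs_of_nonneg h2.1] at h3
    change dist (γ i ((t - i) * D i)) (c i) ≤ D i
    rw [h3]
    exact h2.2

/-- A discrete quasi-geodesic ray extends to a continuous one. -/
theorem IsGeodesicMetric.exists_isQuasiGeodesicOn (hgeod : IsGeodesicMetric X) {lam : ℝ}
    (hlam : 1 ≤ lam) {c : ℕ → X} (hc : ∀ T, IsCoarseGeodesic lam c T) :
    ∃ β : ℝ → X, IsQuasiGeodesicOn lam (4 * lam) β (Ici 0) ∧ (∀ i : ℕ, β i = c i) ∧
      ∀ t, 0 ≤ t → dist (β t) (c ⌊t⌋₊) ≤ lam := by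
  obtain ⟨β, hβ, hβi, hβd⟩ := hgeod.exists_interpolation c
  have hd : ∀ t, 0 ≤ t → dist (β t) (c ⌊t⌋₊) ≤ lam := fun t ht =>
    (hβd t ht).trans ((hc (⌊t⌋₊ + 1)).1 _ (Nat.lt_succ_self _))
  have key : ∀ s t, 0 ≤ s → s ≤ t → (t - s) / lam - 4 * lam ≤ dist (β s) (β t) ∧
      dist (β s) (β t) ≤ lam * (t - s) + 4 * lam := by
    intro s t hs hst
    have hfl : ⌊s⌋₊ ≤ ⌊t⌋₊ := Nat.floor_mono hst
    have h1 := hd s hs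
    have h2 := hd t (hs.trans hst)
    have h3 := (hc ⌊t⌋₊).dist_le hfl le_rfl
    have h4 := (hc ⌊t⌋₊).2 _ _ hfl le_rfl
    have f1 := Nat.floor_le hs
    have f2 := Nat.lt_floor_add_one s
    have f3 := Nat.floor_le (hs.trans hst)
    have f4 := Nat.lt_floor_add_one t
    constructor
    · have h5 := dist_triangle4 (c ⌊s⌋₊) (β s) (β t) (c ⌊t⌋₊)
      rw [dist_comm (c ⌊s⌋₊) (β s)] at h5
      rw [sub_le_iff_le_add, div_le_iff₀ (by linarith)]
      nlinarith
    · have h5 := dist_triangle4 (β s) (c ⌊s⌋₊) (c ⌊t⌋₊) (β t)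
      rw [dist_comm (c ⌊t⌋₊) (β t)] at h5
      nlinarith
  refine ⟨β, ⟨hβ, hlam, by linarith, fun s hs t ht => ?_⟩, hβi, hd⟩
  rcases le_total s t with h | h
  · rw [abs_sub_comm, abs_of_nonneg (sub_nonneg.2 h)]
    exact key s t hs h
  · rw [abs_of_nonneg (sub_nonneg.2 h), dist_comm]
    exact key t s ht h

theorem IsQuasiGeodesicOn.firstTime_spec {o : X} {a b : ℝ} {β : ℝ → X}
    (hβ : IsQuasiGeodesicOn a b β (Ici 0)) (hβ0 : β 0 = o) {R : ℝ} (hR : 0 ≤ R) :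
    0 ≤ firstTime o β R ∧ dist (β (firstTime o β R)) o = R ∧
      ∀ t, 0 ≤ t → t ≤ firstTime o β R → dist (β t) o ≤ R := by
  obtain ⟨hcont, ha, hb, hqi⟩ := hβ
  have hcont' : ContinuousOn (fun t => dist (β t) o) (Ici 0) := continuous_dist.comp_continuousOn (ContinuousOn.prodMk hcont continuousOn_const)
  have hivt : ∀ t, 0 ≤ t → R ≤ dist (β t) o → ∃ s, 0 ≤ s ∧ s ≤ t ∧ dist (β s) o = R := by
    intro t ht hRt
    obtain ⟨s, hs, hs'⟩ := intermediate_value_Icc ht (hcont'.mono Icc_subset_Ici_self)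
      (show R ∈ Icc (dist (β 0) o) (dist (β t) o) from ⟨by rw [hβ0, dist_self]; exact hR, hRt⟩)
    exact ⟨s, hs.1, hs.2, hs'⟩
  set S := {t | 0 ≤ t ∧ dist (β t) o = R} with hS
  have hclosed : IsClosed S := by
    have := hcont'.preimage_isClosed_of_isClosed isClosed_Ici (isClosed_singleton (x := R))
    exact this
  have hbdd : BddBelow S := ⟨0, fun t ht => ht.1⟩
  have hne : S.Nonempty := by
    -- At time `a * (R + b)` the lower quasi-isometry bound is exactly `R`, so the sphere of radius
    -- `R` has been reached.
    have h1 := (hqi 0 (mem_Ici.2 le_rfl) (a * (R + b)) (mem_Ici.2 (by positivity))).1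
    rw [zero_sub, abs_neg, abs_of_nonneg (by positivity), mul_div_cancel_left₀ _ (by linarith),
      hβ0, dist_comm] at h1
    obtain ⟨s, hs, -, hs'⟩ := hivt (a * (R + b)) (by positivity) (by linarith)
    exact ⟨s, hs, hs'⟩
  have hmem : firstTime o β R ∈ S := hclosed.csInf_mem hne hbdd
  refine ⟨hmem.1, hmem.2, fun t ht htR => ?_⟩
  by_contra hcon
  push Not at hcon
  obtain ⟨s, hs, hst, hs'⟩ := hivt t ht hcon.le
  have h1 : firstTime o β R ≤ s := csInf_le hbdd ⟨hs, hs'⟩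
  have h2 : s = t := le_antisymm hst (htR.trans h1)
  rw [h2] at hs'
  linarith

/-- Discrete quasi-geodesic rays from near `o` that end in `Z` stay in `κ`-neighbourhoods
of `Z`. -/
def HasMorseRays (o : X) (κ : ℝ → ℝ) (Z : Set X) : Prop :=
  ∀ lam, 1 ≤ lam → ∃ C, ∀ c : ℕ → X, (∀ T, IsCoarseGeodesic lam c T) → dist (c 0) o ≤ lam →
    (∃ I, ∀ i, I ≤ i → c i ∈ Z) → ∀ i, Metric.infDist (c i) Z ≤ C * κ (dist (c i) o)

/-- A discrete ray starting near `o`, preceded by `o`. -/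
def prependPoint (o : X) (c : ℕ → X) : ℕ → X
  | 0 => o
  | i + 1 => c i

theorem isCoarseGeodesic_prependPoint {o : X} {lam : ℝ} (hlam : 1 ≤ lam) {c : ℕ → X}
    (hc : ∀ T, IsCoarseGeodesic lam c T) (h0 : dist (c 0) o ≤ lam) (T : ℕ) :
    IsCoarseGeodesic (lam * lam + lam + 1) (prependPoint o c) T := by
  refine ⟨fun i _ => ?_, fun i j hij _ => ?_⟩
  · cases i with
    | zero =>
      change dist o (c 0) ≤ _
      rw [dist_comm]
      nlinarith
    | succ i =>
      have := (hc (i + 1)).1 i (Nat.lt_succ_self i)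
      change dist (c i) (c (i + 1)) ≤ _
      nlinarith
  · cases i with
    | zero =>
      cases j with
      | zero =>
        rw [sub_self, dist_self]
        nlinarith
      | succ j =>
        have h1 := (hc j).2 0 j (Nat.zero_le j) le_rfl
        have h2 := dist_triangle (c 0) o (c j)
        change ((j + 1 : ℕ) : ℝ) - (0 : ℕ) ≤ _ * dist o (c j) + _
        push_cast at h1 ⊢
        have h3 : 0 ≤ dist o (c j) := dist_nonneg
        have h4 : lam * dist (c 0) (c j) ≤ lam * (lam + dist o (c j)) := by gcongr; linarith
        nlinarith [mul_nonneg (mul_nonneg (show 0 ≤ lam by linarith) (show 0 ≤ lam by linarith)) h3]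
    | succ i =>
      cases j with
      | zero => omega
      | succ j =>
        have h1 := (hc j).2 i j (by omega) le_rfl
        change ((j + 1 : ℕ) : ℝ) - (i + 1 : ℕ) ≤ _ * dist (c i) (c j) + _
        push_cast
        have h3 : 0 ≤ dist (c i) (c j) := dist_nonneg
        nlinarith [mul_nonneg (mul_nonneg (show 0 ≤ lam by linarith) (show 0 ≤ lam by linarith)) h3]

/-- Prepending `o` puts the initial point on `Z`. Cutting the interpolated ray at an index beyond
`I` and `i` puts the other end on `Z`. The point `c i` then has index `i + 1`. -/
theorem IsWeaklyKappaMorse.hasMorseRays (hgeod : IsGeodesicMetric X) {o : X} {κ : ℝ → ℝ}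
    {Z : Set X} (hZ : IsWeaklyKappaMorse o κ Z) (ho : o ∈ Z) : HasMorseRays o κ Z := by
  obtain ⟨-, M, hM⟩ := hZ
  intro lam hlam
  set lam' := lam * lam + lam + 1 with hlam'
  refine ⟨M lam' (4 * lam'), fun c hc h0 ⟨I, hI⟩ i => ?_⟩
  obtain ⟨β, hβ, hβi, -⟩ := hgeod.exists_isQuasiGeodesicOn (by nlinarith)
    (isCoarseGeodesic_prependPoint hlam hc h0)
  have h1 := hM lam' (4 * lam') β 0 (max I i + 1 : ℕ) (Nat.cast_nonneg _)
    ⟨hβ.1.mono Icc_subset_Ici_self, hβ.2.1, hβ.2.2.1, fun s hs t ht =>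
      hβ.2.2.2 s hs.1 t ht.1⟩
    (by
      have := hβi 0
      rw [Nat.cast_zero] at this
      rw [this]
      exact ho)
    (by
      rw [hβi]
      exact hI _ (le_max_left _ _))
  have h2 : β (i + 1 : ℕ) ∈ kappaNhd o κ Z (M lam' (4 * lam')) :=
    h1 ⟨_, ⟨Nat.cast_nonneg _, by exact_mod_cast Nat.succ_le_succ (le_max_right I i)⟩, rfl⟩
  rw [hβi] at h2
  exact h2

/-- The interpolated ray is eventually within `lam'` of `Z`, so a constant `κ'` meets the hypothesis
of the Morse property at every sufficiently large radius. -/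
theorem IsKappaMorse.hasMorseRays (hgeod : IsGeodesicMetric X) {o : X} {κ : ℝ → ℝ}
    (hκ : IsSublinearGauge κ) {Z : Set X} (hZ : IsKappaMorse o κ Z) :
    HasMorseRays o κ Z := by
  obtain ⟨-, M, -, hM⟩ := hZ
  intro lam hlam
  set lam' := lam * lam + lam + 1 with hlam'
  have hlam1 : 1 ≤ lam' := by nlinarith
  refine ⟨M lam' (4 * lam'), fun c hc h0 ⟨I, hI⟩ i => ?_⟩
  obtain ⟨β, hβ, hβi, hβd⟩ := hgeod.exists_isQuasiGeodesicOn hlam1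
    (isCoarseGeodesic_prependPoint hlam hc h0)
  have hβ0 : β 0 = o := by
    have := hβi 0
    rwa [Nat.cast_zero] at this
  obtain ⟨r₀, hr₀, hr⟩ := hκ.exists_smallComparedTo (M lam' (4 * lam'))
  set N := max I i + 1
  -- This `r` exceeds the norms of the first points by more than `lam'`, so at radius `r` or more
  -- the ray is past time `N`: the point at index `i + 1` lies before `β_r`, and `β_R` is already
  -- near `Z`. The summand `r₀` makes the gauge small compared to `r`.
  set r := r₀ + ∑ j ∈ Finset.range (N + 1), dist (prependPoint o c j) o + lam' + 1 with hrdef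
  have hsum : ∀ j ≤ N, dist (prependPoint o c j) o + lam' < r := by
    intro j hj
    have := Finset.single_le_sum (f := fun j => dist (prependPoint o c j) o)
      (fun j _ => dist_nonneg) (show j ∈ Finset.range (N + 1) by simp; omega)
    linarith
  have hsum0 : 0 ≤ ∑ j ∈ Finset.range (N + 1), dist (prependPoint o c j) o :=
    Finset.sum_nonneg fun _ _ => dist_nonneg
  have hr0 : 0 < r := by linarith
  have hfar : ∀ t, 0 ≤ t → r ≤ dist (β t) o → (N : ℝ) ≤ t := by
    intro t ht hrt
    by_contra hcon
    push Not at hcon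
    have h1 : ⌊t⌋₊ ≤ N := ((Nat.floor_lt ht).2 hcon).le
    have h2 := hsum _ h1
    have h3 := hβd t ht
    have h4 := dist_triangle (β t) (prependPoint o c ⌊t⌋₊) o
    linarith
  obtain ⟨R, hrR, hR⟩ := hM (fun _ => lam')
    ⟨fun _ _ => hlam1, tendsto_const_nhds.div_atTop tendsto_id⟩ r hr0
  have hRspec := hβ.firstTime_spec hβ0 (hr0.le.trans hrR)
  have hrspec := hβ.firstTime_spec hβ0 hr0.le
  have h1 := hR lam' (4 * lam') β hβ hβ0 (hr r (by linarith)) (by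
    have h2 := hfar _ hRspec.1 (by rw [hRspec.2.1]; exact hrR)
    have h3 : N ≤ ⌊firstTime o β R⌋₊ := Nat.le_floor h2
    have h4 : prependPoint o c ⌊firstTime o β R⌋₊ ∈ Z := by
      obtain ⟨k, hk⟩ := Nat.exists_eq_add_of_le (show 1 ≤ ⌊firstTime o β R⌋₊ by omega)
      rw [hk, add_comm]
      exact hI _ (by
        have := le_max_left I i
        omega)
    exact (Metric.infDist_le_dist_of_mem h4).trans (hβd _ hRspec.1))
  have h2 : β (i + 1 : ℕ) ∈ kappaNhd o κ Z (M lam' (4 * lam')) := by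
    refine h1 ⟨_, ⟨Nat.cast_nonneg _, ?_⟩, rfl⟩
    have h3 := hfar _ hrspec.1 hrspec.2.1.ge
    refine le_trans ?_ h3
    have := le_max_right I i
    exact_mod_cast (by omega : i + 1 ≤ N)
  rw [hβi] at h2
  exact h2

end CoarseGeodesics

/-! ### Shortcuts from a coarse geodesic to a ray -/

section Surgery

variable {X : Type u} [MetricSpace X]

/-- The concatenation of `c 0, …, c T` with the sequence `e`, where `e 0 = c T`. -/
def concatSeq {α : Type*} (c : ℕ → α) (T : ℕ) (e : ℕ → α) (k : ℕ) : α :=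
  if k ≤ T then c k else e (k - T)

theorem concatSeq_of_le {α : Type*} {c e : ℕ → α} {T k : ℕ} (h : k ≤ T) :
    concatSeq c T e k = c k := if_pos h

theorem concatSeq_add {α : Type*} {c e : ℕ → α} {T : ℕ} (h0 : e 0 = c T) (k : ℕ) :
    concatSeq c T e (T + k) = e k := by
  unfold concatSeq
  split_ifs with h
  · obtain rfl : k = 0 := by omega
    exact h0.symm
  · rw [Nat.add_sub_cancel_left]

theorem IsCoarseGeodesic.concat {lam : ℝ} {c e : ℕ → X} {T T' : ℕ}
    (hc : IsCoarseGeodesic lam c T) (he : IsCoarseGeodesic lam e T') (h0 : e 0 = c T)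
    (hcross : ∀ i ≤ T, ∀ j ≤ T', ((T : ℝ) - i) + j ≤ lam * dist (c i) (e j) + lam) :
    IsCoarseGeodesic lam (concatSeq c T e) (T + T') := by
  refine ⟨fun i hi => ?_, fun i j hij hj => ?_⟩
  · rcases lt_or_ge i T with h | h
    · rw [concatSeq_of_le h.le, concatSeq_of_le h]
      exact hc.1 i h
    · obtain ⟨k, rfl⟩ := Nat.exists_eq_add_of_le h
      rw [add_assoc, concatSeq_add h0, concatSeq_add h0]
      exact he.1 k (by omega)
  · rcases le_total j T with h | h
    · rw [concatSeq_of_le h, concatSeq_of_le (hij.trans h)]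
      exact hc.2 i j hij h
    · obtain ⟨k, rfl⟩ := Nat.exists_eq_add_of_le h
      rw [concatSeq_add h0]
      rcases le_total i T with h' | h'
      · rw [concatSeq_of_le h']
        have := hcross i h' k (by omega)
        push_cast
        linarith
      · obtain ⟨k', rfl⟩ := Nat.exists_eq_add_of_le h'
        rw [concatSeq_add h0]
        have := he.2 k' k (by omega) (by omega)
        push_cast
        linarith

theorem IsQuasiGeodesicOn.isCoarseGeodesic {a b : ℝ} {q : ℝ → X}
    (hq : IsQuasiGeodesicOn a b q (Ici 0)) (T : ℕ) :
    IsCoarseGeodesic (a + b + a * b) (fun n : ℕ => q n) T := by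
  obtain ⟨-, ha, hb, hqi⟩ := hq
  have hab : 0 ≤ a * b := by positivity
  refine ⟨fun i _ => ?_, fun i j hij _ => ?_⟩
  · have h1 := (hqi i (mem_Ici.2 (Nat.cast_nonneg _)) (i + 1 : ℕ) (mem_Ici.2 (Nat.cast_nonneg _))).2
    push_cast at h1
    rw [abs_sub_comm, add_sub_cancel_left, abs_one, mul_one] at h1
    push_cast
    linarith
  · have h1 := (hqi i (mem_Ici.2 (Nat.cast_nonneg _)) j (mem_Ici.2 (Nat.cast_nonneg _))).1
    have h2 : (i : ℝ) ≤ j := by exact_mod_cast hij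
    rw [abs_sub_comm, abs_of_nonneg (by linarith), sub_le_iff_le_add,
      div_le_iff₀ (by linarith)] at h1
    have : 0 ≤ dist (q i) (q j) := dist_nonneg
    nlinarith [mul_nonneg hb this, mul_nonneg hab this]

/-- The pair of points of two discrete quasi-geodesics that is best for a shortcut. -/
theorem exists_shortcut {l δ : ℝ} (hl : 1 ≤ l) (hδ : 4 * l ^ 3 * δ = 1) {c p : ℕ → X}
    {T s₁ : ℕ} (hc : IsCoarseGeodesic l c T) (hp : ∀ T, IsCoarseGeodesic l p T)
    (h0 : dist (c 0) (p 0) ≤ l) :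
    ∃ i₀ s₀, i₀ ≤ T ∧ s₁ ≤ s₀ ∧ ∀ i s, i ≤ T → s₁ ≤ s →
      dist (c i₀) (p s₀) + δ * i₀ - δ * s₀ ≤ dist (c i) (p s) + δ * i - δ * s := by
  -- Minimising this function trades the length of the shortcut against leaving `c` early and
  -- joining `p` late. Moving either end by one index changes the penalty by `δ`.
  set Ψ : ℕ × ℕ → ℝ := fun x => dist (c x.1) (p x.2) + δ * x.1 - δ * x.2 with hΨ
  have hl3 : 1 ≤ l ^ 3 := one_le_pow₀ hl
  have hδ0 : 0 < δ := by
    by_contra h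
    push Not at h
    nlinarith
  have hlδ : 4 * (l * δ) ≤ 1 := by
    have : l * δ ≤ l ^ 3 * δ := by
      have : l ≤ l ^ 3 := le_self_pow₀ hl (by norm_num)
      gcongr
    linarith
  -- The distance from `c i` to `p s` grows in `s` at rate at least `1 / l`, while `δ ≤ 1 / (4 *
  -- l)`. Beyond `S` the function exceeds its value at `(T, s₁)`, so the minimum is attained in a
  -- finite box.
  set S := max s₁ ⌈2 * l * (Ψ (T, s₁) + 1 + l * T + l)⌉₊ with hS
  obtain ⟨⟨i₀, s₀⟩, hmem, hmin⟩ := Finset.exists_min_image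
    (Finset.range (T + 1) ×ˢ Finset.Icc s₁ S) Ψ ⟨(T, s₁), by simp [hS]⟩
  simp only [Finset.mem_product, Finset.mem_range, Finset.mem_Icc] at hmem
  refine ⟨i₀, s₀, by omega, hmem.2.1, fun i s hi hs => ?_⟩
  change Ψ (i₀, s₀) ≤ Ψ (i, s)
  rcases le_or_gt s S with h | h
  · exact hmin (i, s) (by simp; omega)
  · refine (hmin (T, s₁) (by simp [hS])).trans ?_
    have h1 : 2 * l * (Ψ (T, s₁) + 1 + l * T + l) ≤ s :=
      (Nat.le_ceil _).trans (by exact_mod_cast (le_max_right _ _).trans h.le)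
    have h2 := (hp s).2 0 s (Nat.zero_le _) le_rfl
    have h3 := hc.dist_le (Nat.zero_le i) hi
    have h4 : (i : ℝ) ≤ T := by exact_mod_cast hi
    have h5 := dist_triangle4 (p 0) (c 0) (c i) (p s)
    rw [dist_comm (p 0) (c 0)] at h5
    push_cast at h2 h3
    rw [sub_zero] at h2 h3
    have h6 : l * (i : ℝ) ≤ l * T := by gcongr
    have h7 : l * dist (p 0) (p s) ≤ l * (l + l * T + dist (c i) (p s)) := by
      gcongr
      linarith
    have h8 : 0 ≤ δ * (i : ℝ) := by positivity
    have h9 : 2 * (l * δ * s) ≤ s / 2 := by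
      have : 0 ≤ (s : ℝ) := Nat.cast_nonneg s
      nlinarith
    have h10 : l * Ψ (T, s₁) ≤ l * (dist (c i) (p s) - δ * s) := by
      nlinarith
    have h11 : Ψ (T, s₁) ≤ dist (c i) (p s) - δ * s := le_of_mul_le_mul_left h10 (by linarith)
    change Ψ (T, s₁) ≤ dist (c i) (p s) + δ * i - δ * s
    linarith

/-- Discrete quasi-geodesics that follow a shortcut of `exists_shortcut`. -/
theorem IsGeodesicMetric.exists_shortcut_ray (hgeod : IsGeodesicMetric X) {l δ : ℝ} (hl : 1 ≤ l)
    (hδ : 4 * l ^ 3 * δ = 1) {c p : ℕ → X} {i₀ s₀ : ℕ}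
    (hc : IsCoarseGeodesic l c i₀) (hp : ∀ T, IsCoarseGeodesic l p T)
    (hmin : ∀ i s, i ≤ i₀ → s₀ ≤ s →
      dist (c i₀) (p s₀) + δ * (i₀ - i) + δ * (s - s₀) ≤ dist (c i) (p s)) :
    ∃ e : ℕ → X, (∀ T, IsCoarseGeodesic (4 * l ^ 3) e T) ∧ (∀ i ≤ i₀, e i = c i) ∧
      ∃ I, ∀ i, I ≤ i → ∃ s, e i = p s := by
  have hl3 : l ≤ l ^ 3 := le_self_pow₀ hl (by norm_num)
  set L := 4 * l ^ 3 with hL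
  have hL1 : 4 ≤ L := by linarith
  have hδ0 : 0 < δ := by
    by_contra h
    push Not at h
    nlinarith
  have hδ1 : δ ≤ 1 := by nlinarith
  -- Since `L * δ = 1`, growth at rate `δ` suffices for the constant `L`. The minimality of the
  -- shortcut supplies such growth between any two of the three pieces, and the spare `1` absorbs
  -- rounding along the geodesic.
  have hLδ : ∀ x y D : ℝ, 0 ≤ x → δ * y + x ≤ D → y + x + 1 ≤ L * D + L := by
    intro x y D hx h
    have h1 : L * (δ * y + x) ≤ L * D := by gcongr
    have h2 : L * (δ * y + x) = y + L * x := by linear_combination y * hδ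
    nlinarith
  obtain ⟨γ, hγ0, hγ1, hγ⟩ := hgeod (c i₀) (p s₀)
  set ℓ := dist (c i₀) (p s₀) with hℓ
  have hℓ0 : 0 ≤ ℓ := dist_nonneg
  set k₀ := ⌈ℓ⌉₊ with hk₀
  have hk₀' : (k₀ : ℝ) < ℓ + 1 := Nat.ceil_lt_add_one hℓ0
  have hk₀'' : ℓ ≤ k₀ := Nat.le_ceil ℓ
  set w : ℕ → X := fun j => γ (min j ℓ) with hw
  have hmem : ∀ j : ℕ, min (j : ℝ) ℓ ∈ Icc 0 ℓ := fun j =>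
    ⟨le_min (Nat.cast_nonneg j) hℓ0, min_le_right _ _⟩
  have hw0 : w 0 = c i₀ := by simp [hw, hγ0, hℓ0]
  have hwk : w k₀ = p s₀ := by simp only [hw]; rw [min_eq_right hk₀'', hγ1]
  have hwd : ∀ i j, i ≤ j → dist (w i) (w j) = min (j : ℝ) ℓ - min (i : ℝ) ℓ := by
    intro i j hij
    have h1 : (i : ℝ) ≤ j := by exact_mod_cast hij
    rw [hγ _ (hmem i) _ (hmem j), abs_sub_comm, abs_of_nonneg]
    exact sub_nonneg.2 (min_le_min_right _ h1)
  have hmin1 : ∀ j ≤ k₀, (j : ℝ) ≤ min (j : ℝ) ℓ + 1 := by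
    intro j hj
    have : (j : ℝ) ≤ k₀ := by exact_mod_cast hj
    rw [← min_add_add_right]
    exact le_min (by linarith) (by linarith)
  have hmin2 : ∀ j ≤ k₀, (k₀ : ℝ) - j ≤ ℓ - min (j : ℝ) ℓ + 1 := by
    intro j _
    have := min_le_left (j : ℝ) ℓ
    linarith
  have hwc : IsCoarseGeodesic L w k₀ := by
    refine ⟨fun i _ => ?_, fun i j hij hj => ?_⟩
    · rw [hwd _ _ (Nat.le_succ i)]
      have : min ((i + 1 : ℕ) : ℝ) ℓ ≤ min (i : ℝ) ℓ + 1 := by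
        rw [← min_add_add_right]
        push_cast
        exact min_le_min_left _ (by linarith)
      linarith
    · rw [hwd _ _ hij]
      have h1 := hmin1 j hj
      have h2 := min_le_left (i : ℝ) ℓ
      have h3 : min (i : ℝ) ℓ ≤ min (j : ℝ) ℓ :=
        min_le_min_right _ (by exact_mod_cast hij)
      nlinarith
  have hpc : ∀ T, IsCoarseGeodesic L (fun j => p (s₀ + j)) T := by
    intro T
    have := (hp (s₀ + T)).mono (show l ≤ L by linarith)
    refine ⟨fun i hi => this.1 (s₀ + i) (by omega), fun i j hij hj => ?_⟩
    have h1 := this.2 (s₀ + i) (s₀ + j) (by omega) (by omega)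
    push_cast at h1
    linarith
  set e₁ := concatSeq w k₀ (fun j => p (s₀ + j)) with he₁
  have hp0 : (fun j => p (s₀ + j)) 0 = w k₀ := by simp [hwk]
  have he₁c : ∀ T, IsCoarseGeodesic L e₁ (k₀ + T) := by
    intro T
    refine hwc.concat (hpc T) hp0 fun i hi j _ => ?_
    have h1 := hmin i₀ (s₀ + j) le_rfl (by omega)
    have h2 := dist_triangle (c i₀) (w i) (p (s₀ + j))
    have h3 := hwd 0 i (Nat.zero_le i)
    rw [hw0, Nat.cast_zero, min_eq_left hℓ0] at h3
    push_cast at h1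
    have h4 := hLδ (ℓ - min (i : ℝ) ℓ) j (dist (w i) (p (s₀ + j)))
      (sub_nonneg.2 (min_le_right _ _)) (by linarith)
    have := hmin2 i hi
    linarith
  have he₁0 : e₁ 0 = c i₀ := by rw [he₁, concatSeq_of_le (Nat.zero_le _), hw0]
  have hcL := hc.mono (show l ≤ L by linarith)
  refine ⟨concatSeq c i₀ e₁, fun T => ?_, fun i hi => concatSeq_of_le hi, i₀ + k₀,
    fun i hi => ?_⟩
  · refine IsCoarseGeodesic.restrict ?_ (show T ≤ i₀ + (k₀ + T) by omega)
    refine hcL.concat (he₁c T) he₁0 fun i hi j hj => ?_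
    rcases le_total j k₀ with h | h
    · rw [he₁, concatSeq_of_le h]
      have h1 := hmin i s₀ hi le_rfl
      have h2 := dist_triangle (c i) (w j) (p s₀)
      have h3 := hwd j k₀ h
      rw [hwk, min_eq_right hk₀''] at h3
      have h4 := hLδ (min (j : ℝ) ℓ) (i₀ - i) (dist (c i) (w j)) (hmem j).1 (by linarith)
      have := hmin1 j h
      linarith
    · obtain ⟨k, rfl⟩ := Nat.exists_eq_add_of_le h
      rw [he₁, concatSeq_add hp0]
      have h1 := hmin i (s₀ + k) hi (by omega)
      push_cast at h1
      have h4 := hLδ ℓ (i₀ - i + k) (dist (c i) (p (s₀ + k))) hℓ0 (by linarith)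
      push_cast
      linarith
  · obtain ⟨k, rfl⟩ := Nat.exists_eq_add_of_le hi
    refine ⟨s₀ + k, ?_⟩
    rw [add_assoc, concatSeq_add he₁0, he₁, concatSeq_add hp0]

/-- The shortcut leaves `c` late. If `i₀` were small, `p s₀` would be near the start and `s₀` small.
But `s₀ ≥ s₁`, and `s₁` is comparable to `T` because `p s₁` is near the far end of `c`. The choice
of `δ` turns the loss from the penalty into `T / 4`, which is absorbed. -/
theorem shortcut_index_le {l δ ε T E i i₀ s₀ s₁ x y : ℝ} (hl : 1 ≤ l) (hδ : 4 * l ^ 3 * δ = 1)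
    (hε : 8 * l ^ 4 * ε = 1) (hE0 : 0 ≤ E) (hs : s₁ ≤ s₀)
    (hT : 11 * l ^ 4 ≤ T) (hE : E ≤ ε * T) (hi : i ≤ ε * T)
    (h1 : T ≤ l * x + l) (hx : x ≤ l + l * s₁ + E) (h2 : s₀ ≤ l * y + l)
    (hy : y ≤ l + l * i₀ + (E + δ * T + δ * (s₀ - s₁))) : i ≤ i₀ := by
  have hl0 : 0 < l := by linarith
  have hl3 : l ≤ l ^ 3 := le_self_pow₀ hl (by norm_num)
  have hδ0 : 0 < δ := by
    by_contra h
    push Not at h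
    have : 4 * l ^ 3 * δ ≤ 0 := mul_nonpos_of_nonneg_of_nonpos (by positivity) h
    linarith
  have hlδ : l * δ ≤ 1 := by
    have : l * δ ≤ l ^ 3 * δ := mul_le_mul_of_nonneg_right hl3 hδ0.le
    linarith
  have b1 : l * x ≤ l * (l + l * s₁ + E) := mul_le_mul_of_nonneg_left hx hl0.le
  have b2 : l * y ≤ l * (l + l * i₀ + (E + δ * T + δ * (s₀ - s₁))) :=
    mul_le_mul_of_nonneg_left hy hl0.le
  have hA : T ≤ l ^ 2 * s₁ + l * E + l ^ 2 + l := by linarith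
  have b3 : l * δ * (s₀ - s₁) ≤ 1 * (s₀ - s₁) :=
    mul_le_mul_of_nonneg_right hlδ (sub_nonneg.2 hs)
  have hC : s₁ ≤ l * E + l * δ * T + l ^ 2 * i₀ + l ^ 2 + l := by linarith
  have b4 := mul_le_mul_of_nonneg_left hC (show 0 ≤ l ^ 2 by positivity)
  have b5 : l ^ 2 * (l * δ * T) = T / 4 := by linear_combination T / 4 * hδ
  have l1 : l ≤ l ^ 4 := le_self_pow₀ hl (by norm_num)
  have l2 : l ^ 2 ≤ l ^ 4 := pow_le_pow_right₀ hl (by norm_num)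
  have l3 : l ^ 3 ≤ l ^ 4 := pow_le_pow_right₀ hl (by norm_num)
  have e3 : l ^ 4 * (ε * T) = T / 8 := by linear_combination T / 8 * hε
  have e1 : l ^ 3 * E ≤ l ^ 4 * (ε * T) := mul_le_mul l3 hE hE0 (by positivity)
  have e2 : l * E ≤ l ^ 4 * (ε * T) := mul_le_mul l1 hE hE0 (by positivity)
  have b7 : T / 2 ≤ l ^ 4 * i₀ + 4 * l ^ 4 := by linarith
  have b8 : l ^ 4 * i ≤ l ^ 4 * (ε * T) := mul_le_mul_of_nonneg_left hi (by positivity)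
  have b9 : l ^ 4 * i ≤ l ^ 4 * i₀ := by linarith
  exact le_of_mul_le_mul_left b9 (by positivity)

/-- Discrete quasi-geodesics from near `o` whose endpoints are relatively close to a Morse ray
stay close to it on an initial part of definite proportion. -/
theorem HasMorseRays.exists_bound (hgeod : IsGeodesicMetric X) {o : X} {κ : ℝ → ℝ}
    {Z : Set X} (hZ : HasMorseRays o κ Z) {p : ℕ → X} {l₀ : ℝ}
    (hp : ∀ T, IsCoarseGeodesic l₀ p T) (hp0 : p 0 = o) (hpZ : ∀ s, p s ∈ Z)
    {lam : ℝ} (hlam : 1 ≤ lam) :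
    ∃ C ε T₀ : ℝ, 0 < ε ∧ ∀ (c : ℕ → X) (T : ℕ), T₀ ≤ T → IsCoarseGeodesic lam c T →
      dist (c 0) o ≤ lam → (∃ s, dist (c T) (p s) ≤ ε * T) →
      ∀ i : ℕ, (i : ℝ) ≤ ε * T → Metric.infDist (c i) Z ≤ C * κ (dist (c i) o) := by
  set l := max lam l₀ with hl_def
  have hl : 1 ≤ l := hlam.trans (le_max_left _ _)
  have hl0 : 0 < l := by linarith
  obtain ⟨C, hC⟩ := hZ (4 * l ^ 3) (by
    have : 1 ≤ l ^ 3 := one_le_pow₀ hl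
    linarith)
  set δ := 1 / (4 * l ^ 3) with hδ_def
  set ε := 1 / (8 * l ^ 4) with hε_def
  have hδ : 4 * l ^ 3 * δ = 1 := by rw [hδ_def]; field_simp
  have hε : 8 * l ^ 4 * ε = 1 := by rw [hε_def]; field_simp
  have hε0 : 0 < ε := by positivity
  have hδ0 : 0 < δ := by positivity
  refine ⟨C, ε, 11 * l ^ 4, hε0, fun c T hT hc hc0 ⟨s₁, hs₁⟩ i hi => ?_⟩
  have hcl : IsCoarseGeodesic l c T := hc.mono (le_max_left lam l₀)
  have hpl : ∀ T, IsCoarseGeodesic l p T := fun T => (hp T).mono (le_max_right _ _)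
  have hc0' : dist (c 0) o ≤ l := hc0.trans (le_max_left _ _)
  obtain ⟨i₀, s₀, hi₀, hs₀, hmin⟩ := exists_shortcut (s₁ := s₁) hl hδ hcl hpl (by rwa [hp0])
  have hi₀' : (i : ℝ) ≤ i₀ := by
    set E := dist (c T) (p s₁) with hE
    have hE0 : 0 ≤ E := dist_nonneg
    have a1 := hcl.2 0 T (Nat.zero_le _) le_rfl
    have a2 := (hpl s₁).dist_le (Nat.zero_le _) le_rfl
    have a3 := dist_triangle4 (c 0) o (p s₁) (c T)
    rw [← hp0, dist_comm (p s₁) (c T)] at a3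
    have a4 := (hpl s₀).2 0 s₀ (Nat.zero_le _) le_rfl
    have a5 := hcl.dist_le (Nat.zero_le _) hi₀
    have a6 := dist_triangle4 (p 0) (c 0) (c i₀) (p s₀)
    have a7 := hmin T s₁ le_rfl le_rfl
    rw [dist_comm (p 0) (c 0)] at a6
    rw [← hp0] at hc0'
    rw [Nat.cast_zero, sub_zero] at a1 a2 a4 a5
    exact shortcut_index_le (s₁ := s₁) (s₀ := s₀) hl hδ hε hE0 (by exact_mod_cast hs₀) hT hs₁ hi a1 (by linarith) a4 (by
        have : 0 ≤ δ * (i₀ : ℝ) := by positivity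
        linarith)
  obtain ⟨e, he, hec, I, hI⟩ := hgeod.exists_shortcut_ray hl hδ (hcl.restrict hi₀) hpl
    (s₀ := s₀) (fun j s hj hs => by
      have := hmin j s (hj.trans hi₀) (hs₀.trans hs)
      linarith)
  have h1 := hC e he (by
    rw [hec 0 (Nat.zero_le _)]
    have : l ≤ l ^ 3 := le_self_pow₀ hl (by norm_num)
    linarith) ⟨I, fun i hi => by
      obtain ⟨s, hs⟩ := hI i hi
      rw [hs]
      exact hpZ s⟩ i
  rwa [hec i (by exact_mod_cast hi₀')] at h1

end Surgery

/-! ### Rectangles over an interval -/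

namespace CATZeroCubeComplex

variable {Q : CATZeroCubeComplex.{w}}

/-- The sequence `γ 0, …, γ T` is a combinatorial geodesic. -/
def IsGeodesicSeq (Q : CATZeroCubeComplex.{w}) (γ : ℕ → Q.Vertex) (T : ℕ) : Prop :=
  ∀ i j, i ≤ j → j ≤ T → Q.d (γ i) (γ j) + i = j

theorem exists_isGeodesicSeq (x y : Q.Vertex) :
    ∃ γ : ℕ → Q.Vertex, γ 0 = x ∧ γ (Q.d x y) = y ∧ Q.IsGeodesicSeq γ (Q.d x y) := by
  induction hk : Q.d x y generalizing x with
  | zero =>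
    obtain rfl := eq_of_d_eq_zero hk
    refine ⟨fun _ => x, rfl, rfl, fun i j hij hj => ?_⟩
    rw [d_self]
    omega
  | succ k ih =>
    have hne : x ≠ y := by
      rintro rfl
      rw [d_self] at hk
      omega
    obtain ⟨z, hz1, hz2⟩ := exists_step hne
    obtain ⟨γ, h0, h1, hγ⟩ := ih z (by omega)
    refine ⟨fun i => Nat.casesOn i x γ, rfl, h1, fun i j hij hj => ?_⟩
    cases j with
    | zero =>
      obtain rfl : i = 0 := by omega
      simp
    | succ j =>
      cases i with
      | zero =>
        change Q.d x (γ j) + 0 = j + 1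
        have e1 := hγ 0 j (Nat.zero_le _) (by omega)
        have e2 := hγ j k (by omega) le_rfl
        rw [h0] at e1
        rw [h1] at e2
        have t1 := Q.d_triangle x z (γ j)
        have t2 := Q.d_triangle x (γ j) y
        omega
      | succ i =>
        change Q.d (γ i) (γ j) + (i + 1) = j + 1
        have := hγ i j (by omega) (by omega)
        omega

theorem IsGeodesicSeq.concat {γ e : ℕ → Q.Vertex} {T T' : ℕ} (hγ : Q.IsGeodesicSeq γ T)
    (he : Q.IsGeodesicSeq e T') (h0 : e 0 = γ T) (hd : Q.d (γ 0) (e T') = T + T') :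
    Q.IsGeodesicSeq (concatSeq γ T e) (T + T') := by
  intro i j hij hj
  rcases le_total j T with h | h
  · rw [concatSeq_of_le h, concatSeq_of_le (hij.trans h)]
    exact hγ i j hij h
  · obtain ⟨k, rfl⟩ := Nat.exists_eq_add_of_le h
    rw [concatSeq_add h0]
    rcases le_total i T with h' | h'
    · rw [concatSeq_of_le h']
      have t1 := Q.d_triangle (γ i) (γ T) (e k)
      have t2 := Q.d_triangle (γ 0) (γ i) (e T')
      have t3 := Q.d_triangle (γ i) (e k) (e T')
      have e1 := hγ i T h' le_rfl
      have e2 := hγ 0 i (Nat.zero_le _) h'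
      have e3 := he 0 k (Nat.zero_le _) (by omega)
      have e4 := he k T' (by omega) le_rfl
      rw [h0] at e3
      omega
    · obtain ⟨k', rfl⟩ := Nat.exists_eq_add_of_le h'
      rw [concatSeq_add h0]
      have := he k' k (by omega) (by omega)
      omega

theorem exists_geodesicSeq_through {x p y : Q.Vertex} (h : Q.d x p + Q.d p y = Q.d x y) :
    ∃ γ : ℕ → Q.Vertex, γ 0 = x ∧ γ (Q.d x p) = p ∧ γ (Q.d x p + Q.d p y) = y ∧
      Q.IsGeodesicSeq γ (Q.d x p + Q.d p y) := by
  obtain ⟨γ₁, h10, h11, hγ₁⟩ := exists_isGeodesicSeq x p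
  obtain ⟨γ₂, h20, h21, hγ₂⟩ := exists_isGeodesicSeq p y
  have h0 : γ₂ 0 = γ₁ (Q.d x p) := h20.trans h11.symm
  refine ⟨concatSeq γ₁ (Q.d x p) γ₂, ?_, ?_, ?_, hγ₁.concat hγ₂ h0 ?_⟩
  · rw [concatSeq_of_le (Nat.zero_le _), h10]
  · rw [concatSeq_of_le le_rfl, h11]
  · rw [concatSeq_add h0, h21]
  · rw [h10, h21, h]

/-- The sequence `γ 0, …, γ T` is a discrete quasi-geodesic of unit steps with constant `3`. -/
def IsThreeGeodesicSeq (Q : CATZeroCubeComplex.{w}) (γ : ℕ → Q.Vertex) (T : ℕ) : Prop :=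
  (∀ i < T, Q.d (γ i) (γ (i + 1)) ≤ 1) ∧ ∀ i j, i ≤ j → j ≤ T → j ≤ 3 * Q.d (γ i) (γ j) + i

theorem IsGeodesicSeq.isThreeGeodesicSeq {γ : ℕ → Q.Vertex} {T : ℕ} (hγ : Q.IsGeodesicSeq γ T) :
    Q.IsThreeGeodesicSeq γ T :=
  ⟨fun i hi => by have := hγ i (i + 1) (Nat.le_succ i) hi; omega,
    fun i j hij hj => by have := hγ i j hij hj; omega⟩

theorem d_eq_of_rectangle {x y z t : Q.Vertex} (h1 : Q.d x y + Q.d y z = Q.d x z)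
    (h2 : Q.d y z + Q.d z t = Q.d y t) (h3 : Q.d z t + Q.d t x = Q.d z x)
    (h4 : Q.d t x + Q.d x y = Q.d t y) : Q.d x y = Q.d z t ∧ Q.d y z = Q.d t x := by
  have := Q.d_comm x z
  have := Q.d_comm y t
  omega

open MedianTerm in
-- Projection to the interval from `u` to `v` fixes `u` and maps intervals into intervals. This
-- keeps projections in order along the sides of the rectangle.
theorem between_of_mem_interval (u v a z : Q.Vertex) (hz : Q.d u z + Q.d z a = Q.d u a) :
    Q.d u (Q.median u v z) + Q.d (Q.median u v z) (Q.median u v a) = Q.d u (Q.median u v a) := by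
  have h := between_of_equiv (x := var 0) (p := med (var 0) (var 1) (med (var 0) (var 2) (var 3)))
    (y := med (var 0) (var 1) (var 2)) (by decide) ![u, v, a, z]
  change Q.d u (Q.median u v (Q.median u a z)) + Q.d (Q.median u v (Q.median u a z))
    (Q.median u v a) = Q.d u (Q.median u v a) at h
  rwa [median_eq_iff.2 hz] at h

/-- The configuration spanned by two points `x`, `y` over the interval `[u, v]`: a rectangle with
base `[a, b]` in `[u, v]`, as wide as the distance of the projections of `x` and `y`, and as high
as desired up to the distance of `{x, y}` from the interval. -/
structure IsRectangleOver (u v x y a b a₁ b₁ : Q.Vertex) (l : ℕ) : Prop where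
  width : Q.d a b = Q.d (Q.median u v x) (Q.median u v y)
  base : Q.d u a + Q.d a b + Q.d b v = Q.d u v
  height : Q.d a a₁ = l
  height' : Q.d b₁ b = l
  top : Q.d a₁ b₁ = Q.d a b
  proj : Q.median u v a₁ = a
  proj' : Q.median u v b₁ = b
  left : Q.d u a + Q.d a a₁ = Q.d u a₁
  right : Q.d b₁ b + Q.d b v = Q.d b₁ v
  left_top : Q.d u a₁ + Q.d a₁ b₁ = Q.d u b₁
  top_right : Q.d a₁ b₁ + Q.d b₁ v = Q.d a₁ v
  le : Q.d u a₁ ≤ 3 * Q.d u x + Q.d x y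

open MedianTerm in
-- The vertices `a` and `b` are the corners nearest to `u` and `v` of the box whose other two
-- corners are the projections `x'`, `y'`, so the diagonals `ab` and `x'y'` have equal length. The
-- rectangle climbs from this base towards the projections `A`, `B` of `a`, `b` to the interval from
-- `x` to `y`.
theorem exists_isRectangleOver (u v x y : Q.Vertex) :
    ∃ L, Q.d x (Q.median u v x) ≤ Q.d x y + L ∧
      ∀ l ≤ L, ∃ a b a₁ b₁, IsRectangleOver u v x y a b a₁ b₁ l := by
  let tx : MedianTerm 5 := med (var 0) (var 1) (var 2)
  let ty : MedianTerm 5 := med (var 0) (var 1) (var 3)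
  let ta : MedianTerm 5 := med (var 0) tx ty
  let tb : MedianTerm 5 := med (var 1) tx ty
  let tA : MedianTerm 5 := med (var 2) (var 3) ta
  let tB : MedianTerm 5 := med (var 2) (var 3) tb
  let tt : MedianTerm 5 := med (var 2) (var 3) tx
  -- Writing `a₁` as the median of `a`, `A` and a free variable encodes that it lies between `a` and
  -- `A`. Every betweenness relation of the rectangle is then an identity in five variables.
  let ta₁ : MedianTerm 5 := med ta tA (var 4)
  let tb₁ : MedianTerm 5 := med ta₁ tb tB
  set x' := Q.median u v x with hx'
  set y' := Q.median u v y with hy'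
  set a := Q.median u x' y' with ha
  set b := Q.median v x' y' with hb
  set A := Q.median x y a with hA
  set B := Q.median x y b with hB
  set t := Q.median x y x' with ht
  -- With `t` the projection of `x'` to the interval from `x` to `y`, the vertices `x'`, `a`, `A`,
  -- `t` form a rectangle. So the available height is the distance from `x'` to `t`, and `t` is no
  -- farther from `x` than `y` is.
  refine ⟨Q.d a A, ?_, fun l hl => ?_⟩
  · have f1 : Q.d x' a + Q.d a A = Q.d x' A :=
      between_of_equiv (x := tx) (p := ta) (y := tA) (by decide) ![u, v, x, y, x]
    have f2 : Q.d a A + Q.d A t = Q.d a t :=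
      between_of_equiv (x := ta) (p := tA) (y := tt) (by decide) ![u, v, x, y, x]
    have f3 : Q.d A t + Q.d t x' = Q.d A x' :=
      between_of_equiv (x := tA) (p := tt) (y := tx) (by decide) ![u, v, x, y, x]
    have f4 : Q.d t x' + Q.d x' a = Q.d t a :=
      between_of_equiv (x := tt) (p := tx) (y := ta) (by decide) ![u, v, x, y, x]
    have f5 := (d_eq_of_rectangle f1 f2 f3 f4).2
    have f6 : Q.d x t + Q.d t y = Q.d x y := (Q.median_spec x y x').1
    have f7 := Q.d_triangle x t x'
    omega
  · obtain ⟨γ, h0, h1, hγ⟩ := exists_isGeodesicSeq a A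
    set a₁ := γ l with ha₁
    have hl1 : Q.d a a₁ = l := by
      have : Q.d (γ 0) a₁ + 0 = l := hγ 0 l (Nat.zero_le _) hl
      rwa [h0] at this
    have hl2 : Q.d a a₁ + Q.d a₁ A = Q.d a A := by
      have : Q.d a₁ (γ (Q.d a A)) + l = Q.d a A := hγ l _ hl le_rfl
      rw [h1] at this
      omega
    have hma : Q.median a A a₁ = a₁ := median_eq_iff.2 hl2
    set b₁ := Q.median a₁ b B with hb₁
    have e₁ : ta₁.eval Q.median ![u, v, x, y, a₁] = a₁ := hma
    have e₂ : tb₁.eval Q.median ![u, v, x, y, a₁] = b₁ := by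
      change Q.median (ta₁.eval Q.median ![u, v, x, y, a₁]) b B = b₁
      rw [e₁]
    have g1 : Q.d x' a + Q.d a y' = Q.d x' y' := (Q.median_spec u x' y').2.1
    have g2 : Q.d x' b + Q.d b y' = Q.d x' y' := (Q.median_spec v x' y').2.1
    have g3 : Q.d a x' + Q.d x' b = Q.d a b :=
      between_of_equiv (x := ta) (p := tx) (y := tb) (by decide) ![u, v, x, y, x]
    have g4 : Q.d a y' + Q.d y' b = Q.d a b :=
      between_of_equiv (x := ta) (p := ty) (y := tb) (by decide) ![u, v, x, y, x]
    have g5 : Q.d u a + Q.d a v = Q.d u v :=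
      between_of_equiv (x := var 0) (p := ta) (y := var 1) (by decide) ![u, v, x, y, x]
    have g6 : Q.d a b + Q.d b v = Q.d a v :=
      between_of_equiv (x := ta) (p := tb) (y := var 1) (by decide) ![u, v, x, y, x]
    have r1 := between_of_equiv (Q := Q) (x := ta) (p := ta₁) (y := tb₁) (by decide)
      ![u, v, x, y, a₁]
    have r2 := between_of_equiv (Q := Q) (x := ta₁) (p := tb₁) (y := tb) (by decide)
      ![u, v, x, y, a₁]
    have r3 := between_of_equiv (Q := Q) (x := tb₁) (p := tb) (y := ta) (by decide)
      ![u, v, x, y, a₁]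
    have r4 := between_of_equiv (Q := Q) (x := tb) (p := ta) (y := ta₁) (by decide)
      ![u, v, x, y, a₁]
    have p1 := eval_eq (Q := Q) (s := med (var 0) (var 1) ta₁) (t := ta) (by decide)
      ![u, v, x, y, a₁]
    have p2 := eval_eq (Q := Q) (s := med (var 0) (var 1) tb₁) (t := tb) (by decide)
      ![u, v, x, y, a₁]
    have k1 := between_of_equiv (Q := Q) (x := var 0) (p := ta) (y := ta₁) (by decide)
      ![u, v, x, y, a₁]
    have k2 := between_of_equiv (Q := Q) (x := tb₁) (p := tb) (y := var 1) (by decide)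
      ![u, v, x, y, a₁]
    have k3 := between_of_equiv (Q := Q) (x := var 0) (p := ta₁) (y := tb₁) (by decide)
      ![u, v, x, y, a₁]
    have k4 := between_of_equiv (Q := Q) (x := ta₁) (p := tb₁) (y := var 1) (by decide)
      ![u, v, x, y, a₁]
    have e₀ : ta.eval Q.median ![u, v, x, y, a₁] = a := rfl
    have e₃ : tb.eval Q.median ![u, v, x, y, a₁] = b := rfl
    have e₄ : (var 0 : MedianTerm 5).eval Q.median ![u, v, x, y, a₁] = u := rfl
    have e₅ : (var 1 : MedianTerm 5).eval Q.median ![u, v, x, y, a₁] = v := rfl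
    have e₆ : (med (var 0) (var 1) ta₁).eval Q.median ![u, v, x, y, a₁] = Q.median u v a₁ := by
      change Q.median u v (ta₁.eval Q.median ![u, v, x, y, a₁]) = _
      rw [e₁]
    have e₇ : (med (var 0) (var 1) tb₁).eval Q.median ![u, v, x, y, a₁] = Q.median u v b₁ := by
      change Q.median u v (tb₁.eval Q.median ![u, v, x, y, a₁]) = _
      rw [e₂]
    rw [e₆, e₀] at p1
    rw [e₇, e₃] at p2
    simp only [e₀, e₁, e₂, e₃, e₄, e₅] at r1 r2 r3 r4 k1 k2 k3 k4
    have hr := d_eq_of_rectangle r1 r2 r3 r4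
    have hux : Q.d u a ≤ Q.d u x' := by
      have : Q.d u a + Q.d a x' = Q.d u x' := (Q.median_spec u x' y').1
      omega
    have hux' : Q.d u x' ≤ Q.d u x := by
      have : Q.d u x' + Q.d x' x = Q.d u x := (Q.median_spec u v x).2.2
      omega
    have hA1 : Q.d A x ≤ Q.d x y := by
      have := d_median_le y x a x
      rw [median_swap_left y x a, median_self, d_comm y x] at this
      exact this
    have t1 := Q.d_triangle a u x
    have t2 := Q.d_triangle a x A
    have c1 := Q.d_comm a u
    have c2 := Q.d_comm x A
    have c3 := Q.d_comm a x'
    have c4 := Q.d_comm y' b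
    have c5 := Q.d_comm a b
    have hw : Q.d a b = Q.d x' y' := by omega
    refine ⟨a, b, a₁, b₁, ⟨hw, ?_, hl1, ?_, ?_, p1, p2, k1, k2, k3, k4, ?_⟩⟩ <;> omega

/-- Projecting to the base does not increase distances, and the projections of `z`, `a₁`, `b₁`, `t`
occur in this order on a geodesic. Each of the two outer legs exceeds its shadow by at most `l`. As
`l` is at most the width, the total is at most three times the distance of the shadows. -/
theorem IsRectangleOver.d_le {u v x y a b a₁ b₁ z t : Q.Vertex} {l : ℕ}
    (h : IsRectangleOver u v x y a b a₁ b₁ l) (hl : l ≤ Q.d a b)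
    (hz : Q.d u z + Q.d z a₁ = Q.d u a₁) (ht : Q.d b₁ t + Q.d t v = Q.d b₁ v) :
    Q.d z a₁ + Q.d a₁ b₁ + Q.d b₁ t ≤ 3 * Q.d z t := by
  have b1 := between_of_mem_interval u v a₁ z hz
  have b2 := between_of_mem_interval v u b₁ t (by
    rw [d_comm v t, d_comm t b₁, d_comm v b₁]; omega)
  rw [h.proj] at b1
  rw [median_swap_left v u b₁, median_swap_left v u t, h.proj'] at b2
  have m1 := (Q.median_spec u v z).2.2
  have m2 := (Q.median_spec u v t).2.1
  have m3 := (Q.median_spec u v t).1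
  have m4 := d_median_le₃ u v z t
  have m5 := Q.d_triangle u (Q.median u v z) (Q.median u v t)
  have c1 := Q.d_comm v (Q.median u v t)
  have c2 := Q.d_comm v t
  have c3 := Q.d_comm v b
  have := h.base
  have := h.height
  have := h.height'
  have := h.top
  have := h.left
  have := h.right
  omega

/-- The path runs from `u` over `a₁` and `b₁` to `v`. It is geodesic from `u` to `b₁` and from `a₁`
to `v`, so `IsRectangleOver.d_le` is needed only for pairs before `a₁` and after `b₁`. -/
theorem IsRectangleOver.exists_path {u v x y a b a₁ b₁ : Q.Vertex} {l : ℕ}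
    (h : IsRectangleOver u v x y a b a₁ b₁ l) (hl : l ≤ Q.d a b) :
    ∃ (γ : ℕ → Q.Vertex) (T : ℕ), γ 0 = u ∧ γ T = v ∧ Q.d u a₁ ≤ T ∧ γ (Q.d u a₁) = a₁ ∧
      Q.IsThreeGeodesicSeq γ T := by
  obtain ⟨γ, h0, h1, h2, hγ⟩ := exists_geodesicSeq_through h.left_top
  obtain ⟨e, e0, e1, he⟩ := exists_isGeodesicSeq b₁ v
  obtain ⟨S, hS⟩ : ∃ S, S = Q.d u a₁ + Q.d a₁ b₁ := ⟨_, rfl⟩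
  rw [← hS] at h2 hγ
  have h3 : e 0 = γ S := e0.trans h2.symm
  refine ⟨concatSeq γ S e, S + Q.d b₁ v, ?_, ?_, by omega, ?_, fun i hi => ?_,
    fun i j hij hj => ?_⟩
  · rw [concatSeq_of_le (Nat.zero_le _), h0]
  · rw [concatSeq_add h3, e1]
  · rw [concatSeq_of_le (by omega), h1]
  · rcases lt_or_ge i S with hi' | hi'
    · rw [concatSeq_of_le hi'.le, concatSeq_of_le hi']
      have : Q.d (γ i) (γ (i + 1)) + i = i + 1 := hγ i (i + 1) (Nat.le_succ i) hi'
      change Q.d (γ i) (γ (i + 1)) ≤ 1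
      omega
    · obtain ⟨k, rfl⟩ := Nat.exists_eq_add_of_le hi'
      rw [add_assoc, concatSeq_add h3, concatSeq_add h3]
      have := he k (k + 1) (Nat.le_succ k) (by omega)
      omega
  · rcases le_total j S with hjS | hjS
    · rw [concatSeq_of_le hjS, concatSeq_of_le (hij.trans hjS)]
      have := hγ i j hij hjS
      omega
    · obtain ⟨k, rfl⟩ := Nat.exists_eq_add_of_le hjS
      rw [concatSeq_add h3]
      rcases le_total i S with hiS | hiS
      · rw [concatSeq_of_le hiS]
        have z1 := hγ 0 i (Nat.zero_le _) hiS
        have t1 := he 0 k (Nat.zero_le _) (by omega)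
        have t2 := he k _ (by omega) le_rfl
        rw [h0] at z1
        rw [e0] at t1
        rw [e1] at t2
        rcases le_total i (Q.d u a₁) with hi | hi
        · have z2 := hγ i _ hi (by omega)
          rw [h1] at z2
          have := h.d_le hl (z := γ i) (t := e k) (by omega) (by omega)
          omega
        · have z2 := hγ _ i hi hiS
          rw [h1] at z2
          have m1 := Q.d_triangle a₁ (γ i) v
          have m2 := Q.d_triangle (γ i) (e k) v
          have := h.top_right
          omega
      · obtain ⟨k', rfl⟩ := Nat.exists_eq_add_of_le hiS
        rw [concatSeq_add h3]
        have := he k' k (by omega) (by omega)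
        omega

end CATZeroCubeComplex

/-! ### Transfer of paths and medians through cubical models -/

section Push

variable {X : Type u} [MetricSpace X] {m : X → X → X → X}

theorem IsCubicalModel.isCoarseGeodesic {v : ℕ} {K : ℝ} {H : Set X}
    {Q : CATZeroCubeComplex.{w}} {f : Q.Vertex → X} (h : IsCubicalModel m v K H Q f)
    {γ : ℕ → Q.Vertex} {T : ℕ} (hγ : Q.IsThreeGeodesicSeq γ T) :
    IsCoarseGeodesic (3 * K * K + 3 * K) (fun i => f (γ i)) T := by
  have hK := h.one_le
  refine ⟨fun i hi => ?_, fun i j hij hj => ?_⟩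
  · have h1 := h.upper (γ i) (γ (i + 1))
    have h2 : ((Q.oneSkeleton.dist (γ i) (γ (i + 1)) : ℕ) : ℝ) ≤ 1 := by
      exact_mod_cast hγ.1 i hi
    nlinarith
  · have h1 := h.d_le (γ i) (γ j)
    have h2 : (j : ℝ) ≤ 3 * Q.d (γ i) (γ j) + i := by exact_mod_cast hγ.2 i j hij hj
    have h3 : 0 ≤ dist (f (γ i)) (f (γ j)) := dist_nonneg
    nlinarith [mul_nonneg (mul_nonneg (show 0 ≤ K by linarith) (show 0 ≤ K by linarith)) h3]

/-- Cubical models of hulls of at most `k` points, with the points marked. -/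
theorem IsLocallyQuasiCubical.exists_marked_model {r v : ℕ} (hm : IsCoarseMedian m r)
    (hLQC : IsLocallyQuasiCubical.{u, w} m r v) (k : ℕ) :
    ∃ K, 1 ≤ K ∧ ∀ F : Finset X, F.Nonempty → F.card ≤ k →
      ∃ (Q : CATZeroCubeComplex.{w}) (f : Q.Vertex → X) (g : X → Q.Vertex),
        IsCubicalModel m v K (medianHull m r (F : Set X)) Q f ∧ ∀ z ∈ F, dist z (f (g z)) ≤ K := by
  obtain ⟨K, hK1, hK⟩ := hLQC.exists_model k
  obtain ⟨C, hC⟩ := hm.exists_near_medianHull 0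
  refine ⟨K + |C|, by linarith [abs_nonneg C], fun F hF hcard => ?_⟩
  obtain ⟨Q, f, hf⟩ := hK F hF hcard
  have hz : ∀ z, ∃ a, z ∈ F → dist z (f a) ≤ K + |C| := by
    intro z
    by_cases h : z ∈ F
    · obtain ⟨z', hz', h1⟩ := hC (F : Set X) z h
      obtain ⟨a, ha⟩ := hf.coarselyOnto z' hz'
      refine ⟨a, fun _ => (dist_triangle z z' (f a)).trans ?_⟩
      linarith [le_abs_self C]
    · obtain ⟨p, hp⟩ := medianHull_nonempty (m := m) r
        (show (F : Set X).Nonempty from Finset.coe_nonempty.2 hF)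
      exact ⟨(hf.coarselyOnto p hp).choose, fun h' => absurd h' h⟩
  choose g hg using hz
  exact ⟨Q, f, g, hf.mono (by linarith [abs_nonneg C]), fun z hz => hg z hz⟩

theorem IsCubicalModel.dist_median_le {v : ℕ} {K L e : ℝ} {H : Set X}
    {Q : CATZeroCubeComplex.{w}} {f : Q.Vertex → X} (h : IsCubicalModel m v K H Q f)
    (hL : IsCoarselyLipschitzMedian m L) {a b c : Q.Vertex} {x y z : X} (ha : dist x (f a) ≤ e)
    (hb : dist y (f b) ≤ e) (hc : dist z (f c) ≤ e) :
    dist (m x y z) (f (Q.median a b c)) ≤ K + L * (e + e + e) + L := by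
  have h1 := hL.dist_le ha hb hc
  have h2 := h.median a b c
  have h3 := dist_triangle_right (m x y z) (f (Q.median a b c)) (m (f a) (f b) (f c))
  linarith

end Push

/-- By sublinearity `C * κ s` is at most `s / 2` plus a constant. So `s` and `t` bound each other up
to a factor `2` and a constant, and growth of `κ` applies. -/
theorem IsSublinearGauge.exists_comparison {κ : ℝ → ℝ} (hκ : IsSublinearGauge κ) (C : ℝ) :
    ∃ C', 1 ≤ C' ∧ ∀ s t, 0 ≤ s → 0 ≤ t → |s - t| ≤ C * κ s → κ s ≤ C' * κ t ∧ κ t ≤ C' * κ s := by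
  obtain ⟨B, hB0, hB⟩ := hκ.small (1 / (2 * (|C| + 1))) (by positivity)
  obtain ⟨C', hC'1, hC'⟩ := hκ.growth 2 (2 * ((|C| + 1) * B))
  refine ⟨C', hC'1, fun s t hs ht h => ?_⟩
  have h1 : C * κ s ≤ s / 2 + (|C| + 1) * B := by
    have h2 := hκ.one_le s hs
    calc C * κ s ≤ (|C| + 1) * κ s := by
          have := le_abs_self C
          gcongr
          linarith
      _ ≤ (|C| + 1) * (1 / (2 * (|C| + 1)) * s + B) := by
          gcongr
          exact hB s hs
      _ = s / 2 + (|C| + 1) * B := by field_simp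
  have h3 : 0 ≤ (|C| + 1) * B := by positivity
  have h4 := abs_le.1 (h.trans h1)
  exact ⟨hC' s t hs ht (by linarith), hC' t s ht hs (by linarith)⟩

/-! ### Guides and the contraction estimate -/

section Guide

variable {X : Type u} [MetricSpace X] {m : X → X → X → X}

theorem IsSublinearGauge.exists_dist_comparison {κ : ℝ → ℝ} (hκ : IsSublinearGauge κ) (o : X)
    (C : ℝ) : ∃ C', 1 ≤ C' ∧ ∀ x y, dist x y ≤ C * κ (dist x o) →
      κ (dist x o) ≤ C' * κ (dist y o) ∧ κ (dist y o) ≤ C' * κ (dist x o) := by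
  obtain ⟨C', h1, h⟩ := hκ.exists_comparison C
  exact ⟨C', h1, fun x y hxy => h _ _ dist_nonneg dist_nonneg
    ((abs_dist_sub_le x y o).trans hxy)⟩

/-- As `n` grows, coarse geodesics from near `u 0` to near `u n` get long, and the sublinear
distance from `u n` to `q` falls below the proportion `ε` of their length. The constant `C` does not
depend on the length `ρ` of the initial part; only the threshold for `n` does. -/
theorem HasMorseRays.eventually_infDist_le (hgeod : IsGeodesicMetric X) {o : X} {κ : ℝ → ℝ}
    (hκ : IsSublinearGauge κ) {a b : ℝ} {q : ℝ → X} (hq : IsQuasiGeodesicOn a b q (Ici 0))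
    (hqo : q 0 = o) (hZ : HasMorseRays o κ (rayImage q)) {u : ℕ → X}
    (hu : Tendsto (fun n => dist (u n) o) atTop atTop) {N : ℝ}
    (hnear : ∀ n, ∃ s : ℕ, dist (u n) (q s) ≤ N * κ (dist (u n) o)) {lam : ℝ} (hlam : 1 ≤ lam) :
    ∃ C, 0 ≤ C ∧ ∀ ρ : ℕ, ∀ᶠ n in atTop, ∀ (c : ℕ → X) (T : ℕ), IsCoarseGeodesic lam c T →
      dist (c 0) (u 0) ≤ lam → dist (c T) (u n) ≤ lam → ρ ≤ T ∧
        ∀ i ≤ ρ, Metric.infDist (c i) (rayImage q) ≤ C * κ (dist (c i) o) := by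
  obtain ⟨l, hl⟩ : ∃ l, l = lam + dist (u 0) o := ⟨_, rfl⟩
  have hl1 : lam ≤ l := by rw [hl]; linarith [dist_nonneg (x := u 0) (y := o)]
  obtain ⟨C, ε, T₀, hε, hC⟩ := hZ.exists_bound hgeod (p := fun n : ℕ => q n)
    (fun T => hq.isCoarseGeodesic T) (by simpa using hqo)
    (fun s => self_mem_rayImage (Nat.cast_nonneg s)) (hlam.trans hl1)
  have hl0 : 0 < l := by linarith
  obtain ⟨B, hB0, hB⟩ := hκ.small (ε / (2 * l * (|N| + 1))) (by positivity)
  refine ⟨|C|, abs_nonneg C, fun ρ => ?_⟩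
  obtain ⟨R, hR⟩ : ∃ R, R = max (max T₀ ρ) (max (ρ / ε) ((l + ε + (|N| + 1) * B) / (ε / 2))) :=
    ⟨_, rfl⟩
  filter_upwards [hu.eventually_ge_atTop (2 * l + l * R)] with n hn c T hc h0 hT
  have hc' := hc.mono hl1
  have hc0 : dist (c 0) o ≤ l := by rw [hl]; linarith [dist_triangle (c 0) (u 0) o]
  have hup : dist (u n) o ≤ 2 * l + l * T := by
    have h1 := hc'.dist_le (Nat.zero_le T) le_rfl
    have h2 := dist_triangle4 (u n) (c T) (c 0) o
    rw [dist_comm (u n) (c T), dist_comm (c T) (c 0)] at h2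
    push_cast at h1
    linarith
  have hTR : R ≤ T := by
    have : l * R ≤ l * T := by linarith
    exact le_of_mul_le_mul_left this hl0
  have hR1 : T₀ ≤ R := by rw [hR]; exact (le_max_left _ _).trans (le_max_left _ _)
  have hR2 : (ρ : ℝ) ≤ R := by rw [hR]; exact (le_max_right _ _).trans (le_max_left _ _)
  have hR3 : ρ / ε ≤ R := by rw [hR]; exact (le_max_left _ _).trans (le_max_right _ _)
  have hR4 : (l + ε + (|N| + 1) * B) / (ε / 2) ≤ R := by
    rw [hR]; exact (le_max_right _ _).trans (le_max_right _ _)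
  have hend : ∃ s : ℕ, dist (c T) (q s) ≤ ε * T := by
    obtain ⟨s, hs⟩ := hnear n
    refine ⟨s, ?_⟩
    have h1 : N * κ (dist (u n) o) ≤ ε * T / 2 + ε + (|N| + 1) * B := by
      calc N * κ (dist (u n) o) ≤ (|N| + 1) * κ (dist (u n) o) := by
            have := le_abs_self N
            have := hκ.one_le _ (dist_nonneg (x := u n) (y := o))
            gcongr
            linarith
        _ ≤ (|N| + 1) * (ε / (2 * l * (|N| + 1)) * dist (u n) o + B) := by
            gcongr
            exact hB _ dist_nonneg
        _ ≤ (|N| + 1) * (ε / (2 * l * (|N| + 1)) * (2 * l + l * T) + B) := by gcongr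
        _ = ε * T / 2 + ε + (|N| + 1) * B := by field_simp; ring
    have h2 := dist_triangle (c T) (u n) (q s)
    have h3 : l + ε + (|N| + 1) * B ≤ T * (ε / 2) := (div_le_iff₀ (by positivity)).1 (hR4.trans hTR)
    linarith
  refine ⟨by exact_mod_cast hR2.trans hTR, fun i hi => ?_⟩
  have h1 : (i : ℝ) ≤ ε * T := by
    have h2 : (ρ : ℝ) ≤ T * ε := (div_le_iff₀ hε).1 (hR3.trans hTR)
    have h3 : (i : ℝ) ≤ ρ := by exact_mod_cast hi
    linarith
  refine (hC c T (hR1.trans hTR) hc' hc0 hend i h1).trans ?_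
  have := hκ.one_le _ (dist_nonneg (x := c i) (y := o))
  gcongr
  exact le_abs_self C

/-- Through the median of `x` with `u`, `v` there is a coarse geodesic from `u` to `v`. -/
theorem IsLocallyQuasiCubical.exists_path_through_median {r v : ℕ} (hm : IsCoarseMedian m r)
    (hLQC : IsLocallyQuasiCubical.{u, w} m r v) :
    ∃ E, 1 ≤ E ∧ ∀ p p' x : X, ∃ (c : ℕ → X) (T i : ℕ), IsCoarseGeodesic E c T ∧
      dist (c 0) p ≤ E ∧ dist (c T) p' ≤ E ∧ (∀ j ≤ T, dist (c j) (m p p' (c j)) ≤ E) ∧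
      (i : ℝ) ≤ E * (dist p x + 1) ∧ dist (c i) (m p p' x) ≤ E := by
  classical
  obtain ⟨K, hK1, hK⟩ := hLQC.exists_marked_model hm 3
  rcases isEmpty_or_nonempty X with hX | hX
  · exact ⟨1, le_rfl, fun p => isEmptyElim p⟩
  obtain ⟨L, hL⟩ := hm.exists_lipschitz
  have hL0 := hL.1
  refine ⟨3 * K * K + 3 * K + 3 * L * K + L, by nlinarith [mul_nonneg hL0 (zero_le_one.trans hK1)],
    fun p p' x => ?_⟩
  obtain ⟨Q, f, g, hf, hg⟩ := hK {p, p', x} ⟨p, by simp⟩ Finset.card_le_three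
  have hp := hg p (by simp)
  have hp' := hg p' (by simp)
  have hx := hg x (by simp)
  have hLK : 0 ≤ L * K := by positivity
  have hKK : K ≤ K * K := by nlinarith
  have hmed : Q.d (g p) (Q.median (g p) (g p') (g x)) + Q.d (Q.median (g p) (g p') (g x)) (g p') =
    Q.d (g p) (g p') := (Q.median_spec _ _ _).1
  obtain ⟨γ, h0, h1, h2, hγ⟩ := CATZeroCubeComplex.exists_geodesicSeq_through hmed
  rw [hmed] at h2 hγ
  refine ⟨fun j => f (γ j), Q.d (g p) (g p'), Q.d (g p) (Q.median (g p) (g p') (g x)),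
    (hf.isCoarseGeodesic hγ.isThreeGeodesicSeq).mono (by linarith), ?_, ?_, fun j hj => ?_, ?_, ?_⟩
  · simp only [h0]
    rw [dist_comm]
    linarith
  · simp only [h2]
    rw [dist_comm]
    linarith
  · have e : Q.median (g p) (g p') (γ j) = γ j := by
      rw [CATZeroCubeComplex.median_eq_iff]
      have e1 := hγ 0 j (Nat.zero_le _) hj
      have e2 := hγ j _ hj le_rfl
      rw [h0] at e1
      rw [h2] at e2
      omega
    have := hf.dist_median_le hL hp hp' (z := f (γ j)) (c := γ j) (e := K)
      (by rw [dist_self]; linarith)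
    rw [e, dist_comm] at this
    linarith
  · have h3 : Q.d (g p) (Q.median (g p) (g p') (g x)) +
      Q.d (Q.median (g p) (g p') (g x)) (g x) = Q.d (g p) (g x) := (Q.median_spec _ _ _).2.2
    have h4 : (Q.d (g p) (Q.median (g p) (g p') (g x)) : ℝ) ≤ Q.d (g p) (g x) := by
      exact_mod_cast (by omega)
    have h5 := hf.d_le (g p) (g x)
    have h6 := dist_triangle4 (f (g p)) p x (f (g x))
    rw [dist_comm (f (g p)) p] at h6
    have h7 : K * (dist (f (g p)) (f (g x)) + K) ≤ K * (dist p x + 3 * K) :=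
      mul_le_mul_of_nonneg_left (by linarith) (by linarith)
    have h8 : 0 ≤ (3 * K * K + 2 * K + 3 * L * K + L) * dist p x := by positivity
    nlinarith
  · simp only [h1]
    have := hf.dist_median_le hL hp hp' hx
    rw [dist_comm] at this
    linarith

theorem median_push_arith₁ {K E₀ S D l z : ℝ} (hK : 1 ≤ K) (hE : 0 ≤ E₀) (hS : 0 ≤ S)
    (h1 : l ≤ K * (S + E₀ + K)) (h2 : D ≤ l) (h3 : z ≤ E₀ + (K * D + K) + E₀) :
    z ≤ 20 * K * K * (1 + E₀ + K) * (S + 1) := by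
  have hKK : 1 ≤ K * K := by nlinarith
  have h4 : K * D ≤ K * (K * (S + E₀ + K)) := by
    have : D ≤ K * (S + E₀ + K) := h2.trans h1
    gcongr
  have h5 : z ≤ K * K * (S + 3 * E₀ + 2 * K) := by nlinarith
  have h6 : S + 3 * E₀ + 2 * K ≤ 20 * (1 + E₀ + K) * (S + 1) := by
    nlinarith [mul_nonneg hE hS, mul_nonneg (zero_le_one.trans hK) hS]
  calc z ≤ K * K * (S + 3 * E₀ + 2 * K) := h5
    _ ≤ K * K * (20 * (1 + E₀ + K) * (S + 1)) := by gcongr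
    _ = _ := by ring

theorem median_push_arith₂ {K E₀ S D D' l d z : ℝ} (hK : 1 ≤ K) (hE : 0 ≤ E₀) (hS : 0 ≤ S)
    (hd : 0 ≤ d) (h1 : l ≤ K * (S + E₀ + K)) (h2 : D ≤ D' + l) (h3 : D' ≤ K * (d + 3 * K))
    (h4 : z ≤ K + (K * D + K) + E₀) :
    z ≤ 20 * K * K * (1 + E₀ + K) * (d + S + 1) := by
  have hKK : 1 ≤ K * K := by nlinarith
  have h5 : K * D ≤ K * (K * (d + 3 * K) + K * (S + E₀ + K)) := by
    gcongr
    linarith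
  have h6 : z ≤ K * K * (d + S + 2 * E₀ + 6 * K) := by nlinarith
  have h7 : d + S + 2 * E₀ + 6 * K ≤ 20 * (1 + E₀ + K) * (d + S + 1) := by
    nlinarith [mul_nonneg hE hS, mul_nonneg (zero_le_one.trans hK) hS, mul_nonneg hE hd,
      mul_nonneg (zero_le_one.trans hK) hd]
  calc z ≤ K * K * (d + S + 2 * E₀ + 6 * K) := h6
    _ ≤ K * K * (20 * (1 + E₀ + K) * (d + S + 1)) := by gcongr
    _ = _ := by ring

theorem median_push_arith₃ {K E₀ D D' d d' i : ℝ} (hK : 1 ≤ K) (hE : 0 ≤ E₀)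
    (hd : 0 ≤ d) (hd' : 0 ≤ d') (h1 : i ≤ 3 * D + D') (h2 : D ≤ K * (d + 3 * K))
    (h3 : D' ≤ K * (d' + 3 * K)) :
    i ≤ 20 * K * K * (1 + E₀ + K) * (d + d' + 1) := by
  have h4 : 0 ≤ K * K - K := by nlinarith
  have h6 : i ≤ K * K * (3 * d + d' + 12) := by
    nlinarith [mul_nonneg h4 hd, mul_nonneg h4 hd']
  have h7 : 3 * d + d' + 12 ≤ 20 * (1 + E₀ + K) * (d + d' + 1) := by
    nlinarith [mul_nonneg hE hd', mul_nonneg (zero_le_one.trans hK) hd', mul_nonneg hE hd,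
      mul_nonneg (zero_le_one.trans hK) hd]
  calc i ≤ K * K * (3 * d + d' + 12) := h6
    _ ≤ K * K * (20 * (1 + E₀ + K) * (d + d' + 1)) := by gcongr
    _ = _ := by ring

/-- If the projections of `x` and `y` to the interval of `p`, `p'` are far apart compared to
the distance of `x` and `y`, then there is a coarse geodesic from `p` to `p'` that leaves
the interval. -/
theorem IsLocallyQuasiCubical.exists_path_off_interval {r v : ℕ} (hm : IsCoarseMedian m r)
    (hLQC : IsLocallyQuasiCubical.{u, w} m r v) :
    ∃ E, 1 ≤ E ∧ ∀ p p' x y : X, ∃ (c : ℕ → X) (T i : ℕ), IsCoarseGeodesic E c T ∧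
      dist (c 0) p ≤ E ∧ dist (c T) p' ≤ E ∧ i ≤ T ∧ (i : ℝ) ≤ E * (dist p x + dist x y + 1) ∧
      (dist (m p p' x) (m p p' y) ≤ E * (dist (c i) (m p p' (c i)) + 1) ∨
        dist x (m p p' x) ≤ E * (dist x y + dist (c i) (m p p' (c i)) + 1)) := by
  classical
  obtain ⟨K, hK1, hK⟩ := hLQC.exists_marked_model hm 4
  rcases isEmpty_or_nonempty X with hX | hX
  · exact ⟨1, le_rfl, fun p => isEmptyElim p⟩
  obtain ⟨L, hL⟩ := hm.exists_lipschitz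
  have hL0 := hL.1
  obtain ⟨E₀, hE₀⟩ : ∃ E₀, E₀ = K + L * (K + K + K) + L := ⟨_, rfl⟩
  have hE : 0 ≤ E₀ := by rw [hE₀]; positivity
  have hKK : 1 ≤ K * K := by nlinarith
  have hEK : 3 * K * K + 3 * K ≤ 20 * K * K * (1 + E₀ + K) := by
    nlinarith [mul_nonneg (zero_le_one.trans hKK) hE]
  refine ⟨20 * K * K * (1 + E₀ + K), by nlinarith, fun p p' x y => ?_⟩
  obtain ⟨Q, f, g, hf, hg⟩ := hK {p, p', x, y} ⟨p, by simp⟩ Finset.card_le_four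
  have hp := hg p (by simp)
  have hp' := hg p' (by simp)
  have hx := hg x (by simp)
  have hy := hg y (by simp)
  have hd : ∀ z z', dist z (f (g z)) ≤ K → dist z' (f (g z')) ≤ K →
      (Q.d (g z) (g z') : ℝ) ≤ K * (dist z z' + 3 * K) := by
    intro z z' hz hz'
    refine (hf.d_le (g z) (g z')).trans ?_
    have h6 := dist_triangle4 (f (g z)) z z' (f (g z'))
    rw [dist_comm (f (g z)) z] at h6
    exact mul_le_mul_of_nonneg_left (by linarith) (by linarith)
  obtain ⟨l', hl', hrec⟩ := CATZeroCubeComplex.exists_isRectangleOver (g p) (g p') (g x) (g y)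
  obtain ⟨D, hD⟩ : ∃ D, D = Q.d (Q.median (g p) (g p') (g x)) (Q.median (g p) (g p') (g y)) :=
    ⟨_, rfl⟩
  -- The height is capped by the width `D` so that the path over the top is quasi-geodesic. If the
  -- minimum is `D`, the corner bounds the distance of the projections. If it is `l'`, the corner
  -- bounds the distance from `x` to its projection.
  obtain ⟨a, b, a₁, b₁, h⟩ := hrec (min l' D) (min_le_left _ _)
  obtain ⟨γ, T, h0, h1, h2, h3, hγ⟩ := h.exists_path (by
    rw [h.width, ← hD]; exact min_le_right _ _)
  have hS : (min l' D : ℕ) ≤ K * (dist (f a₁) (m p p' (f a₁)) + E₀ + K) := by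
    have e1 := hf.dist_median_le hL hp hp' (z := f a₁) (c := a₁) (e := K)
      (by rw [dist_self]; linarith)
    rw [← hE₀, h.proj, dist_comm] at e1
    have e2 := hf.d_le a a₁
    have e3 : Q.d a a₁ = min l' D := h.height
    rw [e3] at e2
    refine e2.trans ?_
    have e4 := dist_triangle (f a) (m p p' (f a₁)) (f a₁)
    rw [dist_comm (m p p' (f a₁)) (f a₁)] at e4
    gcongr
    linarith
  refine ⟨fun j => f (γ j), T, Q.d (g p) a₁, (hf.isCoarseGeodesic hγ).mono hEK, ?_, ?_, h2, ?_, ?_⟩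
  · simp only [h0]
    rw [dist_comm]
    nlinarith
  · simp only [h1]
    rw [dist_comm]
    nlinarith
  · exact median_push_arith₃ hK1 hE dist_nonneg dist_nonneg (by exact_mod_cast h.le)
      (hd p x hp hx) (hd x y hx hy)
  · simp only [h3]
    rcases le_total D l' with hc | hc
    · left
      refine median_push_arith₁ (D := D) hK1 hE dist_nonneg hS (by rw [min_eq_right hc]) ?_
      have e1 := hf.dist_median_le hL hp hp' hx
      have e2 := hf.dist_median_le hL hp hp' hy
      have e3 := hf.upper (Q.median (g p) (g p') (g x)) (Q.median (g p) (g p') (g y))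
      have e4 := dist_triangle4 (m p p' x) (f (Q.median (g p) (g p') (g x)))
        (f (Q.median (g p) (g p') (g y))) (m p p' y)
      rw [dist_comm (f (Q.median (g p) (g p') (g y)))] at e4
      rw [hE₀, hD]
      exact e4.trans (add_le_add (add_le_add e1 e3) e2)
    · right
      refine median_push_arith₂ (D := Q.d (g x) (Q.median (g p) (g p') (g x)))
        (D' := Q.d (g x) (g y)) (l := (min l' D : ℕ)) hK1 hE dist_nonneg dist_nonneg hS ?_
        (hd x y hx hy) ?_
      · rw [min_eq_left hc]
        exact_mod_cast hl'
      · have e1 := hf.dist_median_le hL hp hp' hx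
        have e3 := hf.upper (g x) (Q.median (g p) (g p') (g x))
        have e4 := dist_triangle4 x (f (g x)) (f (Q.median (g p) (g p') (g x))) (m p p' x)
        rw [dist_comm (f (Q.median (g p) (g p') (g x))) (m p p' x)] at e4
        rw [hE₀]
        exact e4.trans (add_le_add (add_le_add hx e3) e1)

theorem IsQIEmbeddingOn.tendsto_dist {a b : ℝ} {β : ℝ → X} (h : IsQIEmbeddingOn a b β (Ici 0))
    (o : X) : Tendsto (fun n : ℕ => dist (β n) o) atTop atTop := by
  obtain ⟨ha, hb, h⟩ := h
  have h1 : Tendsto (fun n : ℕ => (n : ℝ) / a + (-b - dist (β 0) o)) atTop atTop :=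
    tendsto_atTop_add_const_right _ _
      (tendsto_natCast_atTop_atTop.atTop_div_const (by linarith))
  refine tendsto_atTop_mono (fun n => ?_) h1
  have h2 := (h n (mem_Ici.2 (Nat.cast_nonneg n)) 0 (mem_Ici.2 le_rfl)).1
  rw [sub_zero, abs_of_nonneg (Nat.cast_nonneg n)] at h2
  have h3 := dist_triangle_right (β n) (β 0) o
  have h4 := dist_triangle (β n) o (β 0)
  rw [dist_comm o] at h4
  linarith

theorem IsQIEmbeddingOn.exists_time {a b : ℝ} {β : ℝ → X} (h : IsQIEmbeddingOn a b β (Ici 0))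
    {x : X} {δ : ℝ} (hx : Metric.infDist x (rayImage β) < δ) :
    ∃ t, 0 ≤ t ∧ dist x (β t) < δ ∧ t ≤ a * (dist x (β 0) + δ + b) := by
  obtain ⟨ha, hb, h⟩ := h
  obtain ⟨_, ⟨t, ht, rfl⟩, hlt⟩ :=
    (Metric.infDist_lt_iff (Set.nonempty_of_mem (self_mem_rayImage (h := β) le_rfl))).1 hx
  refine ⟨t, ht, hlt, ?_⟩
  have h2 := (h t ht 0 (mem_Ici.2 le_rfl)).1
  rw [sub_zero, abs_of_nonneg ht] at h2
  have h3 := dist_triangle_left (β t) (β 0) x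
  have h4 : t / a ≤ dist x (β 0) + δ + b := by linarith
  rw [div_le_iff₀ (by linarith)] at h4
  linarith

/-- A sequence `u` along which the projections `m (u 0) (u n) x` behave like projections to
the quasi-geodesic ray `q`. -/
structure IsGuide (m : X → X → X → X) (o : X) (κ : ℝ → ℝ) (q : ℝ → X) (u : ℕ → X) : Prop where
  follow : ∀ lam, 1 ≤ lam → ∃ C, 0 ≤ C ∧ ∀ ρ : ℕ, ∀ᶠ n in atTop, ∀ (c : ℕ → X) (T : ℕ),
    IsCoarseGeodesic lam c T → dist (c 0) (u 0) ≤ lam → dist (c T) (u n) ≤ lam → ρ ≤ T ∧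
      ∀ i ≤ ρ, Metric.infDist (c i) (rayImage q) ≤ C * κ (dist (c i) o)
  back : ∃ C, 0 ≤ C ∧ ∀ τ : ℝ, ∀ᶠ n in atTop, ∀ t, 0 ≤ t → t ≤ τ →
    dist (q t) (m (u 0) (u n) (q t)) ≤ C * κ (dist (q t) o)

variable {r v : ℕ} {o : X} {κ : ℝ → ℝ} {q : ℝ → X} {u : ℕ → X}

/-- The median is near a coarse geodesic from `u 0` to `u n`, at an index linear in the distance of
`x` from `u 0`. For large `n` this index is in the part that follows `q`, and `κ` there is
comparable to `κ` at `x`. -/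
theorem IsGuide.exists_infDist_median_le (hu : IsGuide m o κ q u) (hm : IsCoarseMedian m r)
    (hLQC : IsLocallyQuasiCubical.{u, w} m r v) (hκ : IsSublinearGauge κ) :
    ∃ C, 0 ≤ C ∧ ∀ x, ∀ᶠ n in atTop,
      Metric.infDist (m (u 0) (u n) x) (rayImage q) ≤ C * κ (dist x o) := by
  obtain ⟨E, hE1, hE⟩ := hLQC.exists_path_through_median hm
  obtain ⟨C, hC0, hC⟩ := hu.follow E hE1
  obtain ⟨G, hG1, hG⟩ := hκ.growth (E * E)
    (E + dist (u 0) o + E * (E * (dist (u 0) o + 1)))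
  refine ⟨C * G + E, by positivity, fun x => ?_⟩
  filter_upwards [hC ⌈E * (dist (u 0) x + 1)⌉₊] with n hn
  obtain ⟨c, T, i, hc, h0, hT, -, hi, him⟩ := hE (u 0) (u n) x
  obtain ⟨hρ, hfol⟩ := hn c T hc h0 hT
  have hiρ : i ≤ ⌈E * (dist (u 0) x + 1)⌉₊ := by exact_mod_cast hi.trans (Nat.le_ceil _)
  have h1 := hfol i hiρ
  have h2 : dist (c i) o ≤ E * E * dist x o + (E + dist (u 0) o + E * (E * (dist (u 0) o + 1))) := by
    have e1 := hc.dist_le (Nat.zero_le i) (hiρ.trans hρ)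
    have e2 := dist_triangle4 (c i) (c 0) (u 0) o
    have e3 := dist_triangle_right (u 0) x o
    have e4 : E * (i : ℝ) ≤ E * (E * (dist (u 0) o + dist x o + 1)) := by
      refine mul_le_mul_of_nonneg_left (hi.trans ?_) (by linarith)
      exact mul_le_mul_of_nonneg_left (by linarith) (by linarith)
    rw [dist_comm (c i) (c 0)] at e2
    push_cast at e1
    linarith
  have h3 := hG _ _ dist_nonneg dist_nonneg h2
  have h4 := Metric.infDist_le_infDist_add_dist (s := rayImage q) (x := m (u 0) (u n) x) (y := c i)
  rw [dist_comm] at h4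
  have h5 := hκ.one_le _ (dist_nonneg (x := x) (y := o))
  have h6 : C * κ (dist (c i) o) ≤ C * (G * κ (dist x o)) := mul_le_mul_of_nonneg_left h3 hC0
  have h7 : E * 1 ≤ E * κ (dist x o) := mul_le_mul_of_nonneg_left h5 (by linarith)
  linarith

theorem contracting_arith {E L S I z d k C C' : ℝ} (hE : 1 ≤ E) (hL : 0 ≤ L) (hk : 1 ≤ k)
    (hd0 : 0 ≤ d) (hS : S ≤ C * k) (hd : d ≤ 1 / (2 * E) * I)
    (hI : I ≤ E * (d + S + 1) + C' * k) (hz : z ≤ L * d + L) :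
    z ≤ (L * (2 * (E * (C + 1) + C')) + L) * k := by
  have h1 : E * d ≤ I / 2 := by
    calc E * d ≤ E * (1 / (2 * E) * I) := mul_le_mul_of_nonneg_left hd (by linarith)
      _ = I / 2 := by field_simp
  have h2 : E * (S + 1) ≤ E * ((C + 1) * k) := mul_le_mul_of_nonneg_left (by linarith) (by linarith)
  have h3 : I ≤ 2 * (E * (C + 1) + C') * k := by nlinarith
  have h4 : d ≤ E * d := by nlinarith
  have h5 : L * d ≤ L * (2 * (E * (C + 1) + C') * k) :=
    mul_le_mul_of_nonneg_left (by linarith) hL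
  nlinarith

/-- The path off the interval follows `q` up to its corner, and `q` is near the interval by `back`.
So the corner has height `O(κ)`, which feeds both alternatives of `exists_path_off_interval`. In the
second one, smallness of the distance of `x` and `y` relative to the distance from `x` to `q` forces
both to be `O(κ)`. -/
theorem IsGuide.exists_dist_median_le (hu : IsGuide m o κ q u) (hm : IsCoarseMedian m r)
    (hLQC : IsLocallyQuasiCubical.{u, w} m r v) (hκ : IsSublinearGauge κ) {a b : ℝ}
    (hq : IsQIEmbeddingOn a b q (Ici 0)) (hqo : q 0 = o) :
    ∃ C₁ C₂, 0 < C₁ ∧ ∀ x y, dist x y ≤ C₁ * Metric.infDist x (rayImage q) →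
      ∀ᶠ n in atTop, dist (m (u 0) (u n) x) (m (u 0) (u n) y) ≤ C₂ * κ (dist x o) := by
  obtain ⟨E, hE1, hE⟩ := hLQC.exists_path_off_interval hm
  have : Nonempty X := ⟨o⟩
  obtain ⟨L, hL⟩ := hm.exists_lipschitz
  obtain ⟨C, hC0, hC⟩ := hu.follow E hE1
  obtain ⟨Cb, hCb0, hCb⟩ := hu.back
  obtain ⟨C', hC'0, hC'⟩ := hu.exists_infDist_median_le hm hLQC hκ
  obtain ⟨B, hB⟩ : ∃ B, B = E + dist (u 0) o + E * (E * (dist (u 0) o + 1)) := ⟨_, rfl⟩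
  obtain ⟨G, hG1, hG⟩ := hκ.growth (2 * E * E) B
  obtain ⟨G', hG'1, hG'⟩ := hκ.exists_dist_comparison o (C + 1)
  refine ⟨1 / (2 * E),
    (L * (2 * (E * (((1 + L) * (C + 1) + Cb * G' + L) * G + 1) + C')) + L) +
      E * (((1 + L) * (C + 1) + Cb * G' + L) * G + 1), by positivity, fun x y hxy => ?_⟩
  have hI : Metric.infDist x (rayImage q) ≤ dist x o :=
    Metric.infDist_le_dist_of_mem (hqo ▸ self_mem_rayImage le_rfl)
  have hE2 : 1 / (2 * E) ≤ 1 := by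
    rw [div_le_one (by positivity)]
    linarith
  have hxy' : dist x y ≤ dist x o := by
    have := mul_le_mul hE2 hI Metric.infDist_nonneg zero_le_one
    linarith
  obtain ⟨k, hk⟩ : ∃ k, k = κ (dist x o) := ⟨_, rfl⟩
  have hk1 : 1 ≤ k := hk ▸ hκ.one_le _ dist_nonneg
  rw [← hk]
  -- Large `n` secures three things uniformly in `n`: the index of the corner lies in the followed
  -- part, the projection of `x` is near `q`, and `back` holds up to the latest time at which `q`
  -- can pass near the corner.
  filter_upwards [hC ⌈E * (dist (u 0) x + dist x y + 1)⌉₊, hC' x,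
    hCb (a * (2 * E * E * dist x o + B + (C + 1) * (G * k) + b))] with n hn hn' hnb
  obtain ⟨c, T, i, hc, h0, hT, -, hi, hcase⟩ := hE (u 0) (u n) x y
  obtain ⟨hρ, hfol⟩ := hn c T hc h0 hT
  have hiρ : i ≤ ⌈E * (dist (u 0) x + dist x y + 1)⌉₊ := by exact_mod_cast hi.trans (Nat.le_ceil _)
  have h1 := hfol i hiρ
  have h2 : dist (c i) o ≤ 2 * E * E * dist x o + B := by
    have e1 := hc.dist_le (Nat.zero_le i) (hiρ.trans hρ)
    have e2 := dist_triangle4 (c i) (c 0) (u 0) o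
    have e3 := dist_triangle_right (u 0) x o
    have e4 : E * (i : ℝ) ≤ E * (E * (dist (u 0) o + 2 * dist x o + 1)) := by
      refine mul_le_mul_of_nonneg_left (hi.trans ?_) (by linarith)
      exact mul_le_mul_of_nonneg_left (by linarith) (by linarith)
    rw [dist_comm (c i) (c 0)] at e2
    push_cast at e1
    rw [hB]
    linarith
  have h3 : κ (dist (c i) o) ≤ G * k := hk ▸ hG _ _ dist_nonneg dist_nonneg h2
  have h4 := hκ.one_le _ (dist_nonneg (x := c i) (y := o))
  obtain ⟨t, ht0, htd, htb⟩ := hq.exists_time (x := c i) (δ := (C + 1) * κ (dist (c i) o))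
    (by linarith)
  have h5 := (hG' (c i) (q t) htd.le).2
  have h6 : (C + 1) * κ (dist (c i) o) ≤ (C + 1) * (G * k) :=
    mul_le_mul_of_nonneg_left h3 (by linarith)
  have h7 := hnb t ht0 (htb.trans (by
    rw [hqo]
    exact mul_le_mul_of_nonneg_left (by linarith) (zero_le_one.trans hq.1)))
  have hS : dist (c i) (m (u 0) (u n) (c i)) ≤ ((1 + L) * (C + 1) + Cb * G' + L) * G * k := by
    have e1 := dist_triangle4 (c i) (q t) (m (u 0) (u n) (q t)) (m (u 0) (u n) (c i))
    have e2 := hL.dist_le (dist_self (u 0)).le (dist_self (u n)).le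
      (show dist (q t) (c i) ≤ (C + 1) * κ (dist (c i) o) by rw [dist_comm]; exact htd.le)
    have e3 : Cb * κ (dist (q t) o) ≤ Cb * (G' * κ (dist (c i) o)) :=
      mul_le_mul_of_nonneg_left h5 hCb0
    have e4 : L * 1 ≤ L * κ (dist (c i) o) := mul_le_mul_of_nonneg_left h4 hL.1
    have e5 : ((1 + L) * (C + 1) + Cb * G' + L) * κ (dist (c i) o) ≤
        ((1 + L) * (C + 1) + Cb * G' + L) * (G * k) := by
      have := hL.1
      exact mul_le_mul_of_nonneg_left h3 (by positivity)
    linarith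
  have hlip := hL.dist_le (dist_self (u 0)).le (dist_self (u n)).le (le_refl (dist x y))
  rw [zero_add, zero_add] at hlip
  have hL0 := hL.1
  rw [add_mul]
  rcases hcase with hcase | hcase
  · refine (hcase.trans ?_).trans (le_add_of_nonneg_left (by positivity))
    rw [mul_assoc E]
    exact mul_le_mul_of_nonneg_left (by linarith) (by linarith)
  · refine (contracting_arith hE1 hL0 hk1 dist_nonneg hS hxy ?_ hlip).trans
      (le_add_of_nonneg_right (by positivity))
    have := Metric.infDist_le_infDist_add_dist (s := rayImage q) (x := x) (y := m (u 0) (u n) x)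
    rw [hk]
    linarith

theorem IsMedianRay.exists_dist_median_le_of_subset (hm : IsCoarseMedian m r)
    (hκ : IsSublinearGauge κ) {a b : ℝ} (hq : IsQIEmbeddingOn a b q (Ici 0)) (hqo : q 0 = o)
    {l : ℝ} {h : ℝ → X} (hh : IsMedianRay m l h) {N : ℝ}
    (hN : rayImage q ⊆ kappaNhd o κ (rayImage h) N) :
    ∃ C, 0 ≤ C ∧ ∀ τ : ℝ, ∀ᶠ n : ℕ in atTop, ∀ t, 0 ≤ t → t ≤ τ →
      dist (q t) (m (h 0) (h n) (q t)) ≤ C * κ (dist (q t) o) := by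
  have : Nonempty X := ⟨o⟩
  obtain ⟨L, hL⟩ := hm.exists_lipschitz
  have hL0 := hL.1
  have hl : 0 ≤ l := zero_le_one.trans hh.1.1
  refine ⟨(1 + L) * (|N| + 1) + l + L, by positivity, fun τ => ?_⟩
  filter_upwards [eventually_ge_atTop
    ⌈l * (a * τ + b + dist (h 0) o + (|N| + 1) * κ (a * τ + b) + l)⌉₊] with n hn t ht0 htτ
  have hn' := (Nat.le_ceil _).trans (show ((⌈_⌉₊ : ℕ) : ℝ) ≤ n by exact_mod_cast hn)
  have h1 : dist (q t) o ≤ a * τ + b := by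
    have e1 := (hq.2.2 t ht0 0 (mem_Ici.2 le_rfl)).2
    rw [hqo, sub_zero, abs_of_nonneg ht0] at e1
    have := mul_le_mul_of_nonneg_left htτ (zero_le_one.trans hq.1)
    linarith
  have h2 : κ (dist (q t) o) ≤ κ (a * τ + b) :=
    hκ.mono (mem_Ici.2 dist_nonneg) (mem_Ici.2 (dist_nonneg.trans h1)) h1
  have h3 := hκ.one_le _ (dist_nonneg (x := q t) (y := o))
  have h4 : Metric.infDist (q t) (rayImage h) ≤ N * κ (dist (q t) o) := hN (self_mem_rayImage ht0)
  have h5 : N * κ (dist (q t) o) ≤ |N| * κ (dist (q t) o) :=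
    mul_le_mul_of_nonneg_right (le_abs_self N) (by linarith)
  obtain ⟨s, hs0, hsd, hsb⟩ := hh.1.exists_time (x := q t) (δ := (|N| + 1) * κ (dist (q t) o))
    (by linarith)
  have h6 : (|N| + 1) * κ (dist (q t) o) ≤ (|N| + 1) * κ (a * τ + b) :=
    mul_le_mul_of_nonneg_left h2 (by positivity)
  have h7 : s ≤ n := by
    refine hsb.trans (le_trans ?_ hn')
    have := dist_triangle_right (q t) (h 0) o
    exact mul_le_mul_of_nonneg_left (by linarith) hl
  have e1 := dist_triangle4 (q t) (h s) (m (h 0) (h n) (h s)) (m (h 0) (h n) (q t))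
  have e2 := hL.dist_le (dist_self (h 0)).le (dist_self (h n)).le
    (show dist (h s) (q t) ≤ (|N| + 1) * κ (dist (q t) o) by rw [dist_comm]; exact hsd.le)
  have e3 := hh.dist_le hs0 h7
  have e4 : (l + L) * 1 ≤ (l + L) * κ (dist (q t) o) := mul_le_mul_of_nonneg_left h3 (by positivity)
  linarith

theorem IsMedianRay.isGuide (hgeod : IsGeodesicMetric X) (hm : IsCoarseMedian m r)
    (hκ : IsSublinearGauge κ) {a b : ℝ} (hq : IsQuasiGeodesicOn a b q (Ici 0)) (hqo : q 0 = o)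
    (hZ : HasMorseRays o κ (rayImage q)) {l : ℝ} {h : ℝ → X} (hh : IsMedianRay m l h)
    (hhq : KappaFellowTravel o κ (rayImage h) (rayImage q)) :
    IsGuide m o κ q (fun n => h n) := by
  obtain ⟨⟨N, hN⟩, ⟨N', hN'⟩⟩ := hhq
  refine ⟨fun lam hlam => ?_, ?_⟩
  · refine hZ.eventually_infDist_le hgeod hκ hq hqo (hh.1.tendsto_dist o) (N := |N| + 1 + a + b)
      (fun n => ?_) hlam
    have h3 := hκ.one_le _ (dist_nonneg (x := h n) (y := o))
    have h4 : Metric.infDist (h n) (rayImage q) ≤ N * κ (dist (h n) o) :=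
      hN (self_mem_rayImage (Nat.cast_nonneg n))
    have h5 : N * κ (dist (h n) o) ≤ |N| * κ (dist (h n) o) :=
      mul_le_mul_of_nonneg_right (le_abs_self N) (by linarith)
    obtain ⟨s, hs0, hsd, -⟩ := hq.2.exists_time (x := h n) (δ := (|N| + 1) * κ (dist (h n) o))
      (by linarith)
    refine ⟨⌈s⌉₊, ?_⟩
    have e1 := (hq.2.2.2 s hs0 ⌈s⌉₊ (mem_Ici.2 (Nat.cast_nonneg _))).2
    have e2 : |s - ⌈s⌉₊| ≤ 1 := by
      rw [abs_le]
      constructor <;> linarith [Nat.le_ceil s, Nat.ceil_lt_add_one hs0]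
    have ha := hq.2.1
    have hb := hq.2.2.1
    have e3 : a * |s - ⌈s⌉₊| ≤ a * 1 := mul_le_mul_of_nonneg_left e2 (by linarith)
    have e4 := dist_triangle (h n) (q s) (q ⌈s⌉₊)
    have e5 : (a + b) * 1 ≤ (a + b) * κ (dist (h n) o) := mul_le_mul_of_nonneg_left h3 (by linarith)
    linarith
  · simpa using hh.exists_dist_median_le_of_subset hm hκ hq.2 hqo hN'

/-- A discrete intermediate value argument. Each `c i` is near some `q (s i)`, with `s 0 = 0` and `s
ρ ≥ τ`, and consecutive times differ by `O(κ)`. So the path passes `κ`-close to every `q t` with `t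
≤ τ`. -/
theorem exists_dist_path_le {E C B : ℝ} (hE : 1 ≤ E) (hκ : IsSublinearGauge κ) {a b : ℝ}
    (hq : IsQIEmbeddingOn a b q (Ici 0)) (hqo : q 0 = o) (hC : 0 ≤ C)
    (hB : ∀ x : X, (C + 1 + E) * κ (dist x o) ≤ dist x o / 2 + B) :
    ∃ D, 0 ≤ D ∧ ∀ (τ : ℝ) (ρ : ℕ), E * (1 + E + 2 * (a * τ + B + b)) ≤ ρ →
      ∀ c : ℕ → X, IsCoarseGeodesic E c ρ → dist (c 0) o ≤ E →
      (∀ i ≤ ρ, Metric.infDist (c i) (rayImage q) ≤ C * κ (dist (c i) o)) →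
      ∀ t, 0 ≤ t → t ≤ τ → ∃ j ≤ ρ, dist (c j) (q t) ≤ D * κ (dist (c j) o) := by
  classical
  obtain ⟨G, hG1, hG⟩ := hκ.exists_dist_comparison o E
  obtain ⟨ha, hb, hqi⟩ := hq
  obtain ⟨D₀, hD₀⟩ : ∃ D₀, D₀ = (C + 1 + E) * G + E + (C + 1 + E) + b := ⟨_, rfl⟩
  have hD₀0 : 0 ≤ D₀ := by rw [hD₀]; positivity
  refine ⟨a * (a * D₀) + b + (C + 1 + E), by positivity,
    fun τ ρ hρ c hc h0 hfol t ht0 htτ => ?_⟩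
  have hk : ∀ i, 1 ≤ κ (dist (c i) o) := fun i => hκ.one_le _ dist_nonneg
  have hs : ∀ i, ∃ s, i ≤ ρ → 0 ≤ s ∧ (i = 0 → s = 0) ∧
      dist (c i) (q s) ≤ (C + 1 + E) * κ (dist (c i) o) := by
    intro i
    by_cases hi : i ≤ ρ
    · rcases Nat.eq_zero_or_pos i with rfl | hi0
      · refine ⟨0, fun _ => ⟨le_rfl, fun _ => rfl, ?_⟩⟩
        rw [hqo]
        nlinarith [hk 0]
      · obtain ⟨s, hs0, hsd, -⟩ := IsQIEmbeddingOn.exists_time ⟨ha, hb, hqi⟩ (x := c i)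
          (δ := (C + 1) * κ (dist (c i) o)) (by linarith [hfol i hi, hk i])
        refine ⟨s, fun _ => ⟨hs0, fun h => by omega, hsd.le.trans ?_⟩⟩
        nlinarith [hk i]
    · exact ⟨0, fun h => absurd h hi⟩
  choose s hs using hs
  have hsρ : τ ≤ s ρ := by
    obtain ⟨e0, -, e1⟩ := hs ρ le_rfl
    have e2 := (hqi (s ρ) e0 0 (mem_Ici.2 le_rfl)).2
    rw [hqo, sub_zero, abs_of_nonneg e0] at e2
    have e3 := hB (c ρ)
    have e4 := dist_triangle (c ρ) (q (s ρ)) o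
    have e5 := hc.2 0 ρ (Nat.zero_le _) le_rfl
    have e6 := dist_triangle_right (c 0) (c ρ) o
    have e7 : E * (1 + E + 2 * (a * τ + B + b)) ≤ E * (1 + E + dist (c ρ) o) := by
      push_cast at e5
      nlinarith
    have e8 := le_of_mul_le_mul_left e7 (by linarith)
    exact le_of_mul_le_mul_left (by linarith) (show 0 < a by linarith)
  -- At the first index whose time reaches `t`, the overshoot is bounded by the jump from the
  -- preceding time.
  have hex : ∃ j, j ≤ ρ ∧ t ≤ s j := ⟨ρ, le_rfl, htτ.trans hsρ⟩
  obtain ⟨hjρ, hj⟩ := Nat.find_spec hex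
  have hmin : ∀ i, i < Nat.find hex → ¬(i ≤ ρ ∧ t ≤ s i) := fun i hi => Nat.find_min hex hi
  generalize Nat.find hex = j at hjρ hj hmin
  refine ⟨j, hjρ, ?_⟩
  obtain ⟨e0, e1, e2⟩ := hs j hjρ
  have hgap : s j - t ≤ a * (D₀ * κ (dist (c j) o)) := by
    rcases j with _ | j
    · rw [e1 rfl]
      have : 0 ≤ a * (D₀ * κ (dist (c 0) o)) := by have := hk 0; positivity
      linarith
    · have e3 : s j < t := by
        by_contra! h
        exact hmin j (Nat.lt_succ_self j) ⟨by omega, h⟩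
      obtain ⟨f0, -, f2⟩ := hs j (by omega)
      have f3 := (hqi (s (j + 1)) e0 (s j) f0).1
      rw [abs_of_nonneg (by linarith)] at f3
      have f4 := dist_triangle4 (q (s (j + 1))) (c (j + 1)) (c j) (q (s j))
      rw [dist_comm (q (s (j + 1))) (c (j + 1)), dist_comm (c (j + 1)) (c j)] at f4
      have f5 := hc.1 j (by omega)
      have f6 := (hG (c (j + 1)) (c j) (by
        rw [dist_comm]; nlinarith [hk (j + 1)])).2
      have f7 : (C + 1 + E) * κ (dist (c j) o) ≤ (C + 1 + E) * (G * κ (dist (c (j + 1)) o)) :=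
        mul_le_mul_of_nonneg_left f6 (by linarith)
      have f8 : (E + b) * 1 ≤ (E + b) * κ (dist (c (j + 1)) o) :=
        mul_le_mul_of_nonneg_left (hk _) (by linarith)
      have f9 : (s (j + 1) - s j) / a ≤ D₀ * κ (dist (c (j + 1)) o) := by
        rw [hD₀]
        linarith
      rw [div_le_iff₀ (by linarith)] at f9
      linarith
  have g1 := (hqi (s j) e0 t ht0).2
  rw [abs_of_nonneg (by linarith)] at g1
  have g2 := dist_triangle (c j) (q (s j)) (q t)
  have g3 := mul_le_mul_of_nonneg_left hgap (zero_le_one.trans ha)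
  have g4 : b * 1 ≤ b * κ (dist (c j) o) := mul_le_mul_of_nonneg_left (hk _) hb
  linarith

/-- Although `q` need not respect medians, a coarse geodesic inside the interval from `q 0` to `q n`
follows `q` and therefore comes `κ`-close to each `q t`. Hence `q t` is close to the interval, as
`back` demands. -/
theorem IsQuasiGeodesicOn.isGuide (hgeod : IsGeodesicMetric X) (hm : IsCoarseMedian m r)
    (hLQC : IsLocallyQuasiCubical.{u, w} m r v) (hκ : IsSublinearGauge κ) {a b : ℝ}
    (hq : IsQuasiGeodesicOn a b q (Ici 0)) (hqo : q 0 = o) (hZ : HasMorseRays o κ (rayImage q)) :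
    IsGuide m o κ q (fun n => q n) := by
  have hfollow : ∀ lam, 1 ≤ lam → ∃ C, 0 ≤ C ∧ ∀ ρ : ℕ, ∀ᶠ n : ℕ in atTop,
      ∀ (c : ℕ → X) (T : ℕ), IsCoarseGeodesic lam c T → dist (c 0) (q (0 : ℕ)) ≤ lam →
        dist (c T) (q n) ≤ lam → ρ ≤ T ∧
          ∀ i ≤ ρ, Metric.infDist (c i) (rayImage q) ≤ C * κ (dist (c i) o) := fun lam hlam =>
    hZ.eventually_infDist_le hgeod hκ hq hqo (u := fun n : ℕ => q n) (hq.2.tendsto_dist o)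
      (N := 0) (fun n => ⟨n, by simp⟩) hlam
  refine ⟨hfollow, ?_⟩
  have : Nonempty X := ⟨o⟩
  obtain ⟨E, hE1, hE⟩ := hLQC.exists_path_through_median hm
  obtain ⟨L, hL⟩ := hm.exists_lipschitz
  have hL0 := hL.1
  obtain ⟨C, hC0, hC⟩ := hfollow E hE1
  obtain ⟨B, hB⟩ : ∃ B, ∀ x : X, (C + 1 + E) * κ (dist x o) ≤ dist x o / 2 + B := by
    obtain ⟨B, -, hB⟩ := hκ.small (1 / (2 * (C + 1 + E))) (by positivity)
    refine ⟨(C + 1 + E) * B, fun x => ?_⟩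
    have h1 := mul_le_mul_of_nonneg_left (hB (dist x o) dist_nonneg)
      (show 0 ≤ C + 1 + E by positivity)
    have h2 : (C + 1 + E) * (1 / (2 * (C + 1 + E)) * dist x o + B) =
      dist x o / 2 + (C + 1 + E) * B := by field_simp
    rwa [h2] at h1
  obtain ⟨D, hD0, hD⟩ := exists_dist_path_le hE1 hκ hq.2 hqo hC0 hB
  obtain ⟨G, hG1, hG⟩ := hκ.exists_dist_comparison o D
  refine ⟨((1 + L) * D + E + L) * G, by positivity, fun τ => ?_⟩
  filter_upwards [hC ⌈E * (1 + E + 2 * (a * τ + B + b))⌉₊] with n hn t ht0 htτ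
  -- The third point is arbitrary here. Only the property that the whole path lies coarsely in the
  -- interval is used.
  obtain ⟨c, T, -, hc, h0, hT, hmed, -⟩ := hE (q (0 : ℕ)) (q n) o
  obtain ⟨hρ, hfol⟩ := hn c T hc h0 hT
  obtain ⟨j, hj, hjt⟩ := hD τ _ (Nat.le_ceil _) c (hc.restrict hρ) (by simpa [hqo] using h0)
    hfol t ht0 htτ
  have e1 := dist_triangle4 (q t) (c j) (m (q (0 : ℕ)) (q n) (c j)) (m (q (0 : ℕ)) (q n) (q t))
  have e2 := hL.dist_le (dist_self (q (0 : ℕ))).le (dist_self (q n)).le hjt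
  have e3 := hmed j (hj.trans hρ)
  have e4 := (hG (c j) (q t) hjt).1
  have e5 := hκ.one_le _ (dist_nonneg (x := c j) (y := o))
  have e6 : (E + L) * 1 ≤ (E + L) * κ (dist (c j) o) := mul_le_mul_of_nonneg_left e5 (by positivity)
  have e7 : ((1 + L) * D + E + L) * κ (dist (c j) o) ≤
      ((1 + L) * D + E + L) * (G * κ (dist (q t) o)) :=
    mul_le_mul_of_nonneg_left e4 (by positivity)
  rw [dist_comm (q t) (c j)] at e1
  linarith

end Guide

/-! ### Excursions from a contracting set -/

theorem IsSublinearGauge.exists_comparison_add {κ : ℝ → ℝ} (hκ : IsSublinearGauge κ) (C : ℝ) :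
    ∃ C', 1 ≤ C' ∧ ∀ s t, 0 ≤ s → 0 ≤ t → |s - t| ≤ C * (κ s + κ t) → κ t ≤ C' * κ s := by
  obtain ⟨C', h1, h⟩ := hκ.exists_comparison (2 * |C|)
  refine ⟨C', h1, fun s t hs ht hst => ?_⟩
  have hks := hκ.one_le s hs
  have hkt := hκ.one_le t ht
  rcases le_total (κ t) (κ s) with h2 | h2
  · nlinarith
  · refine (h t s ht hs ?_).1
    rw [abs_sub_comm]
    have h3 : C * (κ s + κ t) ≤ |C| * (κ t + κ t) :=
      mul_le_mul (le_abs_self C) (by linarith) (by linarith) (abs_nonneg C)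
    linarith

section Contracting

variable {X : Type u} [MetricSpace X] {o : X} {κ : ℝ → ℝ} {Z : Set X} {π : X → Set X}

theorem IsCoarseGeodesic.dist_le_of_sub_le {lam : ℝ} {c : ℕ → X} {T : ℕ} (h : IsCoarseGeodesic lam c T)
    {i j : ℕ} (hij : i ≤ j) (hj : j ≤ T) {d : ℝ} (hlam : 0 < lam)
    (hk : (j : ℝ) - i ≤ d / lam) : dist (c i) (c j) ≤ d :=
  (h.dist_le hij hj).trans (by rwa [le_div_iff₀ hlam, mul_comm] at hk)

/-- While a coarse geodesic stays away from `Z`, its projections to `Z` drift slowly. -/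
theorem dist_projection_le {lam C₁ C₂ M F : ℝ} (hlam : 1 ≤ lam) (hκ : ∀ x, 1 ≤ κ (dist x o))
    (hC₁ : 0 < C₁) (hC₁' : C₁ ≤ 1) (hC₂ : 0 ≤ C₂)
    (hM : M * C₁ = 8 * lam * lam * (C₂ + 1)) (hF : 2 * C₂ ≤ F)
    (hne : ∀ x, (π x).Nonempty)
    (hproj : ∀ x, DiamLE (π x) (F * (Metric.infDist x Z + κ (dist x o))))
    (hcon : ∀ x y, dist x y < C₁ * Metric.infDist x Z → DiamLE (π x ∪ π y) (C₂ * κ (dist x o)))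
    {c : ℕ → X} {T : ℕ} (hc : IsCoarseGeodesic lam c T) {e : ℕ} (he : e ≤ T) (k i : ℕ)
    (hik : i + k = e)
    (hbad : ∀ j, i ≤ j → j < e → M * κ (dist (c j) o) < Metric.infDist (c j) Z)
    {y y' : X} (hy : y ∈ π (c i)) (hy' : y' ∈ π (c e)) :
    dist y y' ≤ 1 / (2 * lam) * k + F * (Metric.infDist (c e) Z + κ (dist (c e) o)) := by
  induction k using Nat.strong_induction_on generalizing i y with
  | _ k ih =>
    rcases Nat.eq_zero_or_pos k with rfl | hk
    · obtain rfl : i = e := by omega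
      simpa using hproj _ y hy y' hy'
    have hD := hbad i le_rfl (by omega)
    have hκi := hκ (c i)
    have hκe := hκ (c e)
    obtain ⟨D, hDdef⟩ : ∃ D, D = Metric.infDist (c i) Z := ⟨_, rfl⟩
    rw [← hDdef] at hD
    have hM8 : 8 * lam * lam * (C₂ + 1) * κ (dist (c i) o) < D * C₁ := by
      rw [← hM]
      nlinarith
    have hlam2 : lam ≤ lam * lam := by nlinarith
    have hDC : 8 * lam < D * C₁ := by
      have : 8 * lam * 1 ≤ 8 * lam * lam * (C₂ + 1) * κ (dist (c i) o) := by
        calc 8 * lam * 1 ≤ 8 * lam * (lam * (C₂ + 1) * κ (dist (c i) o)) := by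
              apply mul_le_mul_of_nonneg_left _ (by linarith)
              calc (1 : ℝ) = 1 * 1 * 1 := by norm_num
                _ ≤ lam * (C₂ + 1) * κ (dist (c i) o) := by gcongr; linarith
          _ = _ := by ring
      linarith
    have hC2k : C₂ * κ (dist (c i) o) ≤ C₁ * D / (8 * lam * lam) := by
      rw [le_div_iff₀ (by positivity)]
      have : 0 ≤ 8 * lam * lam * κ (dist (c i) o) := by positivity
      nlinarith
    have hDpos : 0 < D := by nlinarith
    -- During `n` steps the path moves by at most half the contraction radius, so the projections
    -- move by at most `C₂ * κ`. The constant `M` is so large that this is at most `1 / (2 * lam)`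
    -- per step, half the guaranteed speed of the path.
    obtain ⟨n, hn⟩ : ∃ n, n = ⌊C₁ * D / (2 * lam)⌋₊ := ⟨_, rfl⟩
    have hn1 : (n : ℝ) ≤ C₁ * D / (2 * lam) := hn ▸ Nat.floor_le (by positivity)
    have hn2 : C₁ * D / (2 * lam) < n + 1 := hn ▸ Nat.lt_floor_add_one _
    have hn4 : 4 < C₁ * D / (2 * lam) := by
      rw [lt_div_iff₀ (by positivity)]
      linarith
    have hn3 : C₁ * D / (4 * lam) ≤ n := by
      have : C₁ * D / (2 * lam) = 2 * (C₁ * D / (4 * lam)) := by field_simp; norm_num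
      linarith
    have hstep : ∀ j, i ≤ j → j ≤ e → j ≤ i + n → dist (c i) (c j) ≤ C₁ * D / 2 := by
      intro j hj1 hj2 hj3
      refine hc.dist_le_of_sub_le hj1 (hj2.trans he) (by linarith) ?_
      have : (j : ℝ) ≤ i + n := by exact_mod_cast hj3
      rw [div_div]
      linarith
    rcases le_or_gt e (i + n) with hcase | hcase
    · have h1 := hstep e (by omega) le_rfl hcase
      have h2 := hcon (c i) (c e) (by rw [← hDdef]; nlinarith) y (Or.inl hy) y' (Or.inr hy')
      have h3 := Metric.infDist_le_infDist_add_dist (s := Z) (x := c i) (y := c e)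
      rw [← hDdef] at h3
      have h4 : D ≤ 2 * Metric.infDist (c e) Z := by nlinarith
      have h5 : C₁ * D / (8 * lam * lam) ≤ D / 2 := by
        rw [div_le_iff₀ (by positivity)]
        nlinarith
      have h6 : C₂ * κ (dist (c i) o) ≤ C₂ * D := by
        apply mul_le_mul_of_nonneg_left _ hC₂
        have g1 : 1 ≤ 8 * lam * lam * (C₂ + 1) := by nlinarith
        have g2 : 1 * κ (dist (c i) o) ≤ 8 * lam * lam * (C₂ + 1) * κ (dist (c i) o) :=
          mul_le_mul_of_nonneg_right g1 (by linarith)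
        have g3 : D * C₁ ≤ D * 1 := mul_le_mul_of_nonneg_left hC₁' hDpos.le
        linarith
      have h7 : C₂ * D ≤ C₂ * (2 * Metric.infDist (c e) Z) := mul_le_mul_of_nonneg_left h4 hC₂
      have h8 : 2 * C₂ * Metric.infDist (c e) Z ≤ F * Metric.infDist (c e) Z :=
        mul_le_mul_of_nonneg_right hF Metric.infDist_nonneg
      have h9 : 0 ≤ F * κ (dist (c e) o) := by
        have : 0 ≤ F := by linarith
        positivity
      have h10 : 0 ≤ 1 / (2 * lam) * (k : ℝ) := by positivity
      linarith
    · have hn0 : 0 < n := by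
        have : (0 : ℝ) < n := by linarith
        exact_mod_cast this
      have h1 := hstep (i + n) (by omega) hcase.le le_rfl
      obtain ⟨z, hz⟩ := hne (c (i + n))
      have h2 := hcon (c i) (c (i + n)) (by rw [← hDdef]; nlinarith) y (Or.inl hy) z (Or.inr hz)
      have h3 := ih (k - n) (by omega) (i + n) (by omega)
        (fun j hj1 hj2 => hbad j (by omega) hj2) hz
      rw [Nat.cast_sub (by omega)] at h3
      have h4 : C₁ * D / (8 * lam * lam) ≤ 1 / (2 * lam) * n := by
        calc C₁ * D / (8 * lam * lam) = 1 / (2 * lam) * (C₁ * D / (4 * lam)) := by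
              field_simp
              norm_num
          _ ≤ _ := by gcongr
      have h5 := dist_triangle y z y'
      linarith

theorem exists_last_le {P : ℕ → Prop} (h0 : P 0) (i : ℕ) :
    ∃ s ≤ i, P s ∧ ∀ j, s < j → j ≤ i → ¬P j := by
  induction i with
  | zero => exact ⟨0, le_rfl, h0, fun j h1 h2 => by omega⟩
  | succ i ih =>
    by_cases h : P (i + 1)
    · exact ⟨i + 1, le_rfl, h, fun j h1 h2 => by omega⟩
    · obtain ⟨s, hs, hPs, hj⟩ := ih
      refine ⟨s, by omega, hPs, fun j h1 h2 => ?_⟩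
      rcases Nat.lt_or_ge i j with h3 | h3
      · obtain rfl : j = i + 1 := by omega
        exact h
      · exact hj j h1 h3

theorem exists_first_ge (P : ℕ → Prop) {i T : ℕ} (hi : i ≤ T) :
    ∃ e, i ≤ e ∧ e ≤ T ∧ (P e ∨ e = T) ∧ ∀ j, i ≤ j → j < e → ¬P j := by
  classical
  have hex : ∃ e, i ≤ e ∧ (P e ∨ e = T) := ⟨T, hi, Or.inr rfl⟩
  refine ⟨Nat.find hex, (Nat.find_spec hex).1, Nat.find_min' hex ⟨hi, Or.inr rfl⟩,
    (Nat.find_spec hex).2, fun j h1 h2 hP => Nat.find_min hex h2 ⟨h1, Or.inl hP⟩⟩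

theorem excursion_arith {lam n d D₁ y₁ y₂ Y W ks x₁ k₁ De ke : ℝ} (hlam : 1 ≤ lam)
    (hY : 0 ≤ Y)
    (h1 : n ≤ lam * d + lam) (h2 : d ≤ y₁ + D₁ + y₂)
    (h3 : y₁ ≤ W * (x₁ + k₁)) (h4 : D₁ ≤ 1 / (2 * lam) * n + W * (De + ke))
    (h5 : y₂ ≤ W * (De + ke)) (hW : 0 ≤ W) (h6 : x₁ + k₁ ≤ Y * ks) (hks : 1 ≤ ks)
    (hDe : 0 ≤ De) (hke : 0 ≤ ke) :
    n + 1 ≤ (2 * lam * W * Y + 4 * lam * W + 2 * lam + 1) * (ks + De + ke) := by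
  have h7 : lam * (1 / (2 * lam) * n) = n / 2 := by field_simp
  have h8 : W * (x₁ + k₁) ≤ W * (Y * ks) := mul_le_mul_of_nonneg_left h6 hW
  have h9 : lam * d ≤ lam * (W * (Y * ks) + (1 / (2 * lam) * n + W * (De + ke)) + W * (De + ke)) :=
    mul_le_mul_of_nonneg_left (by linarith) (by linarith)
  have h10 : n ≤ 2 * lam * W * Y * ks + 4 * lam * W * (De + ke) + 2 * lam := by linarith
  have h11 : 0 ≤ 2 * lam * W * Y * (De + ke) := by positivity
  have h12 : 0 ≤ 4 * lam * W * ks := by positivity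
  have h13 : 2 * lam + 1 ≤ (2 * lam + 1) * (ks + De + ke) := by nlinarith
  linarith

/-- Outside the `M * κ`-neighbourhood the projections drift at most half as fast as the path must
advance. So the length of an excursion is bounded by the distances of its two ends from `Z` and the
gauge there. The case `e = T` allows for a path that ends far from `Z`. -/
theorem IsKappaContractingWith.exists_excursion (hκ : IsSublinearGauge κ)
    (hZ : IsKappaContractingWith o κ Z π) {lam : ℝ} (hlam : 1 ≤ lam) :
    ∃ M A, 0 ≤ M ∧ 0 ≤ A ∧ ∀ (c : ℕ → X) (T : ℕ), IsCoarseGeodesic lam c T →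
      Metric.infDist (c 0) Z ≤ lam → ∀ i ≤ T, ∃ s e, s ≤ i ∧ i ≤ e ∧ e ≤ T ∧
        Metric.infDist (c s) Z ≤ M * κ (dist (c s) o) ∧
        (e : ℝ) - s ≤ A * (κ (dist (c s) o) + Metric.infDist (c e) Z + κ (dist (c e) o)) ∧
        (Metric.infDist (c e) Z ≤ M * κ (dist (c e) o) ∨ e = T) := by
  obtain ⟨⟨hπ, D₁, D₂, hD₁, hD₂, hproj⟩, C₁, C₂, hC₁, hcon⟩ := hZ
  obtain ⟨G, hG1, hG⟩ := hκ.exists_dist_comparison o lam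
  have hk : ∀ x : X, 1 ≤ κ (dist x o) := fun x => hκ.one_le _ dist_nonneg
  obtain ⟨C, hCdef⟩ : ∃ C, C = min C₁ 1 := ⟨_, rfl⟩
  have hC0 : 0 < C := hCdef ▸ lt_min hC₁ one_pos
  have hC1 : C ≤ 1 := hCdef ▸ min_le_right _ _
  have hCC : C ≤ C₁ := hCdef ▸ min_le_left _ _
  obtain ⟨M, hM⟩ : ∃ M, M = 8 * lam * lam * (|C₂| + 1) / C := ⟨_, rfl⟩
  have hMC : M * C = 8 * lam * lam * (|C₂| + 1) := by rw [hM]; field_simp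
  have hM0 : 0 ≤ M := by rw [hM]; positivity
  have hMlam : lam ≤ M := by
    rw [hM, le_div_iff₀ hC0]
    have h1 : lam * C ≤ lam * 1 := mul_le_mul_of_nonneg_left hC1 (by linarith)
    have h2 : lam * 1 ≤ lam * lam := mul_le_mul_of_nonneg_left hlam (by linarith)
    nlinarith [mul_nonneg (mul_nonneg (zero_le_one.trans hlam) (zero_le_one.trans hlam))
      (abs_nonneg C₂)]
  obtain ⟨W, hW⟩ : ∃ W, W = D₁ + 1 + D₂ + 2 * |C₂| := ⟨_, rfl⟩
  have hW0 : 0 ≤ W := by rw [hW]; positivity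
  have hprojW : ∀ x, DiamLE ({x} ∪ π x) (W * (Metric.infDist x Z + κ (dist x o))) := by
    intro x p hp p' hp'
    refine (hproj x p hp p' hp').trans ?_
    have h1 : (D₁ + 1) * Metric.infDist x Z ≤ W * Metric.infDist x Z :=
      mul_le_mul_of_nonneg_right (by rw [hW]; linarith [abs_nonneg C₂]) Metric.infDist_nonneg
    have h2 : D₂ * κ (dist x o) ≤ W * κ (dist x o) :=
      mul_le_mul_of_nonneg_right (by rw [hW]; linarith [abs_nonneg C₂]) (by linarith [hk x])
    linarith
  refine ⟨M, 2 * lam * W * (M + lam + G) + 4 * lam * W + 2 * lam + 1, hM0, by positivity,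
    fun c T hc h0 i hi => ?_⟩
  by_cases hgood : Metric.infDist (c i) Z ≤ M * κ (dist (c i) o)
  · refine ⟨i, i, le_rfl, le_rfl, hi, hgood, ?_, Or.inl hgood⟩
    rw [sub_self]
    have h1 := hk (c i)
    have h2 := Metric.infDist_nonneg (s := Z) (x := c i)
    positivity
  obtain ⟨s, hs, hPs, hsj⟩ := exists_last_le
    (P := fun j => Metric.infDist (c j) Z ≤ M * κ (dist (c j) o)) (by nlinarith [hk (c 0)]) i
  obtain ⟨e, hie, heT, hPe, hej⟩ := exists_first_ge
    (fun j => Metric.infDist (c j) Z ≤ M * κ (dist (c j) o)) hi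
  have hsi : s ≠ i := by
    rintro rfl
    exact hgood hPs
  refine ⟨s, e, hs, hie, heT, hPs, ?_, hPe⟩
  -- The drift estimate needs points that are far from `Z`, and `s` is not one of them; it starts at
  -- `s + 1`.
  obtain ⟨k, rfl⟩ : ∃ k, e = s + 1 + k := Nat.exists_eq_add_of_le (by omega)
  obtain ⟨y, hy⟩ := (hπ (c (s + 1))).1
  obtain ⟨y', hy'⟩ := (hπ (c (s + 1 + k))).1
  have h1 := dist_projection_le (F := W) hlam hk hC0 hC1 (abs_nonneg C₂) hMC
    (by rw [hW]; linarith) (fun x => (hπ x).1)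
    (fun x p hp p' hp' => hprojW x p (Or.inr hp) p' (Or.inr hp'))
    (fun x y hxy p hp p' hp' => by
      refine (hcon x y (hxy.trans_le
        (mul_le_mul_of_nonneg_right hCC Metric.infDist_nonneg)) p hp p' hp').trans ?_
      exact mul_le_mul_of_nonneg_right (le_abs_self C₂) (by linarith [hk x]))
    hc heT k (s + 1) rfl (fun j hj1 hj2 => by
      rcases le_total j i with h | h
      · exact not_le.1 (hsj j (by omega) h)
      · exact not_le.1 (hej j h hj2)) hy hy'
  have h2 := hc.2 (s + 1) (s + 1 + k) (by omega) heT
  have h3 := dist_triangle4 (c (s + 1)) y y' (c (s + 1 + k))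
  have h4 := hprojW (c (s + 1)) (c (s + 1)) (Or.inl rfl) y (Or.inr hy)
  have h5 := hprojW (c (s + 1 + k)) y' (Or.inr hy') (c (s + 1 + k)) (Or.inl rfl)
  have h6 := hc.1 s (by omega)
  have h7 := (hG (c s) (c (s + 1)) (by nlinarith [hk (c s)])).2
  have h8 := Metric.infDist_le_infDist_add_dist (s := Z) (x := c (s + 1)) (y := c s)
  rw [dist_comm] at h8
  have h9 := excursion_arith (n := k) (ks := κ (dist (c s) o)) (Y := M + lam + G) hlam
    (by positivity) (by push_cast at h2; linarith) h3 h4 h1 h5 hW0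
    (by nlinarith [hk (c s)]) (hk _) Metric.infDist_nonneg (zero_le_one.trans (hk _))
  push_cast
  linarith

/-- If both ends are good, the excursion has length `O(κ)` at the ends. The gauge is then comparable
at all its points, and the distance to `c s` bounds the distance to `Z`. -/
theorem exists_infDist_le_of_excursion (hκ : IsSublinearGauge κ) (o : X) (Z : Set X) (lam M A : ℝ)
    (hlam : 1 ≤ lam) (hA : 0 ≤ A) (hM : 0 ≤ M) :
    ∃ C, 0 ≤ C ∧ ∀ (c : ℕ → X) (T s i e : ℕ), IsCoarseGeodesic lam c T → s ≤ i → i ≤ e → e ≤ T →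
      Metric.infDist (c s) Z ≤ M * κ (dist (c s) o) →
      (e : ℝ) - s ≤ A * (κ (dist (c s) o) + Metric.infDist (c e) Z + κ (dist (c e) o)) →
      Metric.infDist (c e) Z ≤ M * κ (dist (c e) o) →
      Metric.infDist (c i) Z ≤ C * κ (dist (c i) o) := by
  obtain ⟨G, hG1, hG⟩ := hκ.exists_comparison_add (lam * (A * (1 + M)))
  obtain ⟨G', hG'1, hG'⟩ := hκ.exists_dist_comparison o (lam * (A * (1 + M) * (1 + G)))
  refine ⟨(M + lam * (A * (1 + M) * (1 + G))) * G', by positivity,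
    fun c T s i e hc hsi hie heT hs hes he => ?_⟩
  have hks := hκ.one_le _ (dist_nonneg (x := c s) (y := o))
  have hke := hκ.one_le _ (dist_nonneg (x := c e) (y := o))
  have h1 : (e : ℝ) - s ≤ A * (1 + M) * (κ (dist (c s) o) + κ (dist (c e) o)) := by
    refine hes.trans ?_
    rw [mul_assoc]
    refine mul_le_mul_of_nonneg_left ?_ hA
    nlinarith
  have h2 : dist (c s) (c e) ≤ lam * (A * (1 + M)) * (κ (dist (c s) o) + κ (dist (c e) o)) := by
    refine (hc.dist_le (hsi.trans hie) heT).trans ?_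
    rw [mul_assoc]
    exact mul_le_mul_of_nonneg_left h1 (by linarith)
  have h3 := hG _ _ dist_nonneg dist_nonneg ((abs_dist_sub_le (c s) (c e) o).trans h2)
  have h4 : A * (1 + M) * (κ (dist (c s) o) + κ (dist (c e) o)) ≤
      A * (1 + M) * ((1 + G) * κ (dist (c s) o)) :=
    mul_le_mul_of_nonneg_left (by linarith) (by positivity)
  have h5 : dist (c s) (c i) ≤ lam * (A * (1 + M) * (1 + G)) * κ (dist (c s) o) := by
    refine (hc.dist_le hsi (hie.trans heT)).trans ?_
    rw [mul_assoc]
    refine mul_le_mul_of_nonneg_left ?_ (by linarith)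
    have : (i : ℝ) ≤ e := by exact_mod_cast hie
    linarith
  have h6 := (hG' _ _ h5).1
  have h7 := Metric.infDist_le_infDist_add_dist (s := Z) (x := c i) (y := c s)
  rw [dist_comm] at h7
  have h8 : (M + lam * (A * (1 + M) * (1 + G))) * κ (dist (c s) o) ≤
      (M + lam * (A * (1 + M) * (1 + G))) * (G' * κ (dist (c i) o)) :=
    mul_le_mul_of_nonneg_left h6 (by positivity)
  linarith

end Contracting

/-! ### The equivalence and the projection to the hull -/

section Equivalence

variable {X : Type u} [MetricSpace X] {o : X} {κ : ℝ → ℝ} {Z : Set X} {π : X → Set X}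

/-- Truncating the sampling times at `t` makes `β t` the last sample. The last step may be shorter
than one unit, which the summand `1` of the constant absorbs. -/
theorem IsQuasiGeodesicOn.isCoarseGeodesic_sample {a b : ℝ} {β : ℝ → X} {s t : ℝ} (hst : s ≤ t)
    (hβ : IsQuasiGeodesicOn a b β (Icc s t)) :
    IsCoarseGeodesic (a + b + a * b + 1) (fun i : ℕ => β (min (s + i) t)) ⌈t - s⌉₊ := by
  obtain ⟨-, ha, hb, hqi⟩ := hβ
  have hmem : ∀ i : ℕ, min (s + i) t ∈ Icc s t := fun i =>
    ⟨le_min (le_add_of_nonneg_right (Nat.cast_nonneg i)) hst, min_le_right _ _⟩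
  have hab : 0 ≤ a * b := by positivity
  refine ⟨fun i _ => ?_, fun i j hij hj => ?_⟩
  · refine (hqi _ (hmem i) _ (hmem (i + 1))).2.trans ?_
    have h1 : |min (s + i) t - min (s + (i + 1 : ℕ)) t| ≤ 1 := by
      refine (abs_min_sub_min_le_max _ _ _ _).trans ?_
      rw [sub_self, abs_zero]
      push_cast
      rw [show s + i - (s + (i + 1)) = (-1 : ℝ) by ring]
      norm_num
    have h2 := mul_le_mul_of_nonneg_left h1 (zero_le_one.trans ha)
    linarith
  · have h1 := (hqi _ (hmem i) _ (hmem j)).1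
    have h2 : (j : ℝ) < t - s + 1 :=
      (show (j : ℝ) ≤ ⌈t - s⌉₊ by exact_mod_cast hj).trans_lt (Nat.ceil_lt_add_one (by linarith))
    have h3 : (j : ℝ) - i - 1 ≤ |min (s + i) t - min (s + j) t| := by
      rw [abs_sub_comm]
      refine le_trans ?_ (le_abs_self _)
      have h4 := min_le_left (s + i) t
      have h5 : s + j - 1 ≤ min (s + j) t := le_min (by linarith) (by linarith)
      linarith
    have h4 : |min (s + i) t - min (s + j) t| / a ≤
      dist (β (min (s + i) t)) (β (min (s + j) t)) + b := by linarith
    rw [div_le_iff₀ (by linarith)] at h4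
    have h5 : 0 ≤ dist (β (min (s + i) t)) (β (min (s + j) t)) := dist_nonneg
    nlinarith [mul_nonneg hab h5, mul_nonneg hb h5]

theorem IsKappaContractingWith.exists_excursion_quasiGeodesic (hκ : IsSublinearGauge κ)
    (hZ : IsKappaContractingWith o κ Z π) {lam : ℝ} (hlam : 1 ≤ lam) :
    ∃ M A, 0 ≤ M ∧ 0 ≤ A ∧ ∀ (a b : ℝ) (β : ℝ → X) (s t : ℝ), a + b + a * b + 1 ≤ lam → s ≤ t →
      IsQuasiGeodesicOn a b β (Icc s t) → Metric.infDist (β s) Z ≤ lam → ∀ x ∈ Icc s t,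
        Metric.infDist (β x) Z ≤ M * κ (dist (β x) o) ∨
          0 < Metric.infDist (β t) Z ∧ ∃ x' ∈ Icc s x,
            t - x' ≤ A * (κ (dist (β x') o) + Metric.infDist (β t) Z + κ (dist (β t) o)) := by
  obtain ⟨M, A, hM, hA, h⟩ := hZ.exists_excursion hκ hlam
  obtain ⟨C, hC0, hC⟩ := exists_infDist_le_of_excursion hκ o Z lam M A hlam hA hM
  obtain ⟨G, hG1, hG⟩ := hκ.exists_dist_comparison o lam
  have hG0 : 0 ≤ C * G := by positivity
  refine ⟨C * G + lam, A, by positivity, hA, fun a b β s t hab hst hβ hs x hx => ?_⟩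
  have hc := (hβ.isCoarseGeodesic_sample hst).mono hab
  obtain ⟨-, ha, hb, hqi⟩ := hβ
  obtain ⟨c, hcdef⟩ : ∃ c : ℕ → X, c = fun i : ℕ => β (min (s + i) t) := ⟨_, rfl⟩
  rw [← hcdef] at hc
  have hci : ∀ i : ℕ, s + i ≤ t → c i = β (s + i) := fun i hi => by
    rw [hcdef]
    simp only [min_eq_left hi]
  have hcT : c ⌈t - s⌉₊ = β t := by
    rw [hcdef]
    have := Nat.le_ceil (t - s)
    simp only [min_eq_right (show t ≤ s + ⌈t - s⌉₊ by linarith)]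
  have hxs : 0 ≤ x - s := by linarith [hx.1]
  have hi1 := Nat.floor_le hxs
  have hi2 := Nat.lt_floor_add_one (x - s)
  have hiT : ⌊x - s⌋₊ ≤ ⌈t - s⌉₊ :=
    (Nat.floor_le_floor (by linarith [hx.2])).trans (Nat.floor_le_ceil _)
  obtain ⟨s', e, hs', he, heT, h1, h2, h3⟩ := h c _ hc (by
    rw [hci 0 (by simpa using hst)]; simpa using hs) _ hiT
  by_cases h4 : Metric.infDist (c e) Z ≤ M * κ (dist (c e) o)
  · left
    have h5 := hC c _ s' _ e hc hs' he heT h1 h2 h4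
    have h6 : dist (c ⌊x - s⌋₊) (β x) ≤ lam := by
      rw [hci _ (by linarith [hx.2])]
      refine (hqi _ ⟨by linarith [hx.1], by linarith [hx.2]⟩ x hx).2.trans ?_
      have : |s + ⌊x - s⌋₊ - x| ≤ 1 := by
        rw [abs_le]
        constructor <;> linarith
      have h7 := mul_le_mul_of_nonneg_left this (zero_le_one.trans ha)
      have : 0 ≤ a * b := by positivity
      linarith
    have hk1 := hκ.one_le _ (dist_nonneg (x := c ⌊x - s⌋₊) (y := o))
    have hk2 := hκ.one_le _ (dist_nonneg (x := β x) (y := o))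
    have h7 := (hG (c ⌊x - s⌋₊) (β x) (by nlinarith)).1
    have h8 := Metric.infDist_le_infDist_add_dist (s := Z) (x := β x) (y := c ⌊x - s⌋₊)
    rw [dist_comm] at h8
    have h9 := mul_le_mul_of_nonneg_left h7 hC0
    nlinarith
  · right
    obtain rfl := h3.resolve_left h4
    rw [hcT] at h2 h4
    have hs'x : s + s' ≤ x := by
      have : (s' : ℝ) ≤ ⌊x - s⌋₊ := by exact_mod_cast hs'
      linarith
    rw [hci s' (hs'x.trans hx.2)] at h2
    refine ⟨?_, s + s', ⟨le_add_of_nonneg_right (Nat.cast_nonneg _), hs'x⟩, ?_⟩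
    · have := hκ.one_le _ (dist_nonneg (x := β t) (y := o))
      exact (show 0 ≤ M * κ (dist (β t) o) by positivity).trans_lt (not_le.1 h4)
    · have := Nat.le_ceil (t - s)
      linarith

/-- With the final point on `Z`, the alternative of an unfinished excursion is excluded, since it
requires positive distance from `Z` there. -/
theorem IsKappaContracting.isWeaklyKappaMorse (hκ : IsSublinearGauge κ)
    (hZ : IsKappaContracting o κ Z) : IsWeaklyKappaMorse o κ Z := by
  obtain ⟨hclosed, π, hπ⟩ := hZ
  refine ⟨hclosed, ?_⟩
  have h : ∀ a b : ℝ, ∃ M, ∀ (β : ℝ → X) (s t : ℝ), s ≤ t → IsQuasiGeodesicOn a b β (Icc s t) →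
      β s ∈ Z → β t ∈ Z → β '' Icc s t ⊆ kappaNhd o κ Z M := by
    intro a b
    by_cases hab : 0 ≤ a ∧ 0 ≤ b
    · have h1 := mul_nonneg hab.1 hab.2
      obtain ⟨M, A, -, -, hM⟩ := hπ.exists_excursion_quasiGeodesic hκ
        (show 1 ≤ a + b + a * b + 1 by linarith [hab.1, hab.2])
      refine ⟨M, fun β s t hst hβ hs ht => ?_⟩
      rintro _ ⟨x, hx, rfl⟩
      refine (hM a b β s t le_rfl hst hβ ?_ x hx).resolve_right fun h => ?_
      · rw [Metric.infDist_zero_of_mem hs]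
        linarith [hab.1, hab.2]
      · rw [Metric.infDist_zero_of_mem ht] at h
        exact lt_irrefl _ h.1
    · exact ⟨0, fun β s t _ hβ => absurd ⟨zero_le_one.trans hβ.2.1, hβ.2.2.1⟩ hab⟩
  choose M hM using h
  exact ⟨M, fun a b β s t hst hβ hs ht => hM a b β s t hst hβ hs ht⟩

theorem IsSublinear.eventually_le {κ' : ℝ → ℝ} (h : IsSublinear κ') {ε : ℝ} (hε : 0 < ε) :
    ∀ᶠ R in atTop, κ' R ≤ ε * R := by
  obtain ⟨T, -, hT⟩ := h.exists_le_of_large hε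
  exact eventually_atTop.2 ⟨T, hT⟩

theorem IsSublinearGauge.eventually_lt (hκ : IsSublinearGauge κ) {κ' : ℝ → ℝ}
    (hκ' : IsSublinear κ') (A c lam : ℝ) (hA : 0 ≤ A) :
    ∀ᶠ R in atTop, A * (c + κ' R + κ R) + lam < R := by
  obtain ⟨B, -, hB⟩ := hκ.small (1 / (4 * (A + 1))) (by positivity)
  filter_upwards [hκ'.eventually_le (show 0 < 1 / (4 * (A + 1)) by positivity),
    eventually_gt_atTop (2 * (A * (c + B) + lam)), eventually_ge_atTop 0] with R h1 h2 h3
  have h4 := hB R h3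
  have h5 : A * (c + κ' R + κ R) ≤ A * (c + 1 / (4 * (A + 1)) * R + (1 / (4 * (A + 1)) * R + B)) :=
    mul_le_mul_of_nonneg_left (by linarith) hA
  have h6 : A * (1 / (4 * (A + 1)) * R) ≤ R / 4 := by
    rw [show A * (1 / (4 * (A + 1)) * R) = (A / (A + 1)) * (R / 4) by field_simp]
    have : A / (A + 1) ≤ 1 := by
      rw [div_le_one (by positivity)]
      linarith
    have := mul_le_mul_of_nonneg_right this (show 0 ≤ R / 4 by linarith)
    linarith
  linarith

/-- An excursion that begins before radius `r` and is unfinished at radius `R` would last at most a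
multiple of `κ r + κ' R + κ R`. This is sublinear in `R`, too short to travel from radius `r` to
radius `R`. The threshold for `R` depends only on `lam`, `κ'` and `r`. -/
theorem IsKappaContractingWith.eventually_subset (hκ : IsSublinearGauge κ)
    (hZ : IsKappaContractingWith o κ Z π) (ho : o ∈ Z) {lam : ℝ} (hlam : 1 ≤ lam) :
    ∃ M, 0 ≤ M ∧ ∀ κ', IsSublinear κ' → ∀ r, 0 < r → ∀ᶠ R in atTop, ∀ (a b : ℝ) (β : ℝ → X),
      a + b + a * b + 1 ≤ lam → IsQuasiGeodesicOn a b β (Ici 0) → β 0 = o →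
      Metric.infDist (β (firstTime o β R)) Z ≤ κ' R →
      β '' Icc 0 (firstTime o β r) ⊆ kappaNhd o κ Z M := by
  obtain ⟨M, A, hM0, hA0, hM⟩ := hZ.exists_excursion_quasiGeodesic hκ hlam
  refine ⟨M, hM0, fun κ' hκ' r hr => ?_⟩
  filter_upwards [hκ.eventually_lt hκ' (lam * A) (κ r) (lam + r) (by positivity),
    eventually_gt_atTop r] with R hR hrR a b β hab hβ hβ0 hend
  obtain ⟨hR0, hRd, hRle⟩ := hβ.firstTime_spec hβ0 (hr.le.trans hrR.le)
  obtain ⟨hr0, hrd, hrle⟩ := hβ.firstTime_spec hβ0 hr.le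
  have hle : firstTime o β r ≤ firstTime o β R := by
    by_contra! h
    have := hrle _ hR0 h.le
    linarith
  rintro _ ⟨x, hx, rfl⟩
  refine (hM a b β 0 (firstTime o β R) hab hR0
    ⟨hβ.1.mono fun y hy => hy.1, hβ.2.1, hβ.2.2.1, fun y hy z hz => hβ.2.2.2 y hy.1 z hz.1⟩ ?_ x
    ⟨hx.1, hx.2.trans hle⟩).resolve_right fun h => ?_
  · rw [hβ0, Metric.infDist_zero_of_mem ho]
    linarith
  · obtain ⟨-, x', hx', h⟩ := h
    have h1 := hrle x' hx'.1 (hx'.2.trans hx.2)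
    have h2 : κ (dist (β x') o) ≤ κ r := hκ.mono (mem_Ici.2 dist_nonneg) (mem_Ici.2 hr.le) h1
    have h3 := (hβ.2.2.2 _ (mem_Ici.2 hR0) x' hx'.1).2
    have h4 := dist_triangle (β (firstTime o β R)) (β x') o
    rw [abs_of_nonneg (by linarith [hx'.2, hx.2])] at h3
    have ha := hβ.2.1
    have hb := hβ.2.2.1
    have hab' : 0 ≤ a * b := by positivity
    have h5 : a * (firstTime o β R - x') ≤ lam * (A * (κ r + κ' R + κ R)) := by
      refine mul_le_mul (by linarith) (h.trans ?_) (by linarith [hx'.2, hx.2]) (by linarith)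
      rw [hRd]
      exact mul_le_mul_of_nonneg_left (by linarith) hA0
    linarith

theorem IsKappaContracting.isKappaMorse (hκ : IsSublinearGauge κ)
    (hZ : IsKappaContracting o κ Z) (ho : o ∈ Z) : IsKappaMorse o κ Z := by
  obtain ⟨hclosed, π, hπ⟩ := hZ
  choose M hM0 hM using fun n : ℕ => hπ.eventually_subset hκ ho
    (show (1 : ℝ) ≤ n + 1 by linarith [Nat.cast_nonneg (α := ℝ) n])
  -- Rounding the constants up leaves countably many bounds `M n`. The summands `a + b + 1` make the
  -- gauge positive and proper.
  refine ⟨hclosed, fun a b => M ⌈a + b + a * b⌉₊ + a + b + 1, ⟨fun a b ha hb => ?_, fun B =>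
    ⟨B, fun a b ha hb h => ?_⟩⟩, fun κ' hκ' r hr => ?_⟩
  · have := hM0 ⌈a + b + a * b⌉₊
    linarith
  · have := hM0 ⌈a + b + a * b⌉₊
    constructor <;> linarith
  -- Smallness compared to `r` bounds `a` and `b` by `B`. So only finitely many `n` occur, and a
  -- single `R` serves them all.
  obtain ⟨B, hB⟩ : ∃ B, B = r / (2 * κ r) := ⟨_, rfl⟩
  have hev : ∀ᶠ R in atTop, ∀ n ∈ Finset.range (⌈B + B + B * B⌉₊ + 1), ∀ (a b : ℝ) (β : ℝ → X),
      a + b + a * b + 1 ≤ n + 1 → IsQuasiGeodesicOn a b β (Ici 0) → β 0 = o →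
      Metric.infDist (β (firstTime o β R)) Z ≤ κ' R →
      β '' Icc 0 (firstTime o β r) ⊆ kappaNhd o κ Z (M n) :=
    (Filter.eventually_all_finset _).2 fun n _ => hM n κ' hκ' r hr
  obtain ⟨R, hR, hrR⟩ := (hev.and (eventually_ge_atTop r)).exists
  refine ⟨R, hrR, fun a b β hβ hβ0 hsmall hend => ?_⟩
  have ha := hβ.2.1
  have hb := hβ.2.2.1
  have h0 := hM0 ⌈a + b + a * b⌉₊
  have hsmall' : M ⌈a + b + a * b⌉₊ + a + b + 1 ≤ B := hB ▸ hsmall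
  have hn : ⌈a + b + a * b⌉₊ ≤ ⌈B + B + B * B⌉₊ := by
    refine Nat.ceil_le_ceil ?_
    have : a * b ≤ B * B := mul_le_mul (by linarith) (by linarith) hb (by linarith)
    linarith
  refine (hR _ (Finset.mem_range.2 (Nat.lt_succ_of_le hn)) a b β
    (by linarith [Nat.le_ceil (a + b + a * b)]) hβ hβ0 hend).trans fun x hx => ?_
  have h1 : Metric.infDist x Z ≤ M ⌈a + b + a * b⌉₊ * κ (dist x o) := hx
  have h2 := hκ.one_le _ (dist_nonneg (x := x) (y := o))
  change Metric.infDist x Z ≤ (M ⌈a + b + a * b⌉₊ + a + b + 1) * κ (dist x o)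
  refine h1.trans (mul_le_mul_of_nonneg_right (by linarith) (by linarith))

theorem isKappaContractingWith_singleton {P : X → X} (hP : ∀ x, P x ∈ Z) {D₁ D₂ C₁ C₂ : ℝ}
    (hD₁ : 0 ≤ D₁) (hD₂ : 0 ≤ D₂) (hC₁ : 0 < C₁) (hC₂ : 0 ≤ C₂) (hκ : ∀ x, 0 ≤ κ (dist x o))
    (hproj : ∀ x, dist x (P x) ≤ (D₁ + 1) * Metric.infDist x Z + D₂ * κ (dist x o))
    (hcon : ∀ x y, dist x y < C₁ * Metric.infDist x Z → dist (P x) (P y) ≤ C₂ * κ (dist x o)) :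
    IsKappaContractingWith o κ Z (fun x => {P x}) := by
  refine ⟨⟨fun x => ⟨singleton_nonempty _, singleton_subset_iff.2 (hP x)⟩,
    D₁, D₂, hD₁, hD₂, fun x p hp p' hp' => ?_⟩, C₁, C₂, hC₁, fun x y hxy p hp p' hp' => ?_⟩
  · have h := hproj x
    have h0 := dist_nonneg.trans h
    rcases hp with rfl | rfl <;> rcases hp' with rfl | rfl
    · rwa [dist_self]
    · exact h
    · rwa [dist_comm]
    · rwa [dist_self]
  · have h := hcon x y hxy
    have h0 := mul_nonneg hC₂ (hκ x)
    rcases hp with rfl | rfl <;> rcases hp' with rfl | rfl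
    · rwa [dist_self]
    · exact h
    · rwa [dist_comm]
    · rwa [dist_self]

variable {m : X → X → X → X} {r v : ℕ}

open MedianTerm in
theorem IsCoarseMedian.exists_dist_median_base_le (hm : IsCoarseMedian m r) :
    ∃ C, ∀ x y : X, dist (m x y x) x ≤ C := by
  obtain ⟨C, hC⟩ := hm.exists_dist_eval_le (s := med (var 0) (var 1) (var 0)) (t := var (n := 2) 0)
    (by decide)
  exact ⟨C, fun x y => hC ![x, y]⟩

/-- A guide makes the ray contracting. -/
theorem IsGuide.isKappaContracting [ProperSpace X] (hm : IsCoarseMedian m r)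
    (hLQC : IsLocallyQuasiCubical.{u, w} m r v) (hκ : IsSublinearGauge κ) {a b : ℝ} {q : ℝ → X}
    (hq : IsQIEmbeddingOn a b q (Ici 0)) (hqo : q 0 = o) (hclosed : IsClosed (rayImage q))
    {p : ℕ → X} (hp : IsGuide m o κ q p) : IsKappaContracting o κ (rayImage q) := by
  have : Nonempty X := ⟨o⟩
  have hne : (rayImage q).Nonempty := ⟨q 0, self_mem_rayImage le_rfl⟩
  obtain ⟨L, hL⟩ := hm.exists_lipschitz
  have hL0 := hL.1
  obtain ⟨Cm, hCm⟩ := hm.exists_dist_median_base_le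
  obtain ⟨C, hC0, hC⟩ := hp.exists_infDist_median_le hm hLQC hκ
  obtain ⟨C₁, C₂, hC₁, hmain⟩ := hp.exists_dist_median_le hm hLQC hκ hq hqo
  obtain ⟨Cb, hCb0, hCb⟩ := hp.back
  obtain ⟨U, hU⟩ : ∃ U : Ultrafilter ℕ, (U : Filter ℕ) ≤ atTop :=
    ⟨Ultrafilter.of atTop, Ultrafilter.of_le _⟩
  have hlip : ∀ x y n, dist (m (p 0) (p n) x) (m (p 0) (p n) y) ≤ L * dist x y + L := by
    intro x y n
    have := hL.dist_le (dist_self (p 0)).le (dist_self (p n)).le (le_refl (dist x y))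
    rwa [zero_add, zero_add] at this
  -- The medians with `p 0` and `p n` stay in a ball around `p 0`, so by properness they converge
  -- along an ultrafilter. The limit map inherits the estimates, and moving its values to the ray
  -- costs `O(κ)`.
  have hlim : ∀ x, ∃ y, Tendsto (fun n => m (p 0) (p n) x) U (𝓝 y) := fun x =>
    exists_ultralimit U (x := p 0) (R := (L * dist x (p 0) + L) + Cm)
      (Eventually.of_forall fun n => (dist_triangle _ _ _).trans
        (add_le_add (hlip x (p 0) n) (hCm (p 0) (p n))))
  choose P hP using hlim
  have hP1 : ∀ x, Metric.infDist (P x) (rayImage q) ≤ C * κ (dist x o) := fun x =>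
    le_of_tendsto ((Metric.continuous_infDist_pt _).continuousAt.tendsto.comp (hP x)) (hU (hC x))
  have hP2 : ∀ x y, dist (P x) (P y) ≤ L * dist x y + L := fun x y =>
    le_of_tendsto ((hP x).dist (hP y)) (Eventually.of_forall fun n => hlip x y n)
  have hP3 : ∀ x y, dist x y ≤ C₁ * Metric.infDist x (rayImage q) →
      dist (P x) (P y) ≤ C₂ * κ (dist x o) := fun x y hxy =>
    le_of_tendsto ((hP x).dist (hP y)) (hU (hmain x y hxy))
  have hP4 : ∀ t, 0 ≤ t → dist (q t) (P (q t)) ≤ Cb * κ (dist (q t) o) := fun t ht =>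
    le_of_tendsto (tendsto_const_nhds.dist (hP (q t)))
      (hU ((hCb t).mono fun n hn => hn t ht le_rfl))
  have hk : ∀ x : X, 1 ≤ κ (dist x o) := fun x => hκ.one_le _ dist_nonneg
  have hN : ∀ x, ∃ z ∈ rayImage q, dist (P x) z < (C + 1) * κ (dist x o) := fun x =>
    (Metric.infDist_lt_iff hne).1 (by linarith [hP1 x, hk x])
  choose N hNmem hN using hN
  have hIo : ∀ x, Metric.infDist x (rayImage q) ≤ dist x o := fun x =>
    Metric.infDist_le_dist_of_mem (hqo ▸ self_mem_rayImage le_rfl)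
  obtain ⟨G, hG1, hG⟩ := hκ.growth 2 1
  obtain ⟨G', hG'1, hG'⟩ := hκ.growth (1 + C₁) 0
  refine ⟨hclosed, fun x => {N x}, isKappaContractingWith_singleton (D₁ := L)
    (D₂ := 1 + Cb * G + 2 * L + (C + 1)) (C₁ := C₁) (C₂ := (C + 1) + |C₂| + (C + 1) * G') hNmem hL0
    (by positivity) hC₁ (by positivity) (fun x => zero_le_one.trans (hk x)) (fun x => ?_)
    fun x y hxy => ?_⟩
  · obtain ⟨_, ⟨t, ht, rfl⟩, hz⟩ := (Metric.infDist_lt_iff hne).1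
      (lt_add_one (Metric.infDist x (rayImage q)))
    have e1 := dist_triangle4 x (q t) (P (q t)) (P x)
    have e2 := dist_triangle x (P x) (N x)
    have e3 := hP4 t ht
    have e4 := hP2 (q t) x
    rw [dist_comm (q t) x] at e4
    have e5 := hN x
    have e6 : κ (dist (q t) o) ≤ G * κ (dist x o) := by
      refine hG _ _ dist_nonneg dist_nonneg ?_
      have := dist_triangle_left (q t) o x
      linarith [hIo x]
    have e7 := mul_le_mul_of_nonneg_left e6 hCb0
    have e8 : L * dist x (q t) ≤ L * (Metric.infDist x (rayImage q) + 1) :=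
      mul_le_mul_of_nonneg_left hz.le hL0
    have e9 : (1 + 2 * L) * 1 ≤ (1 + 2 * L) * κ (dist x o) :=
      mul_le_mul_of_nonneg_left (hk x) (by positivity)
    linarith
  · have e1 := dist_triangle4 (N x) (P x) (P y) (N y)
    have e2 := hN x
    have e3 := hN y
    have e4 := hP3 x y hxy.le
    have e5 : κ (dist y o) ≤ G' * κ (dist x o) := by
      refine hG' _ _ dist_nonneg dist_nonneg ?_
      have := dist_triangle_left y o x
      have := mul_le_mul_of_nonneg_left (hIo x) hC₁.le
      linarith
    have e6 := mul_le_mul_of_nonneg_left e5 (show 0 ≤ C + 1 by linarith)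
    have e7 : C₂ * κ (dist x o) ≤ |C₂| * κ (dist x o) :=
      mul_le_mul_of_nonneg_right (le_abs_self _) (by linarith [hk x])
    rw [dist_comm] at e2
    linarith

/-- The projection to the hull of a median ray that represents a ray with a guide. -/
theorem IsMedianRay.isKappaContractingWith_hull (hm : IsCoarseMedian m r)
    (hLQC : IsLocallyQuasiCubical.{u, w} m r v) (hκ : IsSublinearGauge κ) {a b : ℝ} {q : ℝ → X}
    (hq : IsQIEmbeddingOn a b q (Ici 0)) (hqo : q 0 = o) {l : ℝ} {h : ℝ → X}
    (hh : IsMedianRay m l h) {n₀ : ℝ} (hqh : rayImage q ⊆ kappaNhd o κ (rayImage h) n₀)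
    (hp : IsGuide m o κ q (fun n => h n)) {G : X → X}
    (hGH : ∀ x, G x ∈ medianHull m r (rayImage h)) {Cg : ℝ}
    (hG : ∀ x, ∀ᶠ n : ℕ in atTop, dist (G x) (m (h 0) (h n) x) ≤ Cg) :
    IsCoarselyLipschitz G ∧
      IsKappaContractingWith o κ (medianHull m r (rayImage h)) (fun x => {G x}) ∧
      ∃ C₂ C₃ : ℝ, 0 < C₂ ∧ ∀ x y,
        dist x y ≤ C₂ * Metric.infDist x (medianHull m r (rayImage h)) →
        dist (G x) (G y) ≤ C₃ * κ (dist x o) := by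
  have : Nonempty X := ⟨o⟩
  obtain ⟨H, hH⟩ : ∃ H, H = medianHull m r (rayImage h) := ⟨_, rfl⟩
  have hhne : (rayImage h).Nonempty := ⟨h 0, self_mem_rayImage le_rfl⟩
  have hqne : (rayImage q).Nonempty := ⟨q 0, self_mem_rayImage le_rfl⟩
  have hHne : H.Nonempty := ⟨G o, hH ▸ hGH o⟩
  obtain ⟨L, hL⟩ := hm.exists_lipschitz
  have hL0 := hL.1
  obtain ⟨Cn, hCn⟩ := hm.exists_near_medianHull 0
  obtain ⟨Ch, hCh⟩ := hh.exists_dist_median_le hm r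
  obtain ⟨C₁, C₂, hC₁, hmain⟩ := hp.exists_dist_median_le hm hLQC hκ hq hqo
  rw [← hH] at hCh hGH ⊢
  simp only [Nat.cast_zero] at hmain
  have hk : ∀ x : X, 1 ≤ κ (dist x o) := fun x => hκ.one_le _ dist_nonneg
  have hCg : 0 ≤ Cg := by
    obtain ⟨n, hn⟩ := (hG o).exists
    exact dist_nonneg.trans hn
  have hpush : ∀ x y δ, (∀ᶠ n : ℕ in atTop, dist (m (h 0) (h n) x) (m (h 0) (h n) y) ≤ δ) →
      dist (G x) (G y) ≤ Cg + δ + Cg := by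
    intro x y δ hδ
    obtain ⟨n, h1, h2, h3⟩ := ((hG x).and ((hG y).and hδ)).exists
    rw [dist_comm] at h2
    exact (dist_triangle4 _ _ _ _).trans (add_le_add (add_le_add h1 h3) h2)
  have hlip : ∀ x y, dist (G x) (G y) ≤ L * dist x y + (L + 2 * Cg) := by
    intro x y
    have := hpush x y (L * dist x y + L) (Eventually.of_forall fun n => by
      have := hL.dist_le (dist_self (h 0)).le (dist_self (h n)).le (le_refl (dist x y))
      rwa [zero_add, zero_add] at this)
    linarith
  have hfix : ∀ z ∈ H, dist z (G z) ≤ |Ch| + Cg := by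
    intro z hz
    obtain ⟨n, h1, h2⟩ := ((hG z).and (hCh z hz)).exists
    rw [dist_comm] at h1
    linarith [dist_triangle z (m (h 0) (h n) z) (G z), le_abs_self Ch]
  obtain ⟨g, hg1, hg⟩ := hκ.growth 2 1
  obtain ⟨E, hE⟩ : ∃ E, E = 1 + |n₀| * g + |Cn| + 1 := ⟨_, rfl⟩
  have hE0 : 0 ≤ E := by rw [hE]; positivity
  -- The ray `q` lies `κ`-close to `h`, hence to the hull. A point far from the hull on the scale of
  -- `κ` is therefore far from `q`, where contraction is known.
  have hdist : ∀ x, Metric.infDist x H ≤ Metric.infDist x (rayImage q) + E * κ (dist x o) := by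
    intro x
    obtain ⟨z, hz, hxz⟩ := (Metric.infDist_lt_iff hqne).1
      (lt_add_one (Metric.infDist x (rayImage q)))
    have h1 : Metric.infDist z (rayImage h) ≤ n₀ * κ (dist z o) := hqh hz
    obtain ⟨y, hy, hzy⟩ := (Metric.infDist_lt_iff hhne).1
      (lt_add_one (Metric.infDist z (rayImage h)))
    obtain ⟨y', hy', hyy'⟩ := hCn (rayImage h) y hy
    rw [← hH] at hy'
    have h2 := Metric.infDist_le_dist_of_mem (x := x) hy'
    have h3 := dist_triangle4 x z y y'
    have h4 : κ (dist z o) ≤ g * κ (dist x o) := by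
      refine hg _ _ dist_nonneg dist_nonneg ?_
      have := dist_triangle_left z o x
      have : Metric.infDist x (rayImage q) ≤ dist x o :=
        Metric.infDist_le_dist_of_mem (hqo ▸ self_mem_rayImage le_rfl)
      linarith
    have h5 : n₀ * κ (dist z o) ≤ |n₀| * (g * κ (dist x o)) :=
      mul_le_mul (le_abs_self _) h4 (zero_le_one.trans (hk z)) (abs_nonneg _)
    have h6 : (1 + 1 + |Cn|) * 1 ≤ (1 + 1 + |Cn|) * κ (dist x o) :=
      mul_le_mul_of_nonneg_left (hk x) (by positivity)
    rw [hE]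
    linarith [le_abs_self Cn]
  obtain ⟨F, hF⟩ : ∃ F, F = L * (C₁ * E) + L + 2 * Cg + |C₂| := ⟨_, rfl⟩
  have hF0 : 0 ≤ F := by rw [hF]; positivity
  have hcon : ∀ x y, dist x y ≤ C₁ / 2 * Metric.infDist x H →
      dist (G x) (G y) ≤ F * κ (dist x o) := by
    intro x y hxy
    have e1 : (L + 2 * Cg) * 1 ≤ (L + 2 * Cg) * κ (dist x o) :=
      mul_le_mul_of_nonneg_left (hk x) (by positivity)
    have e2 : 0 ≤ |C₂| * κ (dist x o) := mul_nonneg (abs_nonneg _) (zero_le_one.trans (hk x))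
    have e3 : 0 ≤ L * (C₁ * E) * κ (dist x o) :=
      mul_nonneg (by positivity) (zero_le_one.trans (hk x))
    have e4 : C₂ * κ (dist x o) ≤ |C₂| * κ (dist x o) :=
      mul_le_mul_of_nonneg_right (le_abs_self _) (by linarith [hk x])
    rw [hF]
    -- Near the hull, `y` is within `O(κ)` of `x` and coarse Lipschitz continuity suffices. Away
    -- from it, the distance to the hull is at most twice the distance to `q`, which accounts for
    -- the constant `C₁ / 2`.
    rcases le_total (Metric.infDist x H) (2 * E * κ (dist x o)) with hc | hc
    · have h1 : dist x y ≤ C₁ * E * κ (dist x o) := by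
        have := mul_le_mul_of_nonneg_left hc (show 0 ≤ C₁ / 2 by positivity)
        linarith
      have h2 := mul_le_mul_of_nonneg_left h1 hL0
      linarith [hlip x y]
    · have h1 : dist x y ≤ C₁ * Metric.infDist x (rayImage q) := by
        have := mul_le_mul_of_nonneg_left
          (show Metric.infDist x H ≤ 2 * Metric.infDist x (rayImage q) by linarith [hdist x])
          (show 0 ≤ C₁ / 2 by positivity)
        linarith
      have h2 := hpush x y _ (hmain x y h1)
      have e5 : 0 ≤ L * κ (dist x o) := mul_nonneg hL0 (zero_le_one.trans (hk x))
      linarith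
  refine ⟨⟨L + 2 * Cg, fun x y => ?_⟩, isKappaContractingWith_singleton (D₁ := L)
    (D₂ := 1 + |Ch| + Cg + L + L + 2 * Cg) (C₁ := C₁ / 2) hGH hL0 (by positivity) (by positivity)
    hF0 (fun x => zero_le_one.trans (hk x)) (fun x => ?_) fun x y hxy => hcon x y hxy.le,
    C₁ / 2, F, by positivity, hcon⟩
  · have : 0 ≤ Cg * dist x y := by positivity
    linarith [hlip x y]
  · obtain ⟨z, hz, hxz⟩ := (Metric.infDist_lt_iff hHne).1 (lt_add_one (Metric.infDist x H))
    have e1 := dist_triangle4 x z (G z) (G x)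
    have e2 := hfix z hz
    have e3 := hlip z x
    rw [dist_comm z x] at e3
    have e4 : L * dist x z ≤ L * (Metric.infDist x H + 1) := mul_le_mul_of_nonneg_left hxz.le hL0
    have e5 : (1 + |Ch| + Cg + L + L + 2 * Cg) * 1 ≤
      (1 + |Ch| + Cg + L + L + 2 * Cg) * κ (dist x o) :=
      mul_le_mul_of_nonneg_left (hk x) (by positivity)
    linarith

end Equivalence

theorem mainTheorem2 {X : Type u} [MetricSpace X] [ProperSpace X]
    (hgeod : IsGeodesicMetric X)
    (m : X → X → X → X) (r v : ℕ) (hm : IsCoarseMedian m r)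
    (hLQC : IsLocallyQuasiCubical.{u, w} m r v)
    (o : X) (κ : ℝ → ℝ) (hκ : IsSublinear κ) (hmono : MonotoneOn κ (Ici 0))
    (hconc : ConcaveOn ℝ (Ici 0) κ)
    (a b : ℝ) (q : ℝ → X) (hq : IsQuasiGeodesicOn a b q (Ici 0)) (hqo : q 0 = o) :
    List.TFAE
      [IsKappaMorse o κ (rayImage q),
        IsKappaContracting o κ (rayImage q),
        IsWeaklyKappaMorse o κ (rayImage q)] ∧
    ((IsKappaMorse o κ (rayImage q) ∨ IsKappaContracting o κ (rayImage q) ∨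
        IsWeaklyKappaMorse o κ (rayImage q)) →
      ∀ (l : ℝ) (h : ℝ → X), IsMedianRay m l h →
        KappaFellowTravel o κ (rayImage h) (rayImage q) →
        ∃ G : X → X,
          (∀ x, G x ∈ medianHull m r (rayImage h)) ∧
          IsCubicalGateMap.{u, w} m r v (rayImage h) G ∧
          IsCoarselyLipschitz G ∧
          IsKappaContractingWith o κ (medianHull m r (rayImage h)) (fun x => {G x}) ∧
          ∃ C₂ C₃ : ℝ, 0 < C₂ ∧ ∀ x y,
            dist x y ≤ C₂ * Metric.infDist x (medianHull m r (rayImage h)) →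
            dist (G x) (G y) ≤ C₃ * κ (dist x o)) := by
  have hg := hκ.isSublinearGauge hmono hconc
  have ho : o ∈ rayImage q := hqo ▸ self_mem_rayImage le_rfl
  -- Both Morse conditions include closedness of the ray and imply `HasMorseRays`, so they lead to
  -- contraction along the same path.
  have hcon : IsClosed (rayImage q) → HasMorseRays o κ (rayImage q) →
      IsKappaContracting o κ (rayImage q) := fun hc hW =>
    (hq.isGuide hgeod hm hLQC hg hqo hW).isKappaContracting hm hLQC hg hq.2 hqo hc
  have h12 : IsKappaMorse o κ (rayImage q) → IsKappaContracting o κ (rayImage q) := fun h =>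
    hcon h.1 (h.hasMorseRays hgeod hg)
  have h32 : IsWeaklyKappaMorse o κ (rayImage q) → IsKappaContracting o κ (rayImage q) := fun h =>
    hcon h.1 (h.hasMorseRays hgeod ho)
  have h23 : IsKappaContracting o κ (rayImage q) → IsWeaklyKappaMorse o κ (rayImage q) := fun h =>
    h.isWeaklyKappaMorse hg
  refine ⟨?_, fun hany l h hh hhq => ?_⟩
  · tfae_have 1 → 2 := h12
    tfae_have 2 → 1 := fun h => h.isKappaMorse hg ho
    tfae_have 2 → 3 := h23
    tfae_have 3 → 2 := h32
    tfae_finish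
  · have hW : HasMorseRays o κ (rayImage q) :=
      (h23 (hany.elim h12 (fun h => h.elim id h32))).hasMorseRays hgeod ho
    obtain ⟨G, hGH, hGg, Cg, hG⟩ := hh.exists_cubicalGateMap hm hLQC
    exact ⟨G, hGH, hGg, hh.isKappaContractingWith_hull hm hLQC hg hq.2 hqo hhq.2.choose_spec
      (hh.isGuide hgeod hm hg hq hqo hW hhq) hGH hG⟩
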